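/- **Setting.** Let $(\Omega,\mathcal F,(\mathcal F_t),P)$ be a filtered probability space with a totally ordered time set that has a last element $T$, and $\mathcal F_T=\mathcal F$. Let $p,q\in[1,\infty]$ with $\frac1p+\frac1q=1$ and $1\le m\le d$. Let $M=\mathbb R^m\times\{0\}^{d-m}$, $M_+=M\cap\mathbb R^d_+$, $M^\perp$ its orthogonal space, and for $C\subseteq\mathbb R^d$ let $C^+=\{v: v^{\mathsf T}u\ge0\ \forall u\in C\}$. For a (random) set $D$, $L^p_t(D)$ is the set of classes of $\mathcal F_t$-measurable, $p$-integrable (essentially bounded if $p=\infty$) random vectors with values a.s. in $D$; $L^p=L^p_T(\mathbb R^d)$, $M_t=L^p_t(M)$, $M_{t,+}=L^p_t(M_+)$, $M_{t,-}=-M_{t,+}$, and $M_{s,+}^+=\{f\in L^q_s(\mathbb R^d): E[f^{\mathsf T}u]\ge0\ \forall u\in M_{s,+}\}$. $L^p$ carries the norm topology if $p<\infty$ and the weak* topology $\sigma(L^\infty,L^1)$ if $p=\infty$. Let $R_t:L^p\to 2^{M_t}$ be a conditional risk measure: $R_t(X)=R_t(X)+M_{t,+}$; $R_t(X)\subseteq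 R_t(Y)$ whenever $Y-X\ge0$ a.s.; $R_t(X+k)=R_t(X)-k$ for $k\in M_t$; and $R_t(0)$ is non-empty, closed, $\mathcal F_t$-decomposable and equal to $L^p_t(\tilde R_t(0))$ for an $\mathcal F_t$-measurable random closed set $\tilde R_t(0)$ with $P(\tilde R_t(0)=M)=0$. Assume moreover that $R_t$ is - normalized: $R_t(X)=R_t(X)+R_t(0)$ for all $X$; - conditionally convex: $R_t(\lambda X+(1-\lambda)Y)\supseteq\lambda R_t(X)+(1-\lambda)R_t(Y)$ for all $X,Y$ and all $\mathcal F_t$-measurable $\lambda$ with values in $[0,1]$; - convex upper continuous: $\{X: R_t(X)\cap D\neq\emptyset\}$ is closed for every $D\subseteq M_t$ with $D=\operatorname{cl}\operatorname{co}(D+M_{t,-})$. Let $A_t=\{X\in L^p: 0\in R_t(X)\}$ and $\rho_t^w(X)=\operatorname{ess\,inf}\{w^{\mathsf T}u: u\in R_t(X)\}$, and assume that $\rho_t^v(X)$ is integrable for all $X\in L^p$ and $v\in L^q_t(\tilde R_t(0)^+\setminus M^\perp)$. **Dual variables.** Let $\mathcal M^d$ be the set of $d$-tuples of probability measures absolutely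 continuous with respect to $P$. For $Q\in\mathcal M^d$ and times $t\le s$, put $w_t^s(Q,w)=\big(w_i\,\bar\xi_{t,s}(Q_i)\big)_{i\le d}$, where $\bar\xi_{t,s}(Q_i)=E[\tfrac{dQ_i}{dP}|\mathcal F_s]\big/E[\tfrac{dQ_i}{dP}|\mathcal F_t]$ if the denominator is positive, and $1$ otherwise. Let $$\mathcal W_{t,s}(w)=\{(Q,m_\perp)\in\mathcal M^d\times L^q_t(M^\perp): w+m_\perp\in L^q_t(M_+^+\setminus M^\perp),\ w_t^s(Q,w+m_\perp)\in M_{s,+}^+\},$$ $$\mathcal W_s(v)=\{(R,n_\perp)\in\mathcal M^d\times L^q_s(M^\perp): v+n_\perp\in M_{s,+}^+,\ w_s^T(R,v+n_\perp)\in L^q_T(\mathbb R^d_+)\}\qquad(v\in M_{s,+}^+),$$ $$\beta_{t,s}^w(Q,m_\perp,R,n_\perp)=\operatorname*{ess\,sup}_{Z\in A_t}E\big[w_s^T(R,w_t^s(Q,w+m_\perp)+n_\perp)^{\mathsf T}(-Z)\,\big|\,\mathcal F_t\big],$$ and let $\widetilde{\mathcal W}_{t,s}(w)$ be the set of all $(Q,m_\perp,R,n_\perp)$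 with $(Q,m_\perp)\in\mathcal W_{t,s}(w)$, $(R,n_\perp)\in\mathcal W_s(w_t^s(Q,w+m_\perp))$ and $E[\beta_{t,s}^w(Q,m_\perp,R,n_\perp)]<+\infty$. Essential suprema over the empty set are $-\infty$. **Proposition.** Let $t\le s$ $(\le T)$, $w\in L^q_t(M_+^+\setminus M^\perp)$ and $X\in L^p$. Then a.s. $$\rho_t^w(X)=\operatorname*{ess\,sup}_{(Q,m_\perp)\in\mathcal W_{t,s}(w)}\ \operatorname*{ess\,sup}_{(R,n_\perp)\in\mathcal W_s(w_t^s(Q,w+m_\perp))}\Big(-\beta_{t,s}^w(Q,m_\perp,R,n_\perp)+E\big[w_s^T(R,w_t^s(Q,w+m_\perp)+n_\perp)^{\mathsf T}(-X)\,\big|\,\mathcal F_t\big]\Big).$$ Moreover, a.s. $$\rho_t^w(X)=\operatorname*{ess\,sup}_{(Q,m_\perp,R,n_\perp)\in\widetilde{\mathcal W}_{t,s}(w)}\Big(-\beta_{t,s}^w(Q,m_\perp,R,n_\perp)+E\big[w_s^T(R,w_t^s(Q,w+m_\perp)+n_\perp)^{\mathsf T}(-X)\,\big|\,\mathcal F_t\big]\Big).$$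 -/

import Mathlib

open MeasureTheory Filter
open scoped ENNReal Pointwise

/-! ### Essential suprema and infima of arbitrary families of extended real random variables -/

section EssentialSupremum

variable {Ω : Type*} {mΩ : MeasurableSpace Ω}

/-- `g` is (a version of) the essential supremum of the family `S`: the `P`-a.s. least measurable
`P`-a.s. upper bound. -/
structure IsFamilyEssSup (P : Measure Ω) (S : Set (Ω → EReal)) (g : Ω → EReal) : Prop where
  measurable : Measurable g
  upper : ∀ f ∈ S, f ≤ᵐ[P] g
  least : ∀ h : Ω → EReal, AEMeasurable h P → (∀ f ∈ S, f ≤ᵐ[P] h) → g ≤ᵐ[P] h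

theorem exists_isFamilyEssSup (P : Measure Ω) [IsProbabilityMeasure P] (S : Set (Ω → EReal)) :
    ∃ g, IsFamilyEssSup P S g := by
  classical
  let φ : EReal → ℝ≥0∞ := fun x => (1 + x.exp)⁻¹
  have hφ : StrictAnti φ := by
    intro a b hab
    refine ENNReal.inv_strictAnti ?_
    exact (ENNReal.add_lt_add_iff_left ENNReal.one_ne_top).2 (EReal.exp_strictMono hab)
  have hφm : Measurable φ := hφ.antitone.measurable
  have hφ1 : ∀ x, φ x ≤ 1 := fun x => by
    simp only [φ, ENNReal.inv_le_one]
    exact le_self_add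
  let U : Set (Ω → EReal) := {h | Measurable h ∧ ∀ f ∈ S, f ≤ᵐ[P] h}
  have hUne : U.Nonempty := ⟨fun _ => ⊤, measurable_const, fun f _ => ae_of_all _ fun _ => le_top⟩
  let I : (Ω → EReal) → ℝ≥0∞ := fun h => ∫⁻ ω, φ (h ω) ∂P
  have hI1 : ∀ h, I h ≤ 1 := fun h => by
    calc I h ≤ ∫⁻ _, 1 ∂P := lintegral_mono fun ω => hφ1 _
      _ = 1 := by simp
  obtain ⟨v, -, hv, hvU⟩ := exists_seq_tendsto_sSup (S := I '' U) (hUne.image I) (OrderTop.bddAbove _)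
  choose u huU huv using hvU
  let g : Ω → EReal := fun ω => ⨅ n, u n ω
  have hgU : g ∈ U := by
    refine ⟨Measurable.iInf fun n => (huU n).1, fun f hf => ?_⟩
    have : ∀ᵐ ω ∂P, ∀ n, f ω ≤ u n ω := ae_all_iff.2 fun n => (huU n).2 f hf
    filter_upwards [this] with ω hω using le_iInf hω
  have hgI : ∀ h ∈ U, I h ≤ I g := by
    intro h hh
    have h1 : I h ≤ sSup (I '' U) := le_sSup ⟨h, hh, rfl⟩
    refine h1.trans (le_of_tendsto' hv fun n => ?_)
    rw [← huv n]
    exact lintegral_mono fun ω => hφ.antitone (iInf_le _ n)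
  refine ⟨g, hgU.1, hgU.2, fun h hh hS => ?_⟩
  let h' := hh.mk h
  have hh' : h =ᵐ[P] h' := hh.ae_eq_mk
  let k : Ω → EReal := fun ω => g ω ⊓ h' ω
  have hkm : Measurable k := hgU.1.inf hh.measurable_mk
  have hkU : k ∈ U := by
    refine ⟨hkm, fun f hf => ?_⟩
    filter_upwards [hgU.2 f hf, hS f hf, hh'] with ω h1 h2 h3
    exact le_inf h1 (h3 ▸ h2)
  have hle : (fun ω => φ (g ω)) ≤ᵐ[P] fun ω => φ (k ω) :=
    ae_of_all _ fun ω => hφ.antitone inf_le_left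
  have heq : (fun ω => φ (g ω)) =ᵐ[P] fun ω => φ (k ω) :=
    ae_eq_of_ae_le_of_lintegral_le hle (ne_top_of_le_ne_top ENNReal.one_ne_top (hI1 g))
      (hφm.comp hkm).aemeasurable (hgI k hkU)
  filter_upwards [heq, hh'] with ω h1 h2
  have h3 : g ω = g ω ⊓ h' ω := hφ.injective h1
  rw [h2]
  exact inf_eq_left.1 h3.symm

open Classical in
/-- The essential supremum `ess sup S` of a family of extended real random variables. It always
exists when `P` is a probability measure (`isFamilyEssSup_familyEssSup`) and is `P`-a.s. unique. -/
noncomputable def familyEssSup (P : Measure Ω) (S : Set (Ω → EReal)) : Ω → EReal :=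
  if h : ∃ g, IsFamilyEssSup P S g then h.choose else fun _ => ⊤

theorem isFamilyEssSup_familyEssSup (P : Measure Ω) [IsProbabilityMeasure P]
    (S : Set (Ω → EReal)) : IsFamilyEssSup P S (familyEssSup P S) := by
  have h := exists_isFamilyEssSup P S
  rw [familyEssSup, dif_pos h]
  exact h.choose_spec

/-- The essential infimum `ess inf S = -ess sup (-S)`. -/
noncomputable def familyEssInf (P : Measure Ω) (S : Set (Ω → EReal)) : Ω → EReal :=
  fun ω => -familyEssSup P {f | ∃ g ∈ S, f = fun ω' => -g ω'} ω

end EssentialSupremum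

namespace RiskMeasure

/-! ### Random vectors and the eligible portfolios

Random vectors that are arguments of a risk measure are elements of Mathlib's `Lp` (equivalence
classes); dual variables are represented by functions, to be read up to `P`-a.s. equality. -/

section Definitions

variable {Ω : Type*} {mΩ : MeasurableSpace Ω} {ι : Type*} [LinearOrder ι] {d : ℕ}

/-- `f` represents an element of `L^p_t(D)`: it is `ℱ t`-measurable (up to a null set), has finite
`p`-norm, and takes a.s. values in the random set `D`. -/
def MemLt (P : Measure Ω) (ℱ : Filtration ι mΩ) (p : ℝ≥0∞) (t : ι) (D : Ω → Set (Fin d → ℝ))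
    (f : Ω → Fin d → ℝ) : Prop :=
  AEStronglyMeasurable[ℱ t] f P ∧ MemLp f p P ∧ ∀ᵐ ω ∂P, f ω ∈ D ω

/-- The set `L^p_t(D)` of equivalence classes, as a subset of `L^p`. -/
def Lt (P : Measure Ω) (ℱ : Filtration ι mΩ) (p : ℝ≥0∞) (t : ι) (D : Ω → Set (Fin d → ℝ)) :
    Set (Lp (Fin d → ℝ) p P) :=
  {X | MemLt P ℱ p t D X}

/-- The eligible portfolios `M = ℝ^m × {0}^(d-m)`. -/
def eligible (d m : ℕ) : Set (Fin d → ℝ) := {x | ∀ i : Fin d, m ≤ (i : ℕ) → x i = 0}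

/-- `M_+ = M ∩ ℝ^d_+`. -/
def eligiblePos (d m : ℕ) : Set (Fin d → ℝ) := {x | x ∈ eligible d m ∧ 0 ≤ x}

/-- The positive dual cone `C^+` of a subset `C` of `ℝ^d`. -/
def dualCone (C : Set (Fin d → ℝ)) : Set (Fin d → ℝ) := {v | ∀ u ∈ C, 0 ≤ v ⬝ᵥ u}

/-- The orthogonal space `C^⊥` of a subset `C` of `ℝ^d`. -/
def orth (C : Set (Fin d → ℝ)) : Set (Fin d → ℝ) := {v | ∀ u ∈ C, v ⬝ᵥ u = 0}

/-- `M_t = L^p_t(M)`. -/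
def Mt (P : Measure Ω) (ℱ : Filtration ι mΩ) (p : ℝ≥0∞) (m : ℕ) (t : ι) :
    Set (Lp (Fin d → ℝ) p P) :=
  Lt P ℱ p t fun _ => eligible d m

/-- `M_{t,+} = L^p_t(M_+)`. -/
def MtPos (P : Measure Ω) (ℱ : Filtration ι mΩ) (p : ℝ≥0∞) (m : ℕ) (t : ι) :
    Set (Lp (Fin d → ℝ) p P) :=
  Lt P ℱ p t fun _ => eligiblePos d m

open Classical in
/-- The topology used on `L^p`: the norm topology for `p < ∞`, and for `p = ∞` the weak* topology,
i.e. the coarsest one that makes `X ↦ E[YᵀX]` continuous for every `Y ∈ L^1`. -/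
@[reducible] noncomputable def lpTopology (P : Measure Ω) (p : ℝ≥0∞) [Fact (1 ≤ p)] :
    TopologicalSpace (Lp (Fin d → ℝ) p P) :=
  if p = ∞ then
    TopologicalSpace.induced
      (fun (X : Lp (Fin d → ℝ) p P) (Y : Lp (Fin d → ℝ) 1 P) => ∫ ω, Y ω ⬝ᵥ X ω ∂P)
      Pi.topologicalSpace
  else inferInstance

/-- `𝒢(M_t; M_{t,-})`: the sets `D ⊆ M_t` with `D = cl co (D + M_{t,-})`, where
`M_{t,-} = -M_{t,+}`. -/
def lowerClosedConvex (P : Measure Ω) (ℱ : Filtration ι mΩ) (p : ℝ≥0∞) [Fact (1 ≤ p)] (m : ℕ)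
    (t : ι) : Set (Set (Lp (Fin d → ℝ) p P)) :=
  {D | D ⊆ Mt P ℱ p m t ∧
    D = @closure _ (lpTopology P p) (convexHull ℝ (D + -MtPos P ℱ p m t))}

/-! ### Set-valued conditional risk measures -/

/-- `ℱ t`-decomposability: `1_B X + 1_{Bᶜ} Y ∈ S` for `X, Y ∈ S` and `B ∈ ℱ t`. -/
def Decomposable (P : Measure Ω) (ℱ : Filtration ι mΩ) {p : ℝ≥0∞} (t : ι)
    (S : Set (Lp (Fin d → ℝ) p P)) : Prop :=
  ∀ B : Set Ω, MeasurableSet[ℱ t] B → ∀ X ∈ S, ∀ Y ∈ S, ∀ Z : Lp (Fin d → ℝ) p P,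
    (Z =ᵐ[P] fun ω => B.indicator X ω + Bᶜ.indicator Y ω) → Z ∈ S

/-- An `ℱ t`-measurable random closed set: closed values, and `{K ∩ G ≠ ∅} ∈ ℱ t` for every open
`G`. -/
structure IsRandomClosedSet (ℱ : Filtration ι mΩ) (t : ι) (K : Ω → Set (Fin d → ℝ)) : Prop where
  closed : ∀ ω, IsClosed (K ω)
  measurable : ∀ G : Set (Fin d → ℝ), IsOpen G → MeasurableSet[ℱ t] {ω | (K ω ∩ G).Nonempty}

/-- `R` is a conditional risk measure at time `t`, and `R0` is the random set `R̃_t(0)` with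
`R_t(0) = L^p_t(R̃_t(0))`. -/
structure IsConditionalRiskMeasure (P : Measure Ω) (ℱ : Filtration ι mΩ) (p : ℝ≥0∞)
    [Fact (1 ≤ p)] (m : ℕ) (t : ι) (R : Lp (Fin d → ℝ) p P → Set (Lp (Fin d → ℝ) p P))
    (R0 : Ω → Set (Fin d → ℝ)) : Prop where
  subset_eligible : ∀ X, R X ⊆ Mt P ℱ p m t
  upper : ∀ X, R X = R X + MtPos P ℱ p m t
  monotone : ∀ X Y : Lp (Fin d → ℝ) p P, (∀ᵐ ω ∂P, 0 ≤ (Y - X : Lp (Fin d → ℝ) p P) ω) → R X ⊆ R Y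
  translative : ∀ X, ∀ k ∈ Mt P ℱ p m t, R (X + k) = (fun u => u - k) '' R X
  nonempty_zero : (R 0).Nonempty
  closed_zero : @IsClosed _ (lpTopology P p) (R 0)
  decomposable_zero : Decomposable P ℱ t (R 0)
  randomSet : IsRandomClosedSet ℱ t R0
  zero_eq : R 0 = Lt P ℱ p t R0
  ne_eligible : ∀ᵐ ω ∂P, R0 ω ≠ eligible d m

/-- `R_t(X) = R_t(X) + R_t(0)` for every `X`. -/
def Normalized {P : Measure Ω} {p : ℝ≥0∞}
    (R : Lp (Fin d → ℝ) p P → Set (Lp (Fin d → ℝ) p P)) : Prop :=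
  ∀ X, R X = R X + R 0

/-- Conditional convexity: `R_t(λX + (1-λ)Y) ⊇ λR_t(X) + (1-λ)R_t(Y)` for `ℱ t`-measurable
`λ` with values in `[0,1]`. Here `Z` is the class of `λX + (1-λ)Y` and `z` the class of
`λu + (1-λ)v`. -/
def ConditionallyConvex {P : Measure Ω} (ℱ : Filtration ι mΩ) {p : ℝ≥0∞} (t : ι)
    (R : Lp (Fin d → ℝ) p P → Set (Lp (Fin d → ℝ) p P)) : Prop :=
  ∀ (X Y Z : Lp (Fin d → ℝ) p P) (l : Ω → ℝ), AEStronglyMeasurable[ℱ t] l P →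
    (∀ᵐ ω ∂P, l ω ∈ Set.Icc (0 : ℝ) 1) →
    (Z =ᵐ[P] fun ω => l ω • X ω + (1 - l ω) • Y ω) →
    ∀ u ∈ R X, ∀ v ∈ R Y, ∀ z : Lp (Fin d → ℝ) p P,
      (z =ᵐ[P] fun ω => l ω • u ω + (1 - l ω) • v ω) → z ∈ R Z

/-- Convex upper continuity: `{X | R_t(X) ∩ D ≠ ∅}` is closed for every closed
`D ∈ 𝒢(M_t; M_{t,-})`. -/
def ConvexUpperContinuous {P : Measure Ω} (ℱ : Filtration ι mΩ) {p : ℝ≥0∞} [Fact (1 ≤ p)] (m : ℕ)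
    (t : ι) (R : Lp (Fin d → ℝ) p P → Set (Lp (Fin d → ℝ) p P)) : Prop :=
  ∀ D ∈ lowerClosedConvex P ℱ p m t, @IsClosed _ (lpTopology P p) {X | (R X ∩ D).Nonempty}

/-- The acceptance set `A_t = {X | 0 ∈ R_t(X)}`. -/
def acceptance {P : Measure Ω} {p : ℝ≥0∞}
    (R : Lp (Fin d → ℝ) p P → Set (Lp (Fin d → ℝ) p P)) : Set (Lp (Fin d → ℝ) p P) :=
  {X | 0 ∈ R X}

/-- The scalarized risk measure `ρ_t^w(X) = ess inf {wᵀu | u ∈ R_t(X)}`. -/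
noncomputable def scalarization (P : Measure Ω) {p : ℝ≥0∞}
    (R : Lp (Fin d → ℝ) p P → Set (Lp (Fin d → ℝ) p P)) (w : Ω → Fin d → ℝ)
    (X : Lp (Fin d → ℝ) p P) : Ω → EReal :=
  familyEssInf P {f | ∃ u ∈ R X, f = fun ω => ((w ω ⬝ᵥ u ω : ℝ) : EReal)}

/-- All scalarizations in directions `w ∈ L^q_t(R̃_t(0)^+ ∖ M^⊥)` are integrable. -/
def IntegrableScalarizations (P : Measure Ω) (ℱ : Filtration ι mΩ) {p : ℝ≥0∞} (q : ℝ≥0∞) (m : ℕ)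
    (t : ι) (R : Lp (Fin d → ℝ) p P → Set (Lp (Fin d → ℝ) p P))
    (R0 : Ω → Set (Fin d → ℝ)) : Prop :=
  ∀ w : Ω → Fin d → ℝ, MemLt P ℱ q t (fun ω => dualCone (R0 ω) \ orth (eligible d m)) w →
    ∀ X : Lp (Fin d → ℝ) p P, ∃ g : Ω → ℝ, Integrable g P ∧
      scalarization P R w X =ᵐ[P] fun ω => (g ω : EReal)

/-! ### Dual variables -/

/-- `ℳ^d`: vectors of probability measures absolutely continuous with respect to `P`. -/
def vectorMeasures (P : Measure Ω) (d : ℕ) : Set (Fin d → Measure Ω) :=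
  {Q | ∀ i, IsProbabilityMeasure (Q i) ∧ Q i ≪ P}

open Classical in
/-- `ξ̄_{s,σ}(Q) = E[dQ/dP | ℱ σ] / E[dQ/dP | ℱ s]` where the denominator is positive, and `1`
elsewhere. -/
noncomputable def xi (P : Measure Ω) (ℱ : Filtration ι mΩ) (s σ : ι) (Q : Measure Ω) : Ω → ℝ :=
  fun ω =>
    if 0 < (P[fun ω' => (Q.rnDeriv P ω').toReal | ℱ s]) ω then
      (P[fun ω' => (Q.rnDeriv P ω').toReal | ℱ σ]) ω /
        (P[fun ω' => (Q.rnDeriv P ω').toReal | ℱ s]) ω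
    else 1

/-- `w_t^s(Q, w) = diag(w) ξ_{t,s}(Q)`. -/
noncomputable def wStep (P : Measure Ω) (ℱ : Filtration ι mΩ) (t s : ι)
    (Q : Fin d → Measure Ω) (w : Ω → Fin d → ℝ) : Ω → Fin d → ℝ :=
  fun ω i => w ω i * xi P ℱ t s (Q i) ω

/-- `f` represents an element of the dual cone `M_{s,+}^+`, a subset of `L^q_s`. -/
def MemDualMtPos (P : Measure Ω) (ℱ : Filtration ι mΩ) (p q : ℝ≥0∞) (m : ℕ) (s : ι)
    (f : Ω → Fin d → ℝ) : Prop :=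
  MemLt P ℱ q s (fun _ => Set.univ) f ∧
    ∀ u ∈ (MtPos P ℱ p m s : Set (Lp (Fin d → ℝ) p P)), 0 ≤ ∫ ω, f ω ⬝ᵥ u ω ∂P

/-- The stepped dual variables `𝒲_{t,s}(w)`: pairs `(Q, m_⊥) ∈ ℳ^d × L^q_t(M^⊥)` with
`w + m_⊥ ∈ L^q_t(M_+^+ ∖ M^⊥)` and `w_t^s(Q, w + m_⊥) ∈ M_{s,+}^+`. -/
def steppedDual (P : Measure Ω) (ℱ : Filtration ι mΩ) (p q : ℝ≥0∞) (m : ℕ) (t s : ι)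
    (w : Ω → Fin d → ℝ) : Set ((Fin d → Measure Ω) × (Ω → Fin d → ℝ)) :=
  {a | a.1 ∈ vectorMeasures P d ∧
    MemLt P ℱ q t (fun _ => orth (eligible d m)) a.2 ∧
    MemLt P ℱ q t (fun _ => dualCone (eligiblePos d m) \ orth (eligible d m)) (w + a.2) ∧
    MemDualMtPos P ℱ p q m s (wStep P ℱ t s a.1 (w + a.2))}

/-- The time-`s` dual variables `𝒲_s(v)`: pairs `(R, n_⊥) ∈ ℳ^d × L^q_s(M^⊥)` with
`v + n_⊥ ∈ M_{s,+}^+` and `w_s^T(R, v + n_⊥) ∈ L^q(ℝ^d_+)`.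

It is evaluated at `v ∈ M_{s,+}^+`, which may take values in `M^⊥` with positive probability (when
`v = w_t^s(Q, w + m_⊥)` with `Q` not equivalent to `P`). If `v` takes no value in `M^⊥` a.s., then
neither does `v + n_⊥`. -/
def terminalDual [OrderTop ι] (P : Measure Ω) (ℱ : Filtration ι mΩ) (p q : ℝ≥0∞) (m : ℕ) (s : ι)
    (v : Ω → Fin d → ℝ) : Set ((Fin d → Measure Ω) × (Ω → Fin d → ℝ)) :=
  {b | b.1 ∈ vectorMeasures P d ∧
    MemLt P ℱ q s (fun _ => orth (eligible d m)) b.2 ∧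
    MemDualMtPos P ℱ p q m s (v + b.2) ∧
    MemLt P ℱ q ⊤ (fun _ => {x : Fin d → ℝ | 0 ≤ x}) (wStep P ℱ s ⊤ b.1 (v + b.2))}

/-- The composed density `w_s^T(R, w_t^s(Q, w + m_⊥) + n_⊥)`, for `a = (Q, m_⊥)` and
`b = (R, n_⊥)`; the terminal time `T` is `⊤`. -/
noncomputable def splitDensity [OrderTop ι] (P : Measure Ω) (ℱ : Filtration ι mΩ) (t s : ι)
    (w : Ω → Fin d → ℝ) (a b : (Fin d → Measure Ω) × (Ω → Fin d → ℝ)) : Ω → Fin d → ℝ :=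
  wStep P ℱ s ⊤ b.1 (wStep P ℱ t s a.1 (w + a.2) + b.2)

/-- `E[w_s^T(R, w_t^s(Q, w + m_⊥) + n_⊥)ᵀ(-X) | ℱ t]`. -/
noncomputable def splitExpectation [OrderTop ι] {P : Measure Ω} (ℱ : Filtration ι mΩ) {p : ℝ≥0∞}
    (t s : ι) (w : Ω → Fin d → ℝ) (a b : (Fin d → Measure Ω) × (Ω → Fin d → ℝ))
    (X : Lp (Fin d → ℝ) p P) : Ω → EReal :=
  fun ω => (((P[fun ω' => splitDensity P ℱ t s w a b ω' ⬝ᵥ -(X ω') | ℱ t]) ω : ℝ) : EReal)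

/-- The penalty `β_{t,s}^w(Q, m_⊥, R, n_⊥)`, an essential supremum over the acceptance set. -/
noncomputable def beta [OrderTop ι] {P : Measure Ω} (ℱ : Filtration ι mΩ) {p : ℝ≥0∞}
    (t s : ι) (Rt : Lp (Fin d → ℝ) p P → Set (Lp (Fin d → ℝ) p P)) (w : Ω → Fin d → ℝ)
    (a b : (Fin d → Measure Ω) × (Ω → Fin d → ℝ)) : Ω → EReal :=
  familyEssSup P {f | ∃ Z ∈ acceptance Rt, f = splitExpectation ℱ t s w a b Z}

/-- `-β_{t,s}^w(Q, m_⊥, R, n_⊥) + E[w_s^T(R, w_t^s(Q, w + m_⊥) + n_⊥)ᵀ(-X) | ℱ t]`. -/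
noncomputable def dualValue [OrderTop ι] {P : Measure Ω} (ℱ : Filtration ι mΩ) {p : ℝ≥0∞}
    (t s : ι) (Rt : Lp (Fin d → ℝ) p P → Set (Lp (Fin d → ℝ) p P)) (w : Ω → Fin d → ℝ)
    (a b : (Fin d → Measure Ω) × (Ω → Fin d → ℝ)) (X : Lp (Fin d → ℝ) p P) : Ω → EReal :=
  fun ω => -beta ℱ t s Rt w a b ω + splitExpectation ℱ t s w a b X ω

/-- The joint dual variables `𝒲̃_{t,s}(w)`. Since `β` dominates an integrable random variable,
`E[β] < +∞` means that the positive part of `β` has finite expectation. -/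
def jointDual [OrderTop ι] {P : Measure Ω} (ℱ : Filtration ι mΩ) {p : ℝ≥0∞} (q : ℝ≥0∞) (m : ℕ)
    (t s : ι) (Rt : Lp (Fin d → ℝ) p P → Set (Lp (Fin d → ℝ) p P)) (w : Ω → Fin d → ℝ) :
    Set (((Fin d → Measure Ω) × (Ω → Fin d → ℝ)) × ((Fin d → Measure Ω) × (Ω → Fin d → ℝ))) :=
  {c | c.1 ∈ steppedDual P ℱ p q m t s w ∧
    c.2 ∈ terminalDual P ℱ p q m s (wStep P ℱ t s c.1.1 (w + c.1.2)) ∧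
    ∫⁻ ω, (beta ℱ t s Rt w c.1 c.2 ω).toENNReal ∂P < ∞}

end Definitions

end RiskMeasure

/-! Weak duality is pointwise. If u ∈ R(X), then X + u is acceptable. A composed density Y satisfies
E[Y_i | F_t] = w_i on the eligible coordinates, since each ratio ξ̄ has conditional mean one and
m_⊥, n_⊥ vanish there. So β dominates E[Yᵀ(-X) | F_t] - wᵀu, and every dual value lies below wᵀu,
hence below ρ (`dualValue_le_scalarization`). Conversely, an extended random variable G ≤ ρ equals ρ
as soon as it dominates, for each ε > 0, an integrable variable whose expectation is at least E[ρ] -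
ε (`ae_eq_coe_of_forall_exists_integral`). One good dual variable for each ε is therefore enough.

It comes from scalar convex duality for φ(X) = E[ρ(X)] (`exists_affine_minorant`). This φ is
real-valued, convex and decreasing. It is lower semicontinuous because its sublevel sets are
intersections of sets {X : R(X) ∩ D ≠ ∅} with D = {u ∈ M_t : E[wᵀu] ≤ c}, closed by convex upper
continuity. Hahn-Banach gives an affine minorant X ↦ -E[YᵀX] + c that misses φ(X) by only ε.
Monotonicity gives Y ≥ 0, translativity gives E[Y_i | F_t] = w_i for i < m, and φ ≤ 0 on the
acceptance set A gives E[Yᵀ(-Z)] ≤ -c there. Such a Y is a composed density with both measure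
vectors equal and n_⊥ = 0 (`exists_dual_variables`). The family E[Yᵀ(-Z) | F_t], Z ∈ A, is upward
directed, so β has an integrable bound of expectation at most -c. In particular E[β] < ∞, and the
same variables serve both formulas.

There is one gap: integrability of the scalarizations is assumed only for directions in R̃(0)^+,
while w is only in M_+^+. Convex upper continuity closes it: a continuous functional that is
nonnegative on M_{t,+} is nonnegative on all of R(0) (`nonneg_on_zero_of_convexUpperContinuous`),
and measurable selection turns this into w ∈ R̃(0)^+ almost surely (`memLt_dualCone`). -/

set_option linter.unusedSectionVars false

namespace RiskMeasure

/-! ### Riesz representation of positive functionals on scalar L^p, p < ∞ -/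

section Representation

variable {Ω : Type*} {mΩ : MeasurableSpace Ω} {P : Measure Ω} [IsProbabilityMeasure P]

/-- A converse of Hölder's inequality: testing against bounded functions controls the conjugate
norm. -/
theorem lintegral_rpow_le_of_forall_bounded {a b : ℝ} (hab : a.HolderConjugate b)
    {y : Ω → ℝ≥0∞} (hy : Measurable y) {C : ℝ≥0∞}
    (H : ∀ Z : Ω → ℝ≥0∞, Measurable Z → (∃ n : ℕ, ∀ ω, Z ω ≤ (n : ℝ≥0∞)) →
      ∫⁻ ω, y ω * Z ω ∂P ≤ C * (∫⁻ ω, Z ω ^ a ∂P) ^ (1 / a)) :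
    ∫⁻ ω, y ω ^ b ∂P ≤ C ^ b := by
  have ha : 0 < a := hab.pos
  have hb : 0 < b := hab.symm.pos
  have hb1 : 0 < b - 1 := sub_pos.2 hab.symm.lt
  have hba : (b - 1) * a = b := hab.symm.sub_one_mul_conj
  -- Truncation makes the integral I below finite, so that I ≤ C * I^(1/a) can be divided by
  -- I^(1/a). The test function yn^(b-1) is the equality case of Hölder, as (b-1)a = b.
  let yn : ℕ → Ω → ℝ≥0∞ := fun n ω => min (y ω) n
  have hynm : ∀ n, Measurable (yn n) := fun n => hy.min measurable_const
  have hbound : ∀ n, ∫⁻ ω, yn n ω ^ b ∂P ≤ C ^ b := by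
    intro n
    set I := ∫⁻ ω, yn n ω ^ b ∂P with hI
    have hIfin : I ≠ ∞ := by
      refine ne_top_of_le_ne_top (b := (n : ℝ≥0∞) ^ b)
        (ENNReal.rpow_ne_top_of_nonneg hb.le (ENNReal.natCast_ne_top n)) ?_
      calc I ≤ ∫⁻ _, (n : ℝ≥0∞) ^ b ∂P :=
            lintegral_mono fun ω => ENNReal.rpow_le_rpow (min_le_right _ _) hb.le
        _ = _ := by simp
    have h1 : I ≤ C * I ^ (1 / a) := by
      have h2 := H (fun ω => yn n ω ^ (b - 1)) ((hynm n).pow_const _)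
        ⟨⌈(n : ℝ) ^ (b - 1)⌉₊, fun ω => by
          refine (ENNReal.rpow_le_rpow (min_le_right _ _) hb1.le).trans ?_
          rw [← ENNReal.ofReal_natCast n, ENNReal.ofReal_rpow_of_nonneg (by positivity) hb1.le,
            ← ENNReal.ofReal_natCast]
          exact ENNReal.ofReal_le_ofReal (Nat.le_ceil _)⟩
      have h3 : ∀ ω, (yn n ω ^ (b - 1)) ^ a = yn n ω ^ b := fun ω => by
        rw [← ENNReal.rpow_mul, hba]
      simp only [h3] at h2
      refine le_trans (lintegral_mono fun ω => ?_) h2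
      calc yn n ω ^ b = yn n ω ^ (1 + (b - 1)) := by ring_nf
        _ = yn n ω * yn n ω ^ (b - 1) := by
          rw [ENNReal.rpow_add_of_nonneg _ _ zero_le_one hb1.le, ENNReal.rpow_one]
        _ ≤ y ω * yn n ω ^ (b - 1) := by gcongr; exact min_le_left _ _
    rcases eq_or_ne I 0 with h0 | h0
    · rw [h0]; exact zero_le
    have h4 : I ^ (1 / b) ≤ C := by
      have h5 : I = I ^ (1 / b) * I ^ (1 / a) := by
        rw [← ENNReal.rpow_add _ _ h0 hIfin, one_div, one_div, add_comm, hab.inv_add_inv_eq_one,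
          ENNReal.rpow_one]
      have h6 : I ^ (1 / a) ≠ 0 := by
        simp [ENNReal.rpow_eq_zero_iff, h0, hIfin]
      have h7 : I ^ (1 / a) ≠ ∞ := ENNReal.rpow_ne_top_of_nonneg (by positivity) hIfin
      exact (ENNReal.mul_le_mul_iff_left h6 h7).1 (h5.symm.le.trans h1)
    calc I = (I ^ (1 / b)) ^ b := by rw [← ENNReal.rpow_mul]; simp [hb.ne']
      _ ≤ C ^ b := ENNReal.rpow_le_rpow h4 hb.le
  have hsup : ∀ ω, y ω ^ b = ⨆ n, yn n ω ^ b := by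
    intro ω
    have h1 : y ω = ⨆ n, yn n ω := by
      refine le_antisymm ?_ (iSup_le fun n => min_le_left _ _)
      refine le_of_forall_lt fun c hc => ?_
      obtain ⟨n, hn⟩ := ENNReal.exists_nat_gt (ne_top_of_lt hc)
      exact (lt_min hc hn).trans_le (le_iSup (fun n => yn n ω) n)
    nth_rewrite 1 [h1]
    exact (ENNReal.orderIsoRpow b hb).map_iSup _
  simp_rw [hsup]
  rw [lintegral_iSup (fun n => (hynm n).pow_const _)
    (fun i j hij ω => ENNReal.rpow_le_rpow (min_le_min_left _ (by exact_mod_cast hij)) hb.le)]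
  exact iSup_le hbound

/-- The measure `A ↦ ℓ(1_A)` of a positive continuous functional on `L^p`, `p < ∞`. -/
theorem exists_measure_of_positive_functional {p : ℝ≥0∞} [Fact (1 ≤ p)] (hp : p ≠ ∞)
    (l : Lp ℝ p P →L[ℝ] ℝ) (hl : ∀ Z, 0 ≤ Z → 0 ≤ l Z) :
    ∃ ν : Measure Ω, IsFiniteMeasure ν ∧ ν ≪ P ∧ ∀ (A : Set Ω) (hA : MeasurableSet A),
      ν A = ENNReal.ofReal (l (indicatorConstLp p hA (measure_ne_top P A) 1)) := by
  have hpos : ∀ (A : Set Ω) (hA : MeasurableSet A),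
      0 ≤ l (indicatorConstLp p hA (measure_ne_top P A) 1) := fun A hA => by
    refine hl _ ((Lp.coeFn_nonneg _).1 ?_)
    filter_upwards [indicatorConstLp_coeFn (p := p) (hs := hA) (hμs := measure_ne_top P A)
      (c := (1 : ℝ))] with ω hω
    rw [hω]
    exact Set.indicator_nonneg (fun _ _ => zero_le_one) _
  let mm : ∀ A : Set Ω, MeasurableSet A → ℝ≥0∞ := fun A hA =>
    ENNReal.ofReal (l (indicatorConstLp p hA (measure_ne_top P A) 1))
  have m0 : mm ∅ MeasurableSet.empty = 0 := by
    simp only [mm]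
    rw [indicatorConstLp_empty]; simp
  have mU : ∀ ⦃f : ℕ → Set Ω⦄ (h : ∀ i, MeasurableSet (f i)), Pairwise (Function.onFun Disjoint f) →
      mm (⋃ i, f i) (MeasurableSet.iUnion h) = ∑' i, mm (f i) (h i) := by
    intro f h hd
    have hacc : ∀ n, MeasurableSet (Set.accumulate f n) := fun n =>
      MeasurableSet.biUnion (Set.to_countable _) fun i _ => h i
    have hsum : ∀ n, ∑ i ∈ Finset.range (n + 1),
        l (indicatorConstLp p (h i) (measure_ne_top P _) 1) =
        l (indicatorConstLp p (hacc n) (measure_ne_top P _) 1) := by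
      intro n
      induction n with
      | zero =>
        simp only [zero_add, Finset.range_one, Finset.sum_singleton]
        congr 2
        simp [Set.accumulate_def]
      | succ n ih =>
        rw [Finset.sum_range_succ, ih, ← map_add]
        congr 1
        have hdj : Disjoint (Set.accumulate f n) (f (n + 1)) := by
          rw [Set.accumulate_def]
          simp only [Set.disjoint_iUnion_left]
          intro i hi
          exact hd (by omega)
        rw [← indicatorConstLp_disjoint_union (hacc n) (h (n + 1)) _ _ hdj]
        congr 1
        exact (Set.accumulate_succ f n).symm
    -- Countable additivity is continuity of `l` along the indicators of increasing partial unions;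
    -- they converge in L^p norm because p < ∞.
    have ht : HasSum (fun i => l (indicatorConstLp p (h i) (measure_ne_top P _) 1))
        (l (indicatorConstLp p (MeasurableSet.iUnion h) (measure_ne_top P _) 1)) := by
      rw [hasSum_iff_tendsto_nat_of_nonneg fun i => hpos _ (h i)]
      rw [← tendsto_add_atTop_iff_nat 1]
      simp_rw [hsum]
      refine (l.continuous.tendsto _).comp (tendsto_indicatorConstLp_set hp ?_)
      have h1 : ∀ n, P (symmDiff (Set.accumulate f n) (⋃ i, f i)) =
          P (⋃ i, f i) - P (Set.accumulate f n) := fun n => by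
        have hsub : Set.accumulate f n ⊆ ⋃ i, f i := Set.accumulate_subset_iUnion _
        rw [symmDiff_of_le hsub, measure_sdiff hsub (hacc n).nullMeasurableSet (measure_ne_top P _)]
      simp_rw [h1]
      have h2 := ENNReal.Tendsto.sub (tendsto_const_nhds (x := P (⋃ i, f i)) (f := atTop))
        (tendsto_measure_iUnion_accumulate (μ := P) (f := f)) (Or.inl (measure_ne_top P _))
      simpa using h2
    simp only [mm]
    rw [← ENNReal.ofReal_tsum_of_nonneg (fun i => hpos _ (h i)) ht.summable, ht.tsum_eq]
  refine ⟨Measure.ofMeasurable mm m0 mU, ⟨?_⟩, ?_, fun A hA => Measure.ofMeasurable_apply A hA⟩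
  · rw [Measure.ofMeasurable_apply _ MeasurableSet.univ]
    exact ENNReal.ofReal_lt_top
  · refine Measure.AbsolutelyContinuous.mk fun A hA hA0 => ?_
    rw [Measure.ofMeasurable_apply A hA]
    have : indicatorConstLp p hA (measure_ne_top P A) (1 : ℝ) = 0 := by
      refine Lp.ext ?_
      have h0 : ∀ᵐ ω ∂P, ω ∉ A := measure_eq_zero_iff_ae_notMem.1 hA0
      filter_upwards [indicatorConstLp_coeFn (p := p) (hs := hA) (hμs := measure_ne_top P A)
        (c := (1 : ℝ)), Lp.coeFn_zero ℝ p P, h0] with ω h1 h2 h3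
      rw [h1, h2]
      simp [h3]
    simp only [mm]
    rw [this]; simp

end Representation

section Representation

variable {Ω : Type*} {mΩ : MeasurableSpace Ω} {P : Measure Ω} [IsProbabilityMeasure P]

theorem lintegral_simpleFunc_eq_functional {p : ℝ≥0∞} [Fact (1 ≤ p)]
    (l : Lp ℝ p P →L[ℝ] ℝ) (hl : ∀ Z, 0 ≤ Z → 0 ≤ l Z) {ν : Measure Ω}
    (hν : ∀ (A : Set Ω) (hA : MeasurableSet A),
      ν A = ENNReal.ofReal (l (indicatorConstLp p hA (measure_ne_top P A) 1)))
    (s : SimpleFunc Ω NNReal) :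
    ∀ h : MemLp (fun ω => (s ω : ℝ)) p P, ∫⁻ ω, (s ω : ℝ≥0∞) ∂ν = ENNReal.ofReal (l h.toLp) := by
  induction s using SimpleFunc.induction with
  | @const c A hA =>
    intro h
    have h1 : h.toLp = (c : ℝ) • indicatorConstLp p hA (measure_ne_top P A) (1 : ℝ) := by
      refine Lp.ext ?_
      filter_upwards [h.coeFn_toLp, indicatorConstLp_coeFn (p := p) (hs := hA)
        (hμs := measure_ne_top P A) (c := (1 : ℝ)),
        Lp.coeFn_smul (c : ℝ) (indicatorConstLp p hA (measure_ne_top P A) (1 : ℝ))] with ω h1 h2 h3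
      rw [h1, h3, Pi.smul_apply, h2]
      by_cases hω : ω ∈ A <;> simp [hω]
    have h2 : (fun ω => ((SimpleFunc.piecewise A hA (SimpleFunc.const Ω c)
        (SimpleFunc.const Ω 0) ω : NNReal) : ℝ≥0∞)) = A.indicator fun _ => (c : ℝ≥0∞) := by
      ext ω
      by_cases hω : ω ∈ A <;> simp [hω]
    rw [h2, lintegral_indicator_const hA, hν A hA, h1, map_smul, smul_eq_mul,
      ENNReal.ofReal_mul (NNReal.coe_nonneg c), ENNReal.ofReal_coe_nnreal]
  | @add f g hd hf hg =>
    intro h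
    have hfm : MemLp (fun ω => (f ω : ℝ)) p P :=
      h.mono' (by exact (f.measurable.coe_nnreal_real).aestronglyMeasurable)
        (ae_of_all _ fun ω => by simp)
    have hgm : MemLp (fun ω => (g ω : ℝ)) p P :=
      h.mono' (by exact (g.measurable.coe_nnreal_real).aestronglyMeasurable)
        (ae_of_all _ fun ω => by simp)
    have hsum : h.toLp = hfm.toLp + hgm.toLp := by
      rw [← MemLp.toLp_add]
      congr 1
    have hn : ∀ {k : SimpleFunc Ω NNReal} (hk : MemLp (fun ω => (k ω : ℝ)) p P),
        0 ≤ l hk.toLp := fun {k} hk => hl _ ((Lp.coeFn_nonneg _).1 (by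
          filter_upwards [hk.coeFn_toLp] with ω hω
          rw [hω]; simp))
    rw [hsum, map_add, ENNReal.ofReal_add (hn hfm) (hn hgm), ← hf hfm, ← hg hgm,
      ← lintegral_add_left f.measurable.coe_nnreal_ennreal]
    simp

/-- Each simple function below Z belongs to L^p, and positivity of `l` bounds its integral by l Z.
The inequality alone suffices to put the density in L^q; equality follows afterwards by density of
simple functions. -/
theorem lintegral_le_functional {p : ℝ≥0∞} [Fact (1 ≤ p)]
    (l : Lp ℝ p P →L[ℝ] ℝ) (hl : ∀ Z, 0 ≤ Z → 0 ≤ l Z) {ν : Measure Ω} 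
    (hν : ∀ (A : Set Ω) (hA : MeasurableSet A),
      ν A = ENNReal.ofReal (l (indicatorConstLp p hA (measure_ne_top P A) 1)))
    (Z : Lp ℝ p P) (hZ : 0 ≤ Z) : ∫⁻ ω, ENNReal.ofReal (Z ω) ∂ν ≤ ENNReal.ofReal (l Z) := by
  rw [lintegral_eq_nnreal]
  refine iSup₂_le fun s hs => ?_
  have hs' : ∀ ω, (s ω : ℝ) ≤ |Z ω| := fun ω => by
    have h1 := hs ω
    rw [← ENNReal.ofReal_coe_nnreal] at h1
    rcases le_or_gt (Z ω) 0 with h | h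
    · rw [ENNReal.ofReal_of_nonpos h, nonpos_iff_eq_zero, ENNReal.ofReal_eq_zero] at h1
      exact h1.trans (abs_nonneg _)
    · exact ((ENNReal.ofReal_le_ofReal_iff h.le).1 h1).trans (le_abs_self _)
  have hsm : MemLp (fun ω => (s ω : ℝ)) p P :=
    (Lp.memLp Z).mono (s.measurable.coe_nnreal_real).aestronglyMeasurable
      (ae_of_all _ fun ω => by simpa using hs' ω)
  rw [← SimpleFunc.lintegral_eq_lintegral]
  have h1 := lintegral_simpleFunc_eq_functional l hl hν s hsm
  have h2 : ∫⁻ ω, (s.map ((↑) : NNReal → ℝ≥0∞)) ω ∂ν = ∫⁻ ω, (s ω : ℝ≥0∞) ∂ν := by simp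
  rw [h2, h1]
  refine ENNReal.ofReal_le_ofReal ?_
  rw [← sub_nonneg, ← map_sub]
  refine hl _ ((Lp.coeFn_nonneg _).1 ?_)
  filter_upwards [Lp.coeFn_sub Z hsm.toLp, hsm.coeFn_toLp, (Lp.coeFn_nonneg Z).2 hZ] with ω h3 h4 h5
  rw [h3, Pi.sub_apply, h4, Pi.zero_apply, sub_nonneg]
  exact (hs' ω).trans_eq (abs_of_nonneg h5)

/-- Riesz representation of positive continuous functionals on `L^p`, `1 ≤ p < ∞`. -/
theorem exists_density_of_positive_functional {p q : ℝ≥0∞} [Fact (1 ≤ p)]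
    [hpq : ENNReal.HolderConjugate p q] (hp : p ≠ ∞)
    (l : Lp ℝ p P →L[ℝ] ℝ) (hl : ∀ Z, 0 ≤ Z → 0 ≤ l Z) :
    ∃ y : Ω → ℝ, MemLp y q P ∧ ∀ Z : Lp ℝ p P, l Z = ∫ ω, y ω * Z ω ∂P := by
  obtain ⟨ν, hfin, hac, hν⟩ := exists_measure_of_positive_functional hp l hl
  have hp1 : 1 ≤ p := Fact.out
  have hp0 : p ≠ 0 := (zero_lt_one.trans_le hp1).ne'
  set y := ν.rnDeriv P with hy
  have hym : Measurable y := Measure.measurable_rnDeriv _ _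
  have hνy : P.withDensity y = ν := Measure.withDensity_rnDeriv_eq _ _ hac
  have hyt : ∀ᵐ ω ∂P, y ω < ∞ := Measure.rnDeriv_lt_top _ _
  have hνA : ∀ A, MeasurableSet A → ∫⁻ ω in A, y ω ∂P = ν A := fun A hA => by
    rw [← hνy, withDensity_apply _ hA]
  have hnorm : ∀ Z, 0 ≤ Z → ENNReal.ofReal (l Z) ≤ ‖l‖ₑ * ‖Z‖ₑ := fun Z hZ => by
    rw [← Real.enorm_of_nonneg (hl Z hZ)]
    exact l.le_opENorm Z
  have hmem : MemLp (fun ω => (y ω).toReal) q P := by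
    -- For p = 1, the bound ν A ≤ ‖l‖ P(A) on all sets forces y ≤ ‖l‖ a.e. For p > 1, bounded test
    -- functions and the converse of Hölder apply.
    rcases eq_or_ne p 1 with rfl | hp1'
    · have hq : q = ∞ := by
        rw [ENNReal.HolderConjugate.unique 1 q ∞]
      subst hq
      have hle : y ≤ᵐ[P] fun _ => ‖l‖ₑ := by
        refine ae_le_of_forall_setLIntegral_le_of_sigmaFinite hym fun A hA _ => ?_
        rw [hνA A hA, hν A hA, setLIntegral_const]
        refine (hnorm _ ((Lp.coeFn_nonneg _).1 ?_)).trans ?_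
        · filter_upwards [indicatorConstLp_coeFn (p := 1) (hs := hA) (hμs := measure_ne_top P A)
            (c := (1 : ℝ))] with ω hω
          rw [hω]
          exact Set.indicator_nonneg (fun _ _ => zero_le_one) _
        · gcongr
          refine enorm_indicatorConstLp_le.trans ?_
          simp
      refine memLp_top_of_bound hym.ennreal_toReal.aestronglyMeasurable ‖l‖ ?_
      filter_upwards [hle] with ω hω
      rw [Real.norm_of_nonneg ENNReal.toReal_nonneg]
      refine ENNReal.toReal_le_of_le_ofReal (norm_nonneg _) ?_
      rwa [ofReal_norm]
    · have hp1lt : 1 < p := lt_of_le_of_ne hp1 hp1'.symm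
      have hqt : q ≠ ∞ := by
        rintro rfl
        exact hp1' (ENNReal.HolderConjugate.unique ∞ p 1)
      have hq0 : q ≠ 0 := ENNReal.HolderConjugate.ne_zero q p
      have hab : p.toReal.HolderConjugate q.toReal := ENNReal.HolderConjugate.toReal_of_ne_top hp hqt
      have key := lintegral_rpow_le_of_forall_bounded (P := P) hab hym (C := ‖l‖ₑ) fun Z hZ hn => by
        obtain ⟨n, hn⟩ := hn
        have hZm : MemLp (fun ω => (Z ω).toReal) p P :=
          (memLp_top_of_bound hZ.ennreal_toReal.aestronglyMeasurable n (ae_of_all _ fun ω => by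
            rw [Real.norm_of_nonneg ENNReal.toReal_nonneg]
            exact ENNReal.toReal_le_of_le_ofReal (by positivity) (by simpa using hn ω))).mono_exponent
            le_top
        have hZt : ∀ ω, Z ω ≠ ∞ := fun ω => ne_top_of_le_ne_top (ENNReal.natCast_ne_top n) (hn ω)
        have hZ0 : 0 ≤ hZm.toLp := (Lp.coeFn_nonneg _).1 (by
          filter_upwards [hZm.coeFn_toLp] with ω hω
          rw [hω]; exact ENNReal.toReal_nonneg)
        have hae : ∀ᵐ ω ∂ν, (hZm.toLp : Lp ℝ p P) ω = (Z ω).toReal := hac.ae_le hZm.coeFn_toLp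
        have h1 : ∫⁻ ω, y ω * Z ω ∂P = ∫⁻ ω, ENNReal.ofReal ((hZm.toLp : Lp ℝ p P) ω) ∂ν := by
          have h2 : ∫⁻ ω, ENNReal.ofReal ((hZm.toLp : Lp ℝ p P) ω) ∂ν = ∫⁻ ω, Z ω ∂ν := by
            refine lintegral_congr_ae ?_
            filter_upwards [hae] with ω hω
            rw [hω, ENNReal.ofReal_toReal (hZt ω)]
          rw [h2, ← hνy, lintegral_withDensity_eq_lintegral_mul _ hym hZ]
          rfl
        rw [h1]
        refine (lintegral_le_functional l hl hν _ hZ0).trans ((hnorm _ hZ0).trans ?_)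
        gcongr
        rw [Lp.enorm_toLp, eLpNorm_eq_lintegral_rpow_enorm_toReal hp0 hp]
        refine le_of_eq ?_
        congr 1
        refine lintegral_congr fun ω => ?_
        rw [Real.enorm_of_nonneg ENNReal.toReal_nonneg, ENNReal.ofReal_toReal (hZt ω)]
      refine ⟨hym.ennreal_toReal.aestronglyMeasurable, ?_⟩
      rw [eLpNorm_lt_top_iff_lintegral_rpow_enorm_lt_top hq0 hqt]
      refine lt_of_le_of_lt (lintegral_mono_ae ?_) (key.trans_lt ?_)
      · filter_upwards [hyt] with ω hω
        rw [Real.enorm_of_nonneg ENNReal.toReal_nonneg, ENNReal.ofReal_toReal hω.ne]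
      · exact ENNReal.rpow_lt_top_of_nonneg ENNReal.toReal_nonneg enorm_ne_top
  refine ⟨_, hmem, fun Z => ?_⟩
  have : Fact (1 ≤ q) := ⟨ENNReal.HolderConjugate.one_le q p⟩
  have hcont : Continuous fun Z : Lp ℝ p P => ∫ ω, (y ω).toReal * Z ω ∂P := by
    have h1 : (fun Z : Lp ℝ p P => ∫ ω, (y ω).toReal * Z ω ∂P) =
        fun Z => (ContinuousLinearMap.mul ℝ ℝ).lpPairing P q p hmem.toLp Z := by
      ext Z
      rw [ContinuousLinearMap.lpPairing_eq_integral]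
      refine integral_congr_ae ?_
      filter_upwards [hmem.coeFn_toLp] with ω hω
      simp [hω]
    rw [h1]
    exact ContinuousLinearMap.continuous _
  have hadd : ∀ {f : Ω → ℝ}, MemLp f p P → Integrable (fun ω => (y ω).toReal * f ω) P :=
    fun {f} hf => hmem.integrable_mul hf
  refine Lp.induction (p := p) hp (motive := fun Z => l Z = ∫ ω, (y ω).toReal * Z ω ∂P) ?_ ?_ ?_ Z
  · intro c A hA hμA
    have h1 : (Lp.simpleFunc.indicatorConst p hA hμA.ne c : Lp ℝ p P) =
        c • indicatorConstLp p hA (measure_ne_top P A) (1 : ℝ) := by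
      rw [Lp.simpleFunc.coe_indicatorConst]
      refine Lp.ext ?_
      filter_upwards [indicatorConstLp_coeFn (p := p) (hs := hA)
        (hμs := measure_ne_top P A) (c := (1 : ℝ)), indicatorConstLp_coeFn (p := p) (hs := hA)
        (hμs := hμA.ne) (c := c),
        Lp.coeFn_smul c (indicatorConstLp p hA (measure_ne_top P A) (1 : ℝ))] with ω h1 h2 h3
      rw [h2, h3, Pi.smul_apply, h1]
      by_cases hω : ω ∈ A <;> simp [hω]
    have hpos : 0 ≤ l (indicatorConstLp p hA (measure_ne_top P A) (1 : ℝ)) := by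
      refine hl _ ((Lp.coeFn_nonneg _).1 ?_)
      filter_upwards [indicatorConstLp_coeFn (p := p) (hs := hA) (hμs := measure_ne_top P A)
        (c := (1 : ℝ))] with ω hω
      rw [hω]
      exact Set.indicator_nonneg (fun _ _ => zero_le_one) _
    have h2 : l (indicatorConstLp p hA (measure_ne_top P A) (1 : ℝ)) =
        ∫ ω in A, (y ω).toReal ∂P := by
      rw [integral_toReal hym.aemeasurable (ae_restrict_of_ae hyt), hνA A hA, hν A hA,
        ENNReal.toReal_ofReal hpos]
    rw [h1, map_smul, h2, ← integral_indicator hA, smul_eq_mul, ← integral_const_mul]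
    refine integral_congr_ae ?_
    filter_upwards [indicatorConstLp_coeFn (p := p) (hs := hA)
        (hμs := measure_ne_top P A) (c := (1 : ℝ)),
        Lp.coeFn_smul c (indicatorConstLp p hA (measure_ne_top P A) (1 : ℝ))] with ω h1 h3
    rw [h3, Pi.smul_apply, h1]
    by_cases hω : ω ∈ A <;> simp [hω, mul_comm]
  · intro f g hf hg _ h1 h2
    rw [map_add, h1, h2, ← integral_add (hadd (Lp.memLp _)) (hadd (Lp.memLp _))]
    refine integral_congr_ae ?_
    filter_upwards [Lp.coeFn_add hf.toLp hg.toLp] with ω hω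
    rw [hω, Pi.add_apply, mul_add]
  · exact isClosed_eq l.continuous hcont

end Representation

/-! ### The L^p–L^q pairing and the topology of L^p -/

section Pairing

variable {Ω : Type*} {mΩ : MeasurableSpace Ω} {P : Measure Ω} {d : ℕ} {p q : ℝ≥0∞}
  [ENNReal.HolderConjugate p q]

theorem integrable_dotProduct {Y X : Ω → Fin d → ℝ} (hY : MemLp Y q P) (hX : MemLp X p P) :
    Integrable (fun ω => Y ω ⬝ᵥ X ω) P := by
  simp only [dotProduct]
  exact integrable_finsetSum _ fun i _ => (hY.eval i).integrable_mul (hX.eval i)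

/-- The pairing `X ↦ E[YᵀX]` of `L^p` with an element `Y` of `L^q`. -/
noncomputable def pairing (p : ℝ≥0∞) [ENNReal.HolderConjugate p q] {Y : Ω → Fin d → ℝ}
    (hY : MemLp Y q P) : Lp (Fin d → ℝ) p P →ₗ[ℝ] ℝ where
  toFun X := ∫ ω, Y ω ⬝ᵥ X ω ∂P
  map_add' X Z := by
    rw [← integral_add (integrable_dotProduct hY (Lp.memLp X))
      (integrable_dotProduct hY (Lp.memLp Z))]
    refine integral_congr_ae ?_
    filter_upwards [Lp.coeFn_add X Z] with ω hω
    rw [hω, Pi.add_apply, dotProduct_add]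
  map_smul' c X := by
    rw [RingHom.id_apply, smul_eq_mul, ← integral_const_mul]
    refine integral_congr_ae ?_
    filter_upwards [Lp.coeFn_smul c X] with ω hω
    rw [hω, Pi.smul_apply, dotProduct_smul, smul_eq_mul]

theorem pairing_apply {Y : Ω → Fin d → ℝ} (hY : MemLp Y q P) (X : Lp (Fin d → ℝ) p P) :
    pairing p hY X = ∫ ω, Y ω ⬝ᵥ X ω ∂P := rfl

end Pairing

section Topology

variable {Ω : Type*} {mΩ : MeasurableSpace Ω} {P : Measure Ω} {d : ℕ} {p q : ℝ≥0∞}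
  [Fact (1 ≤ p)]

/-- As an infimum of topologies induced by linear functionals, the weak* topology inherits the
locally convex vector space structure, and its continuous functionals are the span of the pairings.
-/
theorem lpTopology_top [Fact ((1 : ℝ≥0∞) ≤ ∞)] : (lpTopology P ∞ : TopologicalSpace (Lp (Fin d → ℝ) ∞ P)) =
    ⨅ Y : Lp (Fin d → ℝ) 1 P, TopologicalSpace.induced (pairing ∞ (Lp.memLp Y)) inferInstance := by
  rw [lpTopology, if_pos rfl, Pi.topologicalSpace, induced_iInf]
  refine iInf_congr fun Y => ?_
  rw [induced_compose]
  rfl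

theorem lpTopology_of_ne_top (hp : p ≠ ∞) :
    lpTopology P p = (inferInstance : TopologicalSpace (Lp (Fin d → ℝ) p P)) := by
  rw [lpTopology, if_neg hp]

theorem isTopologicalAddGroup_lpTopology :
    @IsTopologicalAddGroup (Lp (Fin d → ℝ) p P) (lpTopology P p) _ := by
  by_cases hp : p = ∞
  · subst hp
    rw [lpTopology_top]
    exact topologicalAddGroup_iInf fun Y => topologicalAddGroup_induced _
  · rw [lpTopology_of_ne_top hp]; infer_instance

theorem continuousSMul_lpTopology :
    @ContinuousSMul ℝ (Lp (Fin d → ℝ) p P) _ _ (lpTopology P p) := by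
  by_cases hp : p = ∞
  · subst hp
    rw [lpTopology_top]
    exact continuousSMul_iInf fun Y => continuousSMul_induced _
  · rw [lpTopology_of_ne_top hp]; infer_instance

theorem locallyConvexSpace_lpTopology :
    @LocallyConvexSpace ℝ (Lp (Fin d → ℝ) p P) _ _ _ _ (lpTopology P p) := by
  by_cases hp : p = ∞
  · subst hp
    rw [lpTopology_top]
    exact LocallyConvexSpace.iInf fun Y => LocallyConvexSpace.induced _
  · rw [lpTopology_of_ne_top hp]; infer_instance

variable [ENNReal.HolderConjugate p q]

theorem continuous_pairing {Y : Ω → Fin d → ℝ} (hY : MemLp Y q P) :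
    @Continuous _ _ (lpTopology P p) _ (pairing p hY) := by
  by_cases hp : p = ∞
  · subst hp
    obtain rfl : q = 1 := ENNReal.HolderConjugate.unique ∞ q 1
    rw [lpTopology_top]
    have h1 : pairing ∞ hY = pairing ∞ (Lp.memLp hY.toLp) := by
      ext X
      refine integral_congr_ae ?_
      filter_upwards [hY.coeFn_toLp] with ω hω
      rw [hω]
    rw [h1]
    exact continuous_iInf_dom (i := hY.toLp) continuous_induced_dom
  · rw [lpTopology_of_ne_top hp]
    have : Fact (1 ≤ q) := ⟨ENNReal.HolderConjugate.one_le q p⟩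
    let B : Fin d → ((Fin d → ℝ) →L[ℝ] (Fin d → ℝ) →L[ℝ] ℝ) := fun i =>
      ((ContinuousLinearMap.mul ℝ ℝ).bilinearComp (ContinuousLinearMap.proj i)
        (ContinuousLinearMap.proj i))
    have h1 : (pairing p hY : Lp (Fin d → ℝ) p P → ℝ) =
        fun Z => ∑ i, (B i).lpPairing P q p hY.toLp Z := by
      ext Z
      simp_rw [ContinuousLinearMap.lpPairing_eq_integral]
      rw [pairing_apply, ← integral_finsetSum]
      · refine integral_congr_ae ?_
        filter_upwards [hY.coeFn_toLp] with ω hω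
        simp [hω, B, dotProduct]
      · intro i _
        have h2 : Integrable (fun ω => Y ω i * Z ω i) P :=
          (hY.eval i).integrable_mul ((Lp.memLp Z).eval i)
        refine h2.congr ?_
        filter_upwards [hY.coeFn_toLp] with ω hω
        simp [hω, B]
    rw [h1]
    exact continuous_finsetSum _ fun i _ => ContinuousLinearMap.continuous _

/-- Positive linear functionals that are continuous for `lpTopology` are represented by elements
of `L^q`. -/
theorem exists_pairing_of_positive [IsProbabilityMeasure P] (l : Lp (Fin d → ℝ) p P →ₗ[ℝ] ℝ)
    (hc : @Continuous _ _ (lpTopology P p) _ l)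
    (hl : ∀ Z : Lp (Fin d → ℝ) p P, (∀ᵐ ω ∂P, 0 ≤ Z ω) → 0 ≤ l Z) :
    ∃ (Y : Ω → Fin d → ℝ) (hY : MemLp Y q P), l = pairing p hY := by
  by_cases hp : p = ∞
  · subst hp
    obtain rfl : q = 1 := ENNReal.HolderConjugate.unique ∞ q 1
    -- For p = ∞ continuity alone places `l` in the span of the pairings, so positivity is dropped.
    rw [lpTopology_top, ← LinearMap.mem_span_iff_continuous] at hc
    clear hl
    induction hc using Submodule.span_induction with
    | mem x hx =>
      obtain ⟨Y, rfl⟩ := hx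
      exact ⟨Y, Lp.memLp Y, rfl⟩
    | zero =>
      refine ⟨0, MemLp.zero, ?_⟩
      ext X
      simp [pairing_apply]
    | add x y _ _ hx hy =>
      obtain ⟨Y, hY, rfl⟩ := hx
      obtain ⟨Z, hZ, rfl⟩ := hy
      refine ⟨Y + Z, hY.add hZ, ?_⟩
      ext X
      rw [LinearMap.add_apply, pairing_apply, pairing_apply, pairing_apply,
        ← integral_add (integrable_dotProduct hY (Lp.memLp X))
          (integrable_dotProduct hZ (Lp.memLp X))]
      simp only [Pi.add_apply, add_dotProduct]
    | smul c x _ hx =>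
      obtain ⟨Y, hY, rfl⟩ := hx
      refine ⟨c • Y, hY.const_smul c, ?_⟩
      ext X
      rw [LinearMap.smul_apply, pairing_apply, pairing_apply, smul_eq_mul, ← integral_const_mul]
      simp only [Pi.smul_apply, smul_dotProduct, smul_eq_mul]
  · rw [lpTopology_of_ne_top hp] at hc
    let L : Lp (Fin d → ℝ) p P →L[ℝ] ℝ := ⟨l, hc⟩
    -- Coordinate injections and projections reduce the claim to the scalar representation; each
    -- composite of `L` with `J i` is again positive.
    let J : Fin d → (Lp ℝ p P →L[ℝ] Lp (Fin d → ℝ) p P) := fun i =>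
      ContinuousLinearMap.compLpL p P (ContinuousLinearMap.single ℝ (fun _ : Fin d => ℝ) i)
    let π : Fin d → (Lp (Fin d → ℝ) p P →L[ℝ] Lp ℝ p P) := fun i =>
      ContinuousLinearMap.compLpL p P (ContinuousLinearMap.proj i)
    have hJ : ∀ i (Z : Lp ℝ p P), J i Z =ᵐ[P] fun ω => Pi.single i (Z ω) := fun i Z => by
      filter_upwards [ContinuousLinearMap.coeFn_compLpL
        (ContinuousLinearMap.single ℝ (fun _ : Fin d => ℝ) i) Z] with ω hω
      rw [hω]; simp
    have hπ : ∀ i (Z : Lp (Fin d → ℝ) p P), π i Z =ᵐ[P] fun ω => Z ω i := fun i Z => by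
      filter_upwards [ContinuousLinearMap.coeFn_compLpL
        (ContinuousLinearMap.proj (R := ℝ) (φ := fun _ : Fin d => ℝ) i) Z] with ω hω
      rw [hω]; simp
    have hsum : ∀ X : Lp (Fin d → ℝ) p P, X = ∑ i, J i (π i X) := fun X => by
      refine Lp.ext ?_
      have h1 : ∀ᵐ ω ∂P, ∀ i, π i X ω = X ω i := ae_all_iff.2 fun i => hπ i X
      have h2 : ∀ᵐ ω ∂P, ∀ i, J i (π i X) ω = Pi.single i (π i X ω) :=
        ae_all_iff.2 fun i => hJ i _
      filter_upwards [h1, h2, Lp.coeFn_fun_finsetSum Finset.univ fun i => J i (π i X)] with ω h1 h2 h3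
      rw [h3]
      simp_rw [h2, h1]
      exact (Finset.univ_sum_single (X ω)).symm
    have hrep : ∀ i, ∃ y : Ω → ℝ, MemLp y q P ∧ ∀ Z : Lp ℝ p P, (L ∘L J i) Z = ∫ ω, y ω * Z ω ∂P :=
      fun i => exists_density_of_positive_functional hp _ fun Z hZ => by
        refine hl _ ?_
        filter_upwards [hJ i Z, (Lp.coeFn_nonneg Z).2 hZ] with ω h1 h2
        refine le_of_le_of_eq ?_ h1.symm
        exact Pi.single_nonneg.2 h2
    choose y hy hyL using hrep
    refine ⟨fun ω i => y i ω, MemLp.of_eval hy, ?_⟩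
    ext X
    have h1 : l X = ∑ i, (L ∘L J i) (π i X) := by
      conv_lhs => rw [hsum X]
      rw [map_sum]
      rfl
    rw [h1, pairing_apply]
    simp only [dotProduct]
    rw [integral_finsetSum _ fun i _ => by
      exact (hy i).integrable_mul ((Lp.memLp X).eval i)]
    refine Finset.sum_congr rfl fun i _ => ?_
    rw [hyL]
    refine integral_congr_ae ?_
    filter_upwards [hπ i X] with ω hω
    rw [hω]

end Topology

theorem aestronglyMeasurable_of_forall {Ω : Type*} {m' mΩ : MeasurableSpace Ω} {P : Measure Ω}
    {d : ℕ} {f : Ω → Fin d → ℝ} (h : ∀ i, AEStronglyMeasurable[m'] (fun ω => f ω i) P) :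
    AEStronglyMeasurable[m'] f P := by
  refine ⟨fun ω i => (h i).mk _ ω, ?_, ?_⟩
  · exact Measurable.stronglyMeasurable <|
      @measurable_pi_lambda _ _ _ m' _ _ fun i => (h i).stronglyMeasurable_mk.measurable
  · filter_upwards [ae_all_iff.2 fun i => (h i).ae_eq_mk] with ω hω
    ext i
    exact hω i

/-! ### Eligible portfolios -/

section Eligible

theorem mem_orth_eligible {d m : ℕ} {v : Fin d → ℝ} :
    v ∈ orth (eligible d m) ↔ ∀ i : Fin d, (i : ℕ) < m → v i = 0 := by
  refine ⟨fun h i hi => ?_, fun h u hu => ?_⟩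
  · have h1 := h (Pi.single i 1) fun j hj => by
      rw [Pi.single_apply, if_neg]
      rintro rfl
      omega
    simpa using h1
  · refine Finset.sum_eq_zero fun i _ => ?_
    rcases lt_or_ge (i : ℕ) m with hi | hi
    · rw [h i hi, zero_mul]
    · rw [hu i hi, mul_zero]

theorem mem_dualCone_eligiblePos {d m : ℕ} {v : Fin d → ℝ} :
    v ∈ dualCone (eligiblePos d m) ↔ ∀ i : Fin d, (i : ℕ) < m → 0 ≤ v i := by
  refine ⟨fun h i hi => ?_, fun h u hu => ?_⟩
  · have h1 := h (Pi.single i 1) ⟨fun j hj => by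
      rw [Pi.single_apply, if_neg]
      rintro rfl
      omega, Pi.single_nonneg.2 zero_le_one⟩
    simpa using h1
  · refine Finset.sum_nonneg fun i _ => ?_
    rcases lt_or_ge (i : ℕ) m with hi | hi
    · exact mul_nonneg (h i hi) (hu.2 i)
    · rw [hu.1 i hi, mul_zero]

variable {Ω : Type*} {mΩ : MeasurableSpace Ω} {P : Measure Ω}
  {ι : Type*} [LinearOrder ι] {ℱ : Filtration ι mΩ} {d m : ℕ} {p : ℝ≥0∞} {t : ι}

theorem mem_Mt {X : Lp (Fin d → ℝ) p P} :
    X ∈ Mt P ℱ p m t ↔ AEStronglyMeasurable[ℱ t] X P ∧ ∀ᵐ ω ∂P, X ω ∈ eligible d m :=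
  ⟨fun h => ⟨h.1, h.2.2⟩, fun h => ⟨h.1, Lp.memLp X, h.2⟩⟩

theorem mem_MtPos {X : Lp (Fin d → ℝ) p P} :
    X ∈ MtPos P ℱ p m t ↔ X ∈ Mt P ℱ p m t ∧ ∀ᵐ ω ∂P, 0 ≤ X ω :=
  ⟨fun h => ⟨⟨h.1, h.2.1, h.2.2.mono fun _ h => h.1⟩, h.2.2.mono fun _ h => h.2⟩,
    fun h => ⟨h.1.1, h.1.2.1, h.1.2.2.and h.2⟩⟩

theorem zero_mem_Mt : (0 : Lp (Fin d → ℝ) p P) ∈ Mt P ℱ p m t := by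
  refine mem_Mt.2 ⟨aestronglyMeasurable_zero.congr (Lp.coeFn_zero _ _ _).symm, ?_⟩
  filter_upwards [Lp.coeFn_zero (Fin d → ℝ) p P] with ω hω
  rw [hω]
  exact fun i _ => rfl

theorem add_mem_Mt {X Y : Lp (Fin d → ℝ) p P} (hX : X ∈ Mt P ℱ p m t) (hY : Y ∈ Mt P ℱ p m t) :
    X + Y ∈ Mt P ℱ p m t := by
  rw [mem_Mt] at *
  refine ⟨(hX.1.add hY.1).congr (Lp.coeFn_add _ _).symm, ?_⟩
  filter_upwards [Lp.coeFn_add X Y, hX.2, hY.2] with ω hω h1 h2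
  rw [hω]
  intro i hi
  rw [Pi.add_apply, Pi.add_apply, h1 i hi, h2 i hi, add_zero]

theorem smul_mem_Mt (c : ℝ) {X : Lp (Fin d → ℝ) p P} (hX : X ∈ Mt P ℱ p m t) :
    c • X ∈ Mt P ℱ p m t := by
  rw [mem_Mt] at *
  refine ⟨(hX.1.const_smul c).congr (Lp.coeFn_smul _ _).symm, ?_⟩
  filter_upwards [Lp.coeFn_smul c X, hX.2] with ω hω h1
  rw [hω]
  intro i hi
  rw [Pi.smul_apply, Pi.smul_apply, h1 i hi, smul_zero]

theorem neg_mem_Mt {X : Lp (Fin d → ℝ) p P} (hX : X ∈ Mt P ℱ p m t) :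
    -X ∈ Mt P ℱ p m t := by
  simpa using smul_mem_Mt (-1) hX

theorem convex_Mt : Convex ℝ (Mt P ℱ p m t : Set (Lp (Fin d → ℝ) p P)) :=
  fun _ hX _ hY _ _ _ _ _ => add_mem_Mt (smul_mem_Mt _ hX) (smul_mem_Mt _ hY)

theorem zero_mem_MtPos : (0 : Lp (Fin d → ℝ) p P) ∈ MtPos P ℱ p m t := by
  refine mem_MtPos.2 ⟨zero_mem_Mt, ?_⟩
  filter_upwards [Lp.coeFn_zero (Fin d → ℝ) p P] with ω hω
  rw [hω]; rfl

/-- Every eligible portfolio is the difference of two nonnegative ones. -/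
theorem exists_add_mem_MtPos {X : Lp (Fin d → ℝ) p P} (hX : X ∈ Mt P ℱ p m t) :
    ∃ e ∈ MtPos P ℱ p m t, X + e ∈ MtPos P ℱ p m t := by
  have hX' := mem_Mt.1 hX
  let φ : (Fin d → ℝ) → Fin d → ℝ := fun x i => max (-x i) 0
  have hφ : Continuous φ := by fun_prop
  have hm : MemLp (fun ω => φ (X ω)) p P := MemLp.of_eval fun i => by
    refine ((Lp.memLp X).eval i).mono (((continuous_apply i).comp hφ).comp_aestronglyMeasurable
      (Lp.aestronglyMeasurable X)) (ae_of_all _ fun ω => ?_)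
    simp only [φ, Real.norm_eq_abs]
    rw [abs_of_nonneg (le_max_right _ _)]
    exact max_le (neg_le_abs _) (abs_nonneg _)
  have he : (hm.toLp : Lp (Fin d → ℝ) p P) ∈ Mt P ℱ p m t := by
    refine mem_Mt.2 ⟨(hφ.comp_aestronglyMeasurable hX'.1).congr hm.coeFn_toLp.symm, ?_⟩
    filter_upwards [hm.coeFn_toLp, hX'.2] with ω h1 h2
    rw [h1]
    intro i hi
    simp [φ, h2 i hi]
  refine ⟨hm.toLp, mem_MtPos.2 ⟨he, ?_⟩, mem_MtPos.2 ⟨add_mem_Mt hX he, ?_⟩⟩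
  · filter_upwards [hm.coeFn_toLp] with ω h1
    rw [h1]
    exact fun i => le_max_right _ _
  · filter_upwards [hm.coeFn_toLp, Lp.coeFn_add X hm.toLp] with ω h1 h2
    rw [h2, Pi.add_apply, h1]
    intro i
    have := le_max_left (-X ω i) 0
    simp only [φ, Pi.add_apply, Pi.zero_apply]
    linarith

/-- Both sides equal E[E[g|m'] E[f|m']]; the bound on g makes the products integrable. -/
theorem integral_condExp_mul {m' : MeasurableSpace Ω} (hm' : m' ≤ mΩ) [IsFiniteMeasure P]
    {f g : Ω → ℝ} (hf : Integrable f P) (hg : Integrable g P) {C : ℝ} (hC : ∀ᵐ ω ∂P, ‖g ω‖ ≤ C) :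
    ∫ ω, (P[g | m']) ω * f ω ∂P = ∫ ω, g ω * (P[f | m']) ω ∂P := by
  have hCE : ∀ᵐ ω ∂P, ‖(P[g | m']) ω‖ ≤ C := ae_bdd_norm_condExp_of_ae_bdd_norm hC
  have h1 : Integrable (P[g | m'] * f) P := hf.bdd_mul integrable_condExp.1 hCE
  have h2 : Integrable (g * P[f | m']) P := integrable_condExp.bdd_mul hg.1 hC
  have h3 := condExp_mul_of_stronglyMeasurable_left stronglyMeasurable_condExp h1 hf
  have h4 := condExp_mul_of_stronglyMeasurable_right stronglyMeasurable_condExp h2 hg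
  calc ∫ ω, (P[g | m']) ω * f ω ∂P = ∫ ω, (P[P[g | m'] * f | m']) ω ∂P :=
        (integral_condExp hm').symm
    _ = ∫ ω, (P[g * P[f | m'] | m']) ω ∂P := integral_congr_ae (h3.trans h4.symm)
    _ = ∫ ω, g ω * (P[f | m']) ω ∂P := integral_condExp hm'

/-- To cover the weak* case as well, M_t is written as a common kernel of pairings with L^q. The
coordinate X_i is F_t-measurable iff E[(1_A - E[1_A | F_t]) X_i] = 0 for every event A, by
self-adjointness of conditional expectation, and X_i = 0 iff E[1_A X_i] = 0 for every A. -/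
theorem isClosed_Mt [IsProbabilityMeasure P] [Fact (1 ≤ p)] :
    @IsClosed _ (lpTopology P p) (Mt P ℱ p m t : Set (Lp (Fin d → ℝ) p P)) := by
  have hp1 : 1 ≤ p := Fact.out
  obtain ⟨q, hpq⟩ : ∃ q, ENNReal.HolderConjugate p q :=
    ⟨ENNReal.conjExponent p, ENNReal.HolderConjugate.conjExponent hp1⟩
  have hmem : ∀ (A : Set Ω), MeasurableSet A → ∀ i : Fin d,
      MemLp (fun ω => (Pi.single i (A.indicator 1 ω) : Fin d → ℝ)) q P := fun A hA i =>
    MemLp.of_eval fun j => by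
      by_cases hj : j = i
      · subst hj
        simpa using! (memLp_indicator_const q hA (1 : ℝ) (Or.inr (measure_ne_top P A)))
      · simp [hj]
  have hind : ∀ (A : Set Ω), MeasurableSet A → MemLp (A.indicator 1 : Ω → ℝ) q P := fun A hA =>
    memLp_indicator_const q hA (1 : ℝ) (Or.inr (measure_ne_top P A))
  have hq1 : 1 ≤ q := ENNReal.HolderConjugate.one_le q p
  have hmem' : ∀ (A : Set Ω), MeasurableSet A → ∀ i : Fin d,
      MemLp (fun ω => (Pi.single i (A.indicator 1 ω - (P[A.indicator (1 : Ω → ℝ) | ℱ t]) ω) :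
        Fin d → ℝ)) q P := fun A hA i =>
    MemLp.of_eval fun j => by
      by_cases hj : j = i
      · subst hj
        simpa using! (hind A hA).sub ((hind A hA).condExp hq1)
      · simp [hj]
  have hset : (Mt P ℱ p m t : Set (Lp (Fin d → ℝ) p P)) =
      (⋂ (A : Set Ω) (hA : MeasurableSet A) (i : Fin d), {X | pairing p (hmem' A hA i) X = 0}) ∩
      ⋂ (A : Set Ω) (hA : MeasurableSet A) (i : Fin d) (_ : m ≤ (i : ℕ)),
        {X | pairing p (hmem A hA i) X = 0} := by
    ext X
    have hXi : ∀ i, Integrable (fun ω => X ω i) P := fun i =>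
      ((Lp.memLp X).eval i).integrable hp1
    have hb : ∀ A : Set Ω, ∀ᵐ ω ∂P, ‖(A.indicator (1 : Ω → ℝ)) ω‖ ≤ 1 := fun A =>
      ae_of_all _ fun ω => by by_cases hω : ω ∈ A <;> simp [hω]
    have hmul : ∀ (A : Set Ω) (f : Ω → ℝ), (fun ω => A.indicator (1 : Ω → ℝ) ω * f ω) =
        A.indicator f := fun A f => by
      ext ω; by_cases hω : ω ∈ A <;> simp [hω]
    have hpair : ∀ A (hA : MeasurableSet A) i, pairing p (hmem' A hA i) X =
        ∫ ω in A, X ω i ∂P - ∫ ω in A, (P[fun ω => X ω i | ℱ t]) ω ∂P := fun A hA i => by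
      have hI : Integrable (A.indicator (1 : Ω → ℝ)) P := (integrable_indicator_iff hA).2 (integrable_const (μ := P) (1 : ℝ)).integrableOn
      rw [pairing_apply]
      simp only [single_dotProduct, sub_mul]
      rw [integral_sub, integral_condExp_mul (ℱ.le t) (hXi i) hI (hb A), hmul, hmul,
        integral_indicator hA, integral_indicator hA]
      · rw [hmul]; exact (hXi i).indicator hA
      · exact (hXi i).bdd_mul integrable_condExp.1 (ae_bdd_norm_condExp_of_ae_bdd_norm (hb A))
    have hpair' : ∀ A (hA : MeasurableSet A) i, pairing p (hmem A hA i) X =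
        ∫ ω in A, X ω i ∂P := fun A hA i => by
      rw [pairing_apply]
      simp only [single_dotProduct]
      rw [hmul, integral_indicator hA]
    simp only [Set.mem_inter_iff, Set.mem_iInter, Set.mem_ofPred_eq]
    rw [mem_Mt]
    refine and_congr ⟨fun h A hA i => ?_, fun h => ?_⟩ ⟨fun h A hA i hi => ?_, fun h => ?_⟩
    · rw [hpair A hA i, setIntegral_congr_ae hA, sub_self]
      filter_upwards [condExp_of_aestronglyMeasurable' (ℱ.le t) ((continuous_apply i).comp_aestronglyMeasurable h) (hXi i)] with ω hω _
      exact hω.symm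
    · have h1 : ∀ i, (fun ω => X ω i) =ᵐ[P] P[fun ω => X ω i | ℱ t] := fun i =>
        Integrable.ae_eq_of_forall_setIntegral_eq _ _ (hXi i) integrable_condExp
          fun A hA _ => sub_eq_zero.1 ((hpair A hA i).symm.trans (h A hA i))
      have h2 : (X : Ω → Fin d → ℝ) =ᵐ[P] fun ω i => (P[fun ω => X ω i | ℱ t]) ω := by
        filter_upwards [ae_all_iff.2 h1] with ω hω
        ext i
        exact hω i
      exact (aestronglyMeasurable_of_forall fun i =>
        stronglyMeasurable_condExp.aestronglyMeasurable).congr h2.symm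
    · rw [hpair' A hA i, setIntegral_congr_ae hA (g := fun _ => (0 : ℝ)), integral_zero]
      filter_upwards [h] with ω hω _ using hω i hi
    · have h1 : ∀ᵐ ω ∂P, ∀ i : Fin d, m ≤ (i : ℕ) → X ω i = 0 := by
        refine ae_all_iff.2 fun i => ?_
        by_cases hi : m ≤ (i : ℕ)
        · have h2 : (fun ω => X ω i) =ᵐ[P] fun _ => 0 :=
            Integrable.ae_eq_of_forall_setIntegral_eq _ _ (hXi i) (integrable_zero _ _ _)
              fun A hA _ => by rw [← hpair' A hA i, h A hA i hi]; simp
          filter_upwards [h2] with ω hω _ using hω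
        · exact ae_of_all _ fun ω h => absurd h hi
      exact h1
  rw [hset]
  let : TopologicalSpace (Lp (Fin d → ℝ) p P) := lpTopology P p
  refine IsClosed.inter (isClosed_iInter fun A => isClosed_iInter fun hA => isClosed_iInter fun i =>
      isClosed_eq (continuous_pairing (hmem' A hA i)) continuous_const)
    (isClosed_iInter fun A => isClosed_iInter fun hA => isClosed_iInter fun i =>
      isClosed_iInter fun _ => isClosed_eq (continuous_pairing (hmem A hA i)) continuous_const)

end Eligible

/-! ### The closed convex cone R(0) and convex upper continuity -/

section Cone

variable {Ω : Type*} {mΩ : MeasurableSpace Ω} {P : Measure Ω} [IsProbabilityMeasure P]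
  {ι : Type*} [LinearOrder ι] {ℱ : Filtration ι mΩ} {d m : ℕ} {p : ℝ≥0∞} [Fact (1 ≤ p)] {t : ι}
  {R : Lp (Fin d → ℝ) p P → Set (Lp (Fin d → ℝ) p P)} {R0 : Ω → Set (Fin d → ℝ)}

theorem ConditionallyConvex.combo_mem (hconv : ConditionallyConvex ℱ t R)
    {X Y u v : Lp (Fin d → ℝ) p P} (hu : u ∈ R X) (hv : v ∈ R Y) {a b : ℝ} (ha : 0 ≤ a)
    (hb : 0 ≤ b) (hab : a + b = 1) : a • u + b • v ∈ R (a • X + b • Y) := by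
  obtain rfl : b = 1 - a := by linarith
  have h : ∀ X Y : Lp (Fin d → ℝ) p P, (a • X + (1 - a) • Y : Lp (Fin d → ℝ) p P) =ᵐ[P]
      fun ω => a • X ω + (1 - a) • Y ω := fun X Y => by
    filter_upwards [Lp.coeFn_add (a • X) ((1 - a) • Y), Lp.coeFn_smul a X,
      Lp.coeFn_smul (1 - a) Y] with ω h1 h2 h3
    rw [h1, Pi.add_apply, h2, h3]
    rfl
  exact hconv X Y _ (fun _ => a) aestronglyMeasurable_const
    (ae_of_all _ fun _ => ⟨ha, by linarith⟩) (h X Y) u hu v hv _ (h u v)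

theorem ConditionallyConvex.convex (hconv : ConditionallyConvex ℱ t R) (X : Lp (Fin d → ℝ) p P) :
    Convex ℝ (R X) := fun u hu v hv a b ha hb hab => by
  have := hconv.combo_mem hu hv ha hb hab
  rwa [Convex.combo_self hab] at this

/-- Normalization splits u ∈ R(0) as a + b with a, b ∈ R(0), so convexity puts u/2 = a/2 + b/2 in
R(0). Iterated halving tends to 0, and R(0) is closed. -/
theorem zero_mem_zero (hR : IsConditionalRiskMeasure P ℱ p m t R R0) (hnorm : Normalized R)
    (hconv : ConditionallyConvex ℱ t R) : (0 : Lp (Fin d → ℝ) p P) ∈ R 0 := by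
  have hhalf : ∀ u ∈ R 0, (1 / 2 : ℝ) • u ∈ R 0 := by
    intro u hu
    rw [hnorm 0] at hu
    obtain ⟨a, ha, b, hb, rfl⟩ := hu
    rw [smul_add]
    exact hconv.convex 0 ha hb (by norm_num) (by norm_num) (by norm_num)
  obtain ⟨u, hu⟩ := hR.nonempty_zero
  have hn : ∀ n : ℕ, ((1 / 2 : ℝ) ^ n) • u ∈ R 0 := by
    intro n
    induction n with
    | zero => simpa using hu
    | succ n ih => rw [pow_succ', mul_smul]; exact hhalf _ ih
  let := lpTopology (d := d) P p
  have := continuousSMul_lpTopology (d := d) (P := P) (p := p)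
  have hlim : Tendsto (fun n : ℕ => ((1 / 2 : ℝ) ^ n) • u) atTop (nhds ((0 : ℝ) • u)) :=
    (tendsto_pow_atTop_nhds_zero_of_lt_one (by norm_num) (by norm_num)).smul tendsto_const_nhds
  rw [zero_smul] at hlim
  exact hR.closed_zero.mem_of_tendsto hlim (Eventually.of_forall hn)

theorem Normalized.add_mem (hnorm : Normalized R) {u v : Lp (Fin d → ℝ) p P} (hu : u ∈ R 0)
    (hv : v ∈ R 0) : u + v ∈ R 0 := by
  rw [hnorm 0]
  exact Set.add_mem_add hu hv

/-- Integer multiples come from normalization; c u lies on the segment from 0 to n u for an integer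
n > c. -/
theorem smul_mem_zero (hR : IsConditionalRiskMeasure P ℱ p m t R R0) (hnorm : Normalized R)
    (hconv : ConditionallyConvex ℱ t R) {c : ℝ} (hc : 0 ≤ c) {u : Lp (Fin d → ℝ) p P}
    (hu : u ∈ R 0) : c • u ∈ R 0 := by
  have h0 := zero_mem_zero hR hnorm hconv
  have hn : ∀ n : ℕ, (n : ℝ) • u ∈ R 0 := by
    intro n
    induction n with
    | zero => simpa using h0
    | succ n ih =>
      rw [Nat.cast_succ, add_smul, one_smul]
      exact hnorm.add_mem ih hu
  obtain ⟨n, hn'⟩ := exists_nat_gt c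
  have hn0 : (0 : ℝ) < n := hc.trans_lt hn'
  have h1 := hconv.convex 0 (hn n) h0 (a := c / n) (b := 1 - c / n) (by positivity)
    (by rw [sub_nonneg, div_le_one hn0]; exact hn'.le) (by ring)
  rwa [smul_zero, add_zero, smul_smul, div_mul_cancel₀ _ hn0.ne'] at h1

theorem mtPos_subset_zero (hR : IsConditionalRiskMeasure P ℱ p m t R R0) (hnorm : Normalized R)
    (hconv : ConditionallyConvex ℱ t R) : MtPos P ℱ p m t ⊆ R 0 := fun u hu => by
  rw [hR.upper 0]
  exact ⟨0, zero_mem_zero hR hnorm hconv, u, hu, zero_add u⟩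

/-- Closed convex sets of eligible portfolios that are stable under subtraction of nonnegative
portfolios are admissible test sets for convex upper continuity. -/
theorem mem_lowerClosedConvex {D : Set (Lp (Fin d → ℝ) p P)} (hD : D ⊆ Mt P ℱ p m t)
    (hconv : Convex ℝ D) (hcl : @IsClosed _ (lpTopology P p) D)
    (hlow : ∀ u ∈ D, ∀ e ∈ MtPos P ℱ p m t, u - e ∈ D) : D ∈ lowerClosedConvex P ℱ p m t := by
  refine ⟨hD, ?_⟩
  have h1 : D + -MtPos P ℱ p m t = D := by
    refine Set.Subset.antisymm ?_ fun u hu =>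
      ⟨u, hu, 0, by simpa using! zero_mem_MtPos, add_zero u⟩
    rintro _ ⟨u, hu, e, he, rfl⟩
    simpa using hlow u hu (-e) he
  rw [h1, hconv.convexHull_eq, @IsClosed.closure_eq _ (lpTopology P p) _ hcl]

/-- A convex upper continuous normalized risk measure accepts, among eligible portfolios, only
those that are nonnegative for every continuous functional that is nonnegative on `M_{t,+}`. -/
theorem nonneg_on_zero_of_convexUpperContinuous
    (hR : IsConditionalRiskMeasure P ℱ p m t R R0) (hnorm : Normalized R)
    (hconv : ConditionallyConvex ℱ t R) (hcuc : ConvexUpperContinuous ℱ m t R)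
    (hne : ∃ x ∈ Mt P ℱ p m t, x ∉ R 0) (g : Lp (Fin d → ℝ) p P →ₗ[ℝ] ℝ)
    (hgc : @Continuous _ _ (lpTopology P p) _ g) (hg : ∀ e ∈ MtPos P ℱ p m t, 0 ≤ g e) :
    ∀ k ∈ R 0, 0 ≤ g k := by
  let := lpTopology (d := d) P p
  have := isTopologicalAddGroup_lpTopology (d := d) (P := P) (p := p)
  have := continuousSMul_lpTopology (d := d) (P := P) (p := p)
  have := locallyConvexSpace_lpTopology (d := d) (P := P) (p := p)
  obtain ⟨x, hxM, hx⟩ := hne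
  have h0 := zero_mem_zero hR hnorm hconv
  -- Separating x from the cone gives f ≥ 0 on R(0) with f(x) < 0. Since x + e ∈ M_{t,+} ⊆ R(0),
  -- this forces f(e) > 0 for a nonnegative e.
  obtain ⟨f, a, hfx, hfK⟩ :=
    geometric_hahn_banach_point_closed (hconv.convex 0) hR.closed_zero hx
  have ha : a < 0 := by simpa using hfK 0 h0
  have hf : ∀ k ∈ R 0, 0 ≤ f k := by
    intro k hk
    by_contra! hneg
    have h1 := hfK _ (smul_mem_zero hR hnorm hconv (div_pos_of_neg_of_neg ha hneg).le hk)
    rw [map_smul, smul_eq_mul, div_mul_cancel₀ _ hneg.ne] at h1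
    exact lt_irrefl _ h1
  obtain ⟨e, he, hxe⟩ := exists_add_mem_MtPos hxM
  have hfe : 0 < f e := by
    have h1 := hf _ (mtPos_subset_zero hR hnorm hconv hxe)
    rw [map_add] at h1
    linarith
  by_contra! hcon
  obtain ⟨k0, hk0, hgk0⟩ := hcon
  -- With c the infimum of f on the slice g = -1, the functional F = f + c g is still nonnegative on
  -- the cone, but its infimum on the slice is 0. Thus g can be very negative while F is almost
  -- zero.
  let S : Set ℝ := f '' {k | k ∈ R 0 ∧ g k = -1}
  have hSne : S.Nonempty := by
    refine ⟨_, (-(1 / g k0)) • k0, ⟨smul_mem_zero hR hnorm hconv ?_ hk0, ?_⟩, rfl⟩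
    · rw [neg_nonneg]; exact (one_div_neg.2 hgk0).le
    · rw [map_smul, smul_eq_mul, neg_mul, one_div, inv_mul_cancel₀ hgk0.ne]
  have hSb : ∀ s ∈ S, 0 ≤ s := by
    rintro _ ⟨k, hk, rfl⟩
    exact hf k hk.1
  set c := sInf S with hc
  have hc0 : 0 ≤ c := le_csInf hSne hSb
  have hcS : ∀ s ∈ S, c ≤ s := fun s hs => csInf_le ⟨0, hSb⟩ hs
  let F : Lp (Fin d → ℝ) p P →ₗ[ℝ] ℝ := f.toLinearMap + c • g
  have hFapp : ∀ k, F k = f k + c * g k := fun k => rfl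
  have hFc : Continuous F := f.continuous.add (continuous_const.mul hgc)
  have hF : ∀ k ∈ R 0, 0 ≤ F k := by
    intro k hk
    rw [hFapp]
    rcases le_or_gt 0 (g k) with h | h
    · exact add_nonneg (hf k hk) (mul_nonneg hc0 h)
    · have h1 := hcS _ ⟨(-(1 / g k)) • k, ⟨smul_mem_zero hR hnorm hconv
        (by rw [neg_nonneg]; exact (one_div_neg.2 h).le) hk, by
          rw [map_smul, smul_eq_mul, neg_mul, one_div, inv_mul_cancel₀ h.ne]⟩, rfl⟩
      rw [map_smul, smul_eq_mul, neg_mul, one_div, ← div_eq_inv_mul, ← div_neg,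
        le_div_iff₀ (neg_pos.2 h)] at h1
      linarith
  have hFe : 0 < F e := by
    rw [hFapp]
    exact add_pos_of_pos_of_nonneg hfe (mul_nonneg hc0 (hg e he))
  have hFpos : ∀ e ∈ MtPos P ℱ p m t, 0 ≤ F e := fun e he =>
    hF e (mtPos_subset_zero hR hnorm hconv he)
  -- The half-spaces H_j ≤ -1 are bounded by tangents to the hyperbola 4 F g = 1 in the quadrant F,
  -- g < 0. Their intersection meets R(-) at every small positive multiple of e, but not at 0, which
  -- contradicts closedness.
  let H : ℕ → Lp (Fin d → ℝ) p P →ₗ[ℝ] ℝ := fun j => ((j : ℝ) + 1) • F + (1 / ((j : ℝ) + 1)) • g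
  have hHapp : ∀ j u, H j u = ((j : ℝ) + 1) * F u + 1 / ((j : ℝ) + 1) * g u := fun j u => rfl
  have hHc : ∀ j, Continuous (H j) := fun j =>
    (continuous_const.mul hFc).add (continuous_const.mul hgc)
  let D : Set (Lp (Fin d → ℝ) p P) := Mt P ℱ p m t ∩ ⋂ j, {u | H j u ≤ -1}
  have hmemD : ∀ u, u ∈ D ↔ u ∈ Mt P ℱ p m t ∧ ∀ j, H j u ≤ -1 := fun u => by
    simp [D]
  have hD : D ∈ lowerClosedConvex P ℱ p m t := by
    refine mem_lowerClosedConvex Set.inter_subset_left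
      (convex_Mt.inter (convex_iInter fun j => convex_halfSpace_le (H j).isLinear _))
      (isClosed_Mt.inter (isClosed_iInter fun j => isClosed_le (hHc j) continuous_const)) ?_
    intro u hu e he
    rw [hmemD] at hu ⊢
    refine ⟨?_, fun j => ?_⟩
    · rw [sub_eq_add_neg]
      exact add_mem_Mt hu.1 (neg_mem_Mt (mem_MtPos.1 he).1)
    · have h1 : 0 ≤ H j e := by
        rw [hHapp]
        have := hFpos e he
        have := hg e he
        positivity
      rw [map_sub]
      linarith [hu.2 j]
  have hmem : ∀ n : ℕ, (1 / ((n : ℝ) + 1)) • e ∈ {X | (R X ∩ D).Nonempty} := by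
    intro n
    set σ : ℝ := 1 / ((n : ℝ) + 1) with hσ
    have hσ0 : 0 < σ := by positivity
    -- A slice point k with F(k) ≤ b², scaled by 1/b and shifted by -σe, has F ≤ b - 2b = -b and g ≤
    -- -1/b. With y = (j+1)b this gives H_j ≤ -(y + 1/y) ≤ -1.
    set b : ℝ := σ * F e / 2 with hb
    have hb0 : 0 < b := by positivity
    obtain ⟨_, ⟨k, ⟨hkK, hgk⟩, rfl⟩, hk⟩ :=
      exists_lt_of_csInf_lt hSne (show sInf S < c + b ^ 2 by rw [← hc]; nlinarith)
    have hFk : F k ≤ b ^ 2 := by rw [hFapp, hgk]; linarith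
    refine ⟨(1 / b) • k - σ • e, ?_, (hmemD _).2 ⟨?_, fun j => ?_⟩⟩
    · have h1 := hR.translative 0 (σ • e) (smul_mem_Mt σ (mem_MtPos.1 he).1)
      rw [zero_add] at h1
      rw [h1]
      exact ⟨(1 / b) • k, smul_mem_zero hR hnorm hconv (by positivity) hkK, rfl⟩
    · rw [sub_eq_add_neg]
      exact add_mem_Mt (smul_mem_Mt _ (hR.subset_eligible 0 hkK))
        (neg_mem_Mt (smul_mem_Mt _ (mem_MtPos.1 he).1))
    · have hj : (0 : ℝ) < (j : ℝ) + 1 := by positivity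
      rw [hHapp, map_sub, map_sub, map_smul, map_smul, map_smul, map_smul, hgk]
      simp only [smul_eq_mul]
      have h1 : 1 / b * F k ≤ b := by
        rw [one_div, inv_mul_le_iff₀ hb0]; nlinarith
      have h2 : 1 / b * F k - σ * F e ≤ -b := by
        have : σ * F e = 2 * b := by rw [hb]; ring
        linarith
      have h3 : 1 / b * -1 - σ * g e ≤ -(1 / b) := by
        have := mul_nonneg hσ0.le (hg e he)
        linarith
      have h4 := mul_le_mul_of_nonneg_left h2 hj.le
      have h5 := mul_le_mul_of_nonneg_left h3 (one_div_pos.2 hj).le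
      have h6 : 1 ≤ ((j : ℝ) + 1) * b + 1 / ((j : ℝ) + 1) * (1 / b) := by
        set y := ((j : ℝ) + 1) * b with hy
        have hy0 : 0 < y := by positivity
        have h7 : 1 / ((j : ℝ) + 1) * (1 / b) = 1 / y := by rw [hy]; field_simp
        rw [h7]
        rcases le_total 1 y with h | h
        · have : 0 < 1 / y := by positivity
          linarith
        · have : 1 ≤ 1 / y := by rw [le_div_iff₀ hy0]; linarith
          linarith
      linarith
  have hlim : Tendsto (fun n : ℕ => (1 / ((n : ℝ) + 1)) • e) atTop (nhds ((0 : ℝ) • e)) :=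
    tendsto_one_div_add_atTop_nhds_zero_nat.smul tendsto_const_nhds
  rw [zero_smul] at hlim
  obtain ⟨u, huK, huD⟩ := (hcuc D hD).mem_of_tendsto hlim (Eventually.of_forall hmem)
  have huD' := ((hmemD u).1 huD).2
  have hFu := hF u huK
  -- On R(0) one has F(u) ≥ 0, so H_j(u) ≤ -1 forces g(u) ≤ -(j + 1) for every j.
  obtain ⟨j, hj⟩ := exists_nat_gt (-g u)
  have h1 := huD' j
  rw [hHapp] at h1
  have hj0 : (0 : ℝ) < (j : ℝ) + 1 := by positivity
  have h2 : 1 / ((j : ℝ) + 1) * g u ≤ -1 := by nlinarith [mul_nonneg hj0.le hFu]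
  rw [one_div, inv_mul_le_iff₀ hj0] at h2
  linarith

end Cone

theorem aestronglyMeasurable_indicator_of_measurableSet {Ω E : Type*} {m' mΩ : MeasurableSpace Ω}
    {P : Measure Ω} [TopologicalSpace E] [Zero E] {f : Ω → E} (hf : AEStronglyMeasurable[m'] f P)
    {A : Set Ω} (hA : MeasurableSet[m'] A) : AEStronglyMeasurable[m'] (A.indicator f) P :=
  ⟨A.indicator (hf.mk f), hf.stronglyMeasurable_mk.indicator hA, by
    filter_upwards [hf.ae_eq_mk] with ω hω
    by_cases h : ω ∈ A <;> simp [h, hω]⟩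

/-! ### Measurable selections of random closed sets -/

section Selection

/-- The Kuratowski–Ryll-Nardzewski measurable selection theorem. -/
theorem exists_measurable_selection {Ω E : Type*} [MeasurableSpace Ω] [MetricSpace E]
    [CompleteSpace E] [TopologicalSpace.SeparableSpace E] [MeasurableSpace E] [BorelSpace E]
    [Nonempty E] {K : Ω → Set E} (hcl : ∀ ω, IsClosed (K ω))
    (hm : ∀ G : Set E, IsOpen G → MeasurableSet {ω | (K ω ∩ G).Nonempty})
    (hne : ∀ ω, (K ω).Nonempty) : ∃ f : Ω → E, Measurable f ∧ ∀ ω, f ω ∈ K ω := by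
  classical
  let u := TopologicalSpace.denseSeq E
  have hu : ∀ (x : E) (r : ℝ), 0 < r → ∃ n, x ∈ Metric.ball (u n) r := fun x r hr => by
    obtain ⟨n, hn⟩ := (TopologicalSpace.denseRange_denseSeq E).exists_dist_lt x hr
    exact ⟨n, hn⟩
  let r : ℕ → ℝ := fun k => (1 / 2) ^ k
  have hr : ∀ k, 0 < r k := fun k => by positivity
  -- At stage k, a measurable index N picks a ball of radius 2^(-k) that meets K ω; the next ball is
  -- chosen to meet it inside K ω. The centres are then Cauchy, and their limit lies in K ω because
  -- K ω is closed.
  let T : ℕ → Type _ := fun k => {N : Ω → ℕ // Measurable N ∧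
    ∀ ω, (K ω ∩ Metric.ball (u (N ω)) (r k)).Nonempty}
  have base : Nonempty (T 0) := by
    have h1 : ∀ ω, ∃ n, (K ω ∩ Metric.ball (u n) (r 0)).Nonempty := fun ω => by
      obtain ⟨x, hx⟩ := hne ω
      obtain ⟨n, hn⟩ := hu x (r 0) (hr 0)
      exact ⟨n, x, hx, hn⟩
    exact ⟨fun ω => Nat.find (h1 ω), measurable_find h1 fun n => hm _ Metric.isOpen_ball,
      fun ω => Nat.find_spec (h1 ω)⟩
  have step : ∀ k (N : T k), ∃ N' : T (k + 1), ∀ ω,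
      (K ω ∩ (Metric.ball (u (N.1 ω)) (r k) ∩ Metric.ball (u (N'.1 ω)) (r (k + 1)))).Nonempty := by
    rintro k ⟨N, hN, hNK⟩
    have h1 : ∀ ω, ∃ n,
        (K ω ∩ (Metric.ball (u (N ω)) (r k) ∩ Metric.ball (u n) (r (k + 1)))).Nonempty := fun ω => by
      obtain ⟨x, hx, hx'⟩ := hNK ω
      obtain ⟨n, hn⟩ := hu x (r (k + 1)) (hr _)
      exact ⟨n, x, hx, hx', hn⟩
    have h2 : ∀ n, MeasurableSet
        {ω | (K ω ∩ (Metric.ball (u (N ω)) (r k) ∩ Metric.ball (u n) (r (k + 1)))).Nonempty} := by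
      intro n
      have h3 : {ω | (K ω ∩ (Metric.ball (u (N ω)) (r k) ∩
          Metric.ball (u n) (r (k + 1)))).Nonempty} = ⋃ j, ({ω | N ω = j} ∩
          {ω | (K ω ∩ (Metric.ball (u j) (r k) ∩ Metric.ball (u n) (r (k + 1)))).Nonempty}) := by
        ext ω
        simp
      rw [h3]
      exact MeasurableSet.iUnion fun j => (hN (measurableSet_singleton j)).inter
        (hm _ (Metric.isOpen_ball.inter Metric.isOpen_ball))
    refine ⟨⟨fun ω => Nat.find (h1 ω), measurable_find h1 h2, fun ω => ?_⟩, fun ω =>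
      Nat.find_spec (h1 ω)⟩
    obtain ⟨x, hx, -, hx'⟩ := Nat.find_spec (h1 ω)
    exact ⟨x, hx, hx'⟩
  choose next hnext using step
  let N : ∀ k, T k := fun k => Nat.rec base.some next k
  have hN : ∀ k, N (k + 1) = next k (N k) := fun k => rfl
  have hdist : ∀ ω k, dist (u ((N k).1 ω)) (u ((N (k + 1)).1 ω)) ≤ 2 * (1 / 2) ^ k := by
    intro ω k
    obtain ⟨x, -, h1, h2⟩ := hnext k (N k) ω
    rw [← hN] at h2
    rw [Metric.mem_ball] at h1 h2
    have h3 := dist_triangle_left (u ((N k).1 ω)) (u ((N (k + 1)).1 ω)) x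
    have h4 : r (k + 1) = r k / 2 := by simp only [r, pow_succ]; ring
    have h5 : r k = (1 / 2) ^ k := rfl
    have h6 := hr k
    linarith
  have hlim : ∀ ω, ∃ x, Tendsto (fun k => u ((N k).1 ω)) atTop (nhds x) := fun ω =>
    cauchySeq_tendsto_of_complete
      (cauchySeq_of_le_geometric (1 / 2) 2 (by norm_num) (hdist ω))
  choose f hf using hlim
  refine ⟨f, measurable_of_tendsto_metrizable (fun k => (measurable_from_nat (f := u)).comp
    (N k).2.1) (tendsto_pi_nhds.2 hf), fun ω => ?_⟩
  choose y hyK hy using fun k => (N k).2.2 ω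
  refine (hcl ω).mem_of_tendsto (f := y) (b := atTop) ?_ (Eventually.of_forall hyK)
  rw [tendsto_iff_dist_tendsto_zero]
  have h1 := (tendsto_iff_dist_tendsto_zero.1 (hf ω))
  have h2 : Tendsto r atTop (nhds 0) :=
    tendsto_pow_atTop_nhds_zero_of_lt_one (by norm_num) (by norm_num)
  refine squeeze_zero (fun _ => dist_nonneg) (fun k => ?_) (by simpa using h2.add h1)
  exact (dist_triangle _ _ _).trans (add_le_add_left (Metric.mem_ball.1 (hy k)).le _)

variable {Ω : Type*} {mΩ : MeasurableSpace Ω} {P : Measure Ω} [IsProbabilityMeasure P]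
  {ι : Type*} [LinearOrder ι] {ℱ : Filtration ι mΩ} {d : ℕ} {p : ℝ≥0∞} {t : ι}
  {R0 : Ω → Set (Fin d → ℝ)}

theorem IsRandomClosedSet.exists_selection_ball (hRS : IsRandomClosedSet ℱ t R0)
    (c : Fin d → ℝ) (r : ℝ) : ∃ f : Ω → Fin d → ℝ, Measurable[ℱ t] f ∧
      ∀ ω, (R0 ω ∩ Metric.ball c r).Nonempty → f ω ∈ R0 ω ∩ Metric.closedBall c r := by
  classical
  -- Taking the closure does not change which open sets are hit, so measurability is preserved. Off
  -- the event the value is irrelevant, and `Set.univ` only keeps K nonempty.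
  let K : Ω → Set (Fin d → ℝ) := fun ω =>
    if (R0 ω ∩ Metric.ball c r).Nonempty then closure (R0 ω ∩ Metric.ball c r) else Set.univ
  have hA := hRS.measurable _ (Metric.isOpen_ball (x := c) (ε := r))
  obtain ⟨f, hf, hfK⟩ := @exists_measurable_selection Ω (Fin d → ℝ) (ℱ t) _ _ _ _ _ _ K
    (fun ω => by
      simp only [K]
      split_ifs
      · exact isClosed_closure
      · exact isClosed_univ)
    (fun G hG => by
      have h1 : {ω | (K ω ∩ G).Nonempty} = {ω | (R0 ω ∩ (Metric.ball c r ∩ G)).Nonempty} ∪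
          ({ω | (R0 ω ∩ Metric.ball c r).Nonempty}ᶜ ∩ {_ω | G.Nonempty}) := by
        ext ω
        simp only [K, Set.mem_union, Set.mem_inter_iff, Set.mem_compl_iff, Set.mem_ofPred_eq]
        split_ifs with h
        · rw [← Set.inter_assoc]
          simp only [h, not_true_eq_false, false_and, or_false]
          exact closure_inter_open_nonempty_iff hG
        · simp only [h, not_false_eq_true, true_and, Set.univ_inter]
          refine ⟨Or.inr, ?_⟩
          rintro (⟨x, hx, hx', -⟩ | h')
          · exact absurd ⟨x, hx, hx'⟩ h
          · exact h'
      rw [h1]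
      exact (hRS.measurable _ (Metric.isOpen_ball.inter hG)).union
        (hA.compl.inter (MeasurableSet.const _)))
    (fun ω => by
      simp only [K]
      split_ifs with h
      · exact h.closure
      · exact Set.univ_nonempty)
  refine ⟨f, hf, fun ω hω => ?_⟩
  have h1 := hfK ω
  simp only [K, if_pos hω] at h1
  exact ⟨(hRS.closed ω).closure_subset_iff.2 Set.inter_subset_left h1,
    Metric.closure_ball_subset_closedBall (closure_mono Set.inter_subset_right h1)⟩

/-- A random vector that is nonnegative on all selections in `L^p_t(R0)` of a random closed set
takes its values in the dual cone of the random set. -/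
theorem IsRandomClosedSet.ae_mem_dualCone (hRS : IsRandomClosedSet ℱ t R0)
    (hne : (Lt P ℱ p t R0).Nonempty) {w : Ω → Fin d → ℝ}
    (hw : ∀ u ∈ Lt P ℱ p t R0, ∀ᵐ ω ∂P, 0 ≤ w ω ⬝ᵥ u ω) :
    ∀ᵐ ω ∂P, w ω ∈ dualCone (R0 ω) := by
  classical
  obtain ⟨u0, hu0m, hu0p, hu0⟩ := hne
  let c := TopologicalSpace.denseSeq (Fin d → ℝ)
  choose f hfm hf using fun (n k : ℕ) => hRS.exists_selection_ball (c n) (1 / ((k : ℝ) + 1))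
  -- The selection is bounded on the event that R0 meets the ball, and u0 fills the complement, so
  -- the glued vector is in L^p_t(R0). Countably many such selections approximate every point of R0
  -- ω.
  have key : ∀ n k : ℕ, ∀ᵐ ω ∂P, (R0 ω ∩ Metric.ball (c n) (1 / ((k : ℝ) + 1))).Nonempty →
      0 ≤ w ω ⬝ᵥ f n k ω := by
    intro n k
    set A := {ω | (R0 ω ∩ Metric.ball (c n) (1 / ((k : ℝ) + 1))).Nonempty} with hAdef
    have hA : MeasurableSet[ℱ t] A := hRS.measurable _ Metric.isOpen_ball
    have hA' : MeasurableSet A := ℱ.le t _ hA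
    have hfm' : StronglyMeasurable[ℱ t] (f n k) := (hfm n k).stronglyMeasurable
    have hb : MemLp (A.indicator (f n k)) p P := by
      refine (memLp_top_of_bound ((hfm'.mono (ℱ.le t)).aestronglyMeasurable.indicator hA')
        (‖c n‖ + 1 / ((k : ℝ) + 1)) (ae_of_all _ fun ω => ?_)).mono_exponent le_top
      by_cases hω : ω ∈ A
      · rw [Set.indicator_of_mem hω]
        have h1 := (hf n k ω hω).2
        rw [mem_closedBall_iff_norm] at h1
        calc ‖f n k ω‖ = ‖c n + (f n k ω - c n)‖ := by rw [add_sub_cancel]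
          _ ≤ _ := (norm_add_le _ _).trans (by gcongr)
      · rw [Set.indicator_of_notMem hω, norm_zero]; positivity
    have hu : MemLp (A.indicator (f n k) + Aᶜ.indicator u0) p P :=
      hb.add (hu0p.indicator hA'.compl)
    have hLt : (hu.toLp : Lp (Fin d → ℝ) p P) ∈ Lt P ℱ p t R0 := by
      refine ⟨?_, Lp.memLp _, ?_⟩
      · have h1 : AEStronglyMeasurable[ℱ t] (A.indicator (f n k)) P :=
          (hfm'.indicator hA).aestronglyMeasurable
        have h2 : AEStronglyMeasurable[ℱ t] (Aᶜ.indicator u0) P := 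
          aestronglyMeasurable_indicator_of_measurableSet hu0m hA.compl
        exact (h1.add h2).congr hu.coeFn_toLp.symm
      · filter_upwards [hu.coeFn_toLp, hu0] with ω h1 h2
        rw [h1]
        by_cases hω : ω ∈ A
        · simpa [hω] using (hf n k ω hω).1
        · simpa [hω] using h2
    filter_upwards [hw _ hLt, hu.coeFn_toLp] with ω h1 h2 hω
    rw [h2] at h1
    have hω' : ω ∈ A := hω
    simpa [hω'] using h1
  filter_upwards [ae_all_iff.2 fun n => ae_all_iff.2 fun k => key n k] with ω hω x hx
  have h1 : ∀ k : ℕ, ∃ n, x ∈ Metric.ball (c n) (1 / ((k : ℝ) + 1)) := fun k => by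
    obtain ⟨n, hn⟩ := (TopologicalSpace.denseRange_denseSeq (Fin d → ℝ)).exists_dist_lt x
      (show (0 : ℝ) < 1 / ((k : ℝ) + 1) by positivity)
    exact ⟨n, hn⟩
  choose n hn using h1
  have hlim : Tendsto (fun k => f (n k) k ω) atTop (nhds x) := by
    rw [tendsto_iff_dist_tendsto_zero]
    have h2 := tendsto_one_div_add_atTop_nhds_zero_nat (𝕜 := ℝ)
    refine squeeze_zero (fun _ => dist_nonneg) (fun k => ?_) (by simpa only [add_zero] using h2.add h2)
    refine (dist_triangle _ (c (n k)) _).trans (add_le_add ?_ ?_)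
    · exact Metric.mem_closedBall.1 (hf (n k) k ω ⟨x, hx, hn k⟩).2
    · rw [dist_comm]; exact (Metric.mem_ball.1 (hn k)).le
  have hcont : Continuous fun y : Fin d → ℝ => w ω ⬝ᵥ y := by fun_prop
  exact ge_of_tendsto ((hcont.tendsto x).comp hlim)
    (Eventually.of_forall fun k => hω _ _ ⟨x, hx, hn k⟩)

end Selection

/-! ### Admissible directions lie in the dual cone of R̃(0) -/

section DualCone

variable {Ω : Type*} {mΩ : MeasurableSpace Ω} {P : Measure Ω} [IsProbabilityMeasure P]
  {ι : Type*} [LinearOrder ι] {ℱ : Filtration ι mΩ} {d m : ℕ} {p : ℝ≥0∞} [Fact (1 ≤ p)] {t : ι}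
  {R : Lp (Fin d → ℝ) p P → Set (Lp (Fin d → ℝ) p P)} {R0 : Ω → Set (Fin d → ℝ)}

/-- If M_t ⊆ R(0), then R̃(0) = M almost surely, which is excluded. Testing selections with ± the
coordinate vectors gives R̃(0) ⊆ M, and constant portfolios from a countable dense subset of M give
the reverse inclusion. -/
theorem exists_mem_Mt_notMem_zero (hR : IsConditionalRiskMeasure P ℱ p m t R R0) :
    ∃ x ∈ Mt P ℱ p m t, x ∉ R 0 := by
  by_contra! hsub
  have hne : (Lt P ℱ p t R0).Nonempty := hR.zero_eq ▸ hR.nonempty_zero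
  have h1 : ∀ i : Fin d, m ≤ (i : ℕ) → ∀ᵐ ω ∂P, ∀ x ∈ R0 ω, x i = 0 := by
    intro i hi
    have hu : ∀ u ∈ Lt P ℱ p t R0, ∀ᵐ ω ∂P, u ω i = 0 := fun u hu => by
      filter_upwards [(mem_Mt.1 (hR.subset_eligible 0 (hR.zero_eq ▸ hu))).2] with ω hω
      exact hω i hi
    have h2 := hR.randomSet.ae_mem_dualCone (p := p) hne (w := fun _ => Pi.single i 1) fun u hu' => by
      filter_upwards [hu u hu'] with ω hω
      simp [hω]
    have h3 := hR.randomSet.ae_mem_dualCone (p := p) hne (w := fun _ => Pi.single i (-1))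
      fun u hu' => by
        filter_upwards [hu u hu'] with ω hω
        simp [hω]
    filter_upwards [h2, h3] with ω h2 h3 x hx
    have h4 := h2 x hx
    have h5 := h3 x hx
    simp only [single_dotProduct] at h4 h5
    linarith
  let π : (Fin d → ℝ) → Fin d → ℝ := fun x i => if (i : ℕ) < m then x i else 0
  have hπ : Continuous π := continuous_pi fun i => by
    by_cases hi : (i : ℕ) < m <;> simp only [π, hi, if_true, if_false] <;> fun_prop
  have hπM : ∀ x, π x ∈ eligible d m := fun x i hi => if_neg (not_lt.2 hi)
  have hπid : ∀ x ∈ eligible d m, π x = x := fun x hx => by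
    ext i
    by_cases hi : (i : ℕ) < m
    · exact if_pos hi
    · rw [hx i (not_lt.1 hi)]; exact if_neg hi
  let c := TopologicalSpace.denseSeq (Fin d → ℝ)
  have h2 : ∀ n, ∀ᵐ ω ∂P, π (c n) ∈ R0 ω := by
    intro n
    have hc : MemLp (fun _ : Ω => π (c n)) p P := memLp_const _
    have h3 : (hc.toLp : Lp (Fin d → ℝ) p P) ∈ Mt P ℱ p m t := by
      refine mem_Mt.2 ⟨(aestronglyMeasurable_const).congr hc.coeFn_toLp.symm, ?_⟩
      filter_upwards [hc.coeFn_toLp] with ω hω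
      rw [hω]; exact hπM _
    have h4 := hsub _ h3
    rw [hR.zero_eq] at h4
    filter_upwards [h4.2.2, hc.coeFn_toLp] with ω h5 h6
    rwa [h6] at h5
  have h1' : ∀ᵐ ω ∂P, ∀ i : Fin d, m ≤ (i : ℕ) → ∀ x ∈ R0 ω, x i = 0 := by
    refine ae_all_iff.2 fun i => ?_
    by_cases hi : m ≤ (i : ℕ)
    · filter_upwards [h1 i hi] with ω hω _ using hω
    · exact ae_of_all _ fun ω h => absurd h hi
  obtain ⟨ω, ⟨hω1, hω2⟩, hω3⟩ := ((h1'.and (ae_all_iff.2 h2)).and hR.ne_eligible).exists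
  refine hω3 (Set.Subset.antisymm (fun x hx i hi => hω1 i hi x hx) fun x hx => ?_)
  have h3 : x ∈ closure (Set.range fun n => π (c n)) := by
    have h4 := (TopologicalSpace.denseRange_denseSeq (Fin d → ℝ)) x
    have h5 := image_closure_subset_closure_image hπ (Set.mem_image_of_mem π h4)
    rw [hπid x hx, ← Set.range_comp] at h5
    exact h5
  refine (hR.randomSet.closed ω).closure_subset_iff.2 ?_ h3
  rintro _ ⟨n, rfl⟩
  exact hω2 n

theorem aestronglyMeasurable_dotProduct {m' : MeasurableSpace Ω} {f g : Ω → Fin d → ℝ}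
    (hf : AEStronglyMeasurable[m'] f P) (hg : AEStronglyMeasurable[m'] g P) :
    AEStronglyMeasurable[m'] (fun ω => f ω ⬝ᵥ g ω) P := by
  have hc : Continuous fun x : (Fin d → ℝ) × (Fin d → ℝ) => x.1 ⬝ᵥ x.2 := by fun_prop
  exact hc.comp_aestronglyMeasurable (hf.prodMk hg)

/-- The class of `1_B X + 1_{Bᶜ} Y`. -/
theorem exists_glue (B : Set Ω) (hB : MeasurableSet B) (X Y : Lp (Fin d → ℝ) p P) :
    ∃ Z : Lp (Fin d → ℝ) p P, Z =ᵐ[P] fun ω => B.indicator X ω + Bᶜ.indicator Y ω := by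
  have h : MemLp (B.indicator X + Bᶜ.indicator Y) p P :=
    ((Lp.memLp X).indicator hB).add ((Lp.memLp Y).indicator hB.compl)
  exact ⟨h.toLp, h.coeFn_toLp⟩

variable {q : ℝ≥0∞} [ENNReal.HolderConjugate p q]

/-- Under convex upper continuity every admissible direction lies in the dual cone of the random
set `R̃_t(0)`. -/
theorem memLt_dualCone (hR : IsConditionalRiskMeasure P ℱ p m t R R0) (hnorm : Normalized R)
    (hconv : ConditionallyConvex ℱ t R) (hcuc : ConvexUpperContinuous ℱ m t R)
    {w : Ω → Fin d → ℝ}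
    (hw : MemLt P ℱ q t (fun _ => dualCone (eligiblePos d m) \ orth (eligible d m)) w) :
    MemLt P ℱ q t (fun ω => dualCone (R0 ω) \ orth (eligible d m)) w := by
  obtain ⟨hwm, hwq, hwv⟩ := hw
  refine ⟨hwm, hwq, ?_⟩
  have hpos := nonneg_on_zero_of_convexUpperContinuous hR hnorm hconv hcuc
    (exists_mem_Mt_notMem_zero hR) (pairing p hwq) (continuous_pairing hwq) fun e he => by
      rw [pairing_apply]
      refine integral_nonneg_of_ae ?_
      have he' : ∀ᵐ ω ∂P, e ω ∈ eligiblePos d m := he.2.2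
      filter_upwards [hwv, he'] with ω h1 h2 using h1.1 _ h2
  have hu : ∀ u ∈ Lt P ℱ p t R0, ∀ᵐ ω ∂P, 0 ≤ w ω ⬝ᵥ u ω := by
    intro u hu
    rw [← hR.zero_eq] at hu
    have hum := (mem_Mt.1 (hR.subset_eligible 0 hu)).1
    have hm := aestronglyMeasurable_dotProduct hwm hum
    set φ := hm.mk _ with hφ
    -- The inequality is known only in expectation. Decomposability lets it be applied to 1_B u,
    -- where B is the event wᵀu < 0.
    let B := {ω | φ ω < 0}
    have hB : MeasurableSet[ℱ t] B :=
      hm.stronglyMeasurable_mk.measurable measurableSet_Iio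
    obtain ⟨Z, hZ⟩ := exists_glue B (ℱ.le t _ hB) u 0
    have hZR := hR.decomposable_zero B hB u hu 0 (zero_mem_zero hR hnorm hconv) Z hZ
    have h1 := hpos Z hZR
    rw [pairing_apply] at h1
    have h2 : (fun ω => w ω ⬝ᵥ Z ω) =ᵐ[P] B.indicator φ := by
      filter_upwards [hZ, hm.ae_eq_mk] with ω h3 h4
      rw [h3]
      by_cases hω : ω ∈ B
      · simp [hω, h4, hφ]
      · simp [hω]
    have h3 : B.indicator φ ≤ 0 := fun ω => by
      by_cases hω : ω ∈ B
      · rw [Set.indicator_of_mem hω]; exact le_of_lt hω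
      · rw [Set.indicator_of_notMem hω]; rfl
    have hI : Integrable (B.indicator φ) P := (integrable_dotProduct hwq (Lp.memLp Z)).congr h2
    rw [integral_congr_ae h2] at h1
    have h4 : -B.indicator φ =ᵐ[P] 0 := by
      refine (integral_eq_zero_iff_of_nonneg (fun ω => neg_nonneg.2 (h3 ω)) hI.neg).1 ?_
      refine le_antisymm ?_ (integral_nonneg fun ω => neg_nonneg.2 (h3 ω))
      simp only [integral_neg]
      linarith
    filter_upwards [h4, hm.ae_eq_mk] with ω h5 h6
    rw [h6]
    by_contra! hlt
    have hω : ω ∈ B := hlt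
    simp only [Pi.neg_apply, Set.indicator_of_mem hω, Pi.zero_apply] at h5
    have hlt' : φ ω < 0 := hlt
    linarith
  have hd := hR.randomSet.ae_mem_dualCone (hR.zero_eq ▸ hR.nonempty_zero) hu
  filter_upwards [hd, hwv] with ω h1 h2 using ⟨h1, h2.2⟩

end DualCone

/-! ### Essential suprema of directed families -/

section Directed

variable {Ω : Type*} {mΩ : MeasurableSpace Ω} {P : Measure Ω} [IsProbabilityMeasure P]

/-- An upward directed family with bounded expectations has an integrable essential upper bound
with the same bound on its expectation. -/
theorem exists_integrable_upper_bound {F : Set (Ω → ℝ)} (hne : F.Nonempty)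
    (hint : ∀ f ∈ F, Integrable f P)
    (hdir : ∀ f ∈ F, ∀ g ∈ F, ∃ h ∈ F, f ≤ᵐ[P] h ∧ g ≤ᵐ[P] h) {a : ℝ}
    (ha : ∀ f ∈ F, ∫ ω, f ω ∂P ≤ a) :
    ∃ h : Ω → ℝ, Integrable h P ∧ ∫ ω, h ω ∂P ≤ a ∧ ∀ f ∈ F, f ≤ᵐ[P] h := by
  let S : Set ℝ := (fun f : Ω → ℝ => ∫ ω, f ω ∂P) '' F
  have hSne : S.Nonempty := hne.image _
  have hSb : BddAbove S := ⟨a, by rintro _ ⟨f, hf, rfl⟩; exact ha f hf⟩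
  have hseq : ∀ n : ℕ, ∃ f : F, sSup S - 1 / ((n : ℝ) + 1) < ∫ ω, f.1 ω ∂P := fun n => by
    obtain ⟨_, ⟨f, hf, rfl⟩, h⟩ := exists_lt_of_lt_csSup hSne
      (show sSup S - 1 / ((n : ℝ) + 1) < sSup S by
        have : (0 : ℝ) < 1 / ((n : ℝ) + 1) := by positivity
        linarith)
    exact ⟨⟨f, hf⟩, h⟩
  choose f hf using hseq
  have hdir' : ∀ f g : F, ∃ h : F, f.1 ≤ᵐ[P] h.1 ∧ g.1 ≤ᵐ[P] h.1 := fun f g => by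
    obtain ⟨h, hh, h1⟩ := hdir f.1 f.2 g.1 g.2
    exact ⟨⟨h, hh⟩, h1⟩
  choose D hD1 hD2 using hdir'
  -- Directedness turns the maximizing sequence f into an increasing one, so monotone convergence
  -- yields an integrable limit h.
  let g : ℕ → F := fun n => Nat.rec (f 0) (fun n G => D G (f (n + 1))) n
  have hgs : ∀ n, g (n + 1) = D (g n) (f (n + 1)) := fun n => rfl
  have hgI : ∀ n, Integrable (g n).1 P := fun n => hint _ (g n).2
  have hgmono : ∀ n, (g n).1 ≤ᵐ[P] (g (n + 1)).1 := fun n => hD1 _ _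
  have hfg : ∀ n, (f n).1 ≤ᵐ[P] (g n).1 := fun n => by
    cases n with
    | zero => exact EventuallyLE.refl _ _
    | succ n => exact hD2 _ _
  have hgS : ∀ n : ℕ, sSup S - 1 / ((n : ℝ) + 1) < ∫ ω, (g n).1 ω ∂P := fun n =>
    (hf n).trans_le (integral_mono_ae (hint _ (f n).2) (hgI n) (hfg n))
  have hmono : ∀ᵐ ω ∂P, Monotone fun n => (g n).1 ω := by
    filter_upwards [ae_all_iff.2 hgmono] with ω hω using monotone_nat_of_le_succ hω
  let H : Ω → ℝ≥0∞ := fun ω => ⨆ n, ENNReal.ofReal ((g n).1 ω - (g 0).1 ω)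
  have hgm : ∀ n, AEMeasurable (fun ω => ENNReal.ofReal ((g n).1 ω - (g 0).1 ω)) P := fun n =>
    ((hgI n).1.aemeasurable.sub (hgI 0).1.aemeasurable).ennreal_ofReal
  have hHm : AEMeasurable H P := AEMeasurable.iSup hgm
  have hHle : ∫⁻ ω, H ω ∂P ≤ ENNReal.ofReal (a - ∫ ω, (g 0).1 ω ∂P) := by
    simp only [H]
    rw [lintegral_iSup' hgm (by
        filter_upwards [hmono] with ω hω i j hij
        exact ENNReal.ofReal_le_ofReal (sub_le_sub_right (hω hij) _))]
    refine iSup_le fun n => ?_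
    have hI : Integrable (fun ω => (g n).1 ω - (g 0).1 ω) P := (hgI n).sub (hgI 0)
    rw [← ofReal_integral_eq_lintegral_ofReal hI (by
      filter_upwards [hmono] with ω hω
      exact sub_nonneg.2 (hω (Nat.zero_le n)))]
    refine ENNReal.ofReal_le_ofReal ?_
    rw [integral_sub (hgI n) (hgI 0)]
    exact sub_le_sub_right (ha _ (g n).2) _
  have hHt : ∫⁻ ω, H ω ∂P ≠ ∞ := ne_top_of_le_ne_top ENNReal.ofReal_ne_top hHle
  have hHI : Integrable (fun ω => (H ω).toReal) P := integrable_toReal_of_lintegral_ne_top hHm hHt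
  let h : Ω → ℝ := fun ω => (g 0).1 ω + (H ω).toReal
  have hhI : Integrable h P := (hgI 0).add hHI
  have hgh : ∀ n, (g n).1 ≤ᵐ[P] h := fun n => by
    filter_upwards [ae_lt_top' hHm hHt] with ω hω
    have h1 : ENNReal.ofReal ((g n).1 ω - (g 0).1 ω) ≤ H ω :=
      le_iSup (fun n => ENNReal.ofReal ((g n).1 ω - (g 0).1 ω)) n
    have h2 := (ENNReal.ofReal_le_iff_le_toReal hω.ne).1 h1
    simp only [h]
    linarith
  refine ⟨h, hhI, ?_, fun k hk => ?_⟩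
  · simp only [h]
    rw [integral_add (hgI 0) hHI, integral_toReal hHm (ae_lt_top' hHm hHt)]
    have h1 : (∫⁻ ω, H ω ∂P).toReal ≤ a - ∫ ω, (g 0).1 ω ∂P :=
      ENNReal.toReal_le_of_le_ofReal (sub_nonneg.2 (ha _ (g 0).2)) hHle
    linarith
  · have hkI := hint k hk
    have hpI : Integrable (fun ω => max (k ω - h ω) 0) P := (hkI.sub hhI).pos_part
    -- A common upper bound D ∈ F of k and g_n satisfies (k - h)⁺ ≤ D - g_n, and E[D] ≤ sup S <
    -- E[g_n] + 1/(n+1).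
    have hle : ∀ n : ℕ, ∫ ω, max (k ω - h ω) 0 ∂P ≤ 1 / ((n : ℝ) + 1) := fun n => by
      have h1 := hD1 ⟨k, hk⟩ (g n)
      have h2 := hD2 ⟨k, hk⟩ (g n)
      have hI := hint _ (D ⟨k, hk⟩ (g n)).2
      calc ∫ ω, max (k ω - h ω) 0 ∂P
          ≤ ∫ ω, ((D ⟨k, hk⟩ (g n)).1 ω - (g n).1 ω) ∂P := by
            refine integral_mono_ae hpI (hI.sub (hgI n)) ?_
            filter_upwards [h1, h2, hgh n] with ω h3 h4 h5
            exact max_le (sub_le_sub h3 h5) (sub_nonneg.2 h4)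
        _ = ∫ ω, (D ⟨k, hk⟩ (g n)).1 ω ∂P - ∫ ω, (g n).1 ω ∂P := integral_sub hI (hgI n)
        _ ≤ 1 / ((n : ℝ) + 1) := by
            have h3 : ∫ ω, (D ⟨k, hk⟩ (g n)).1 ω ∂P ≤ sSup S :=
              le_csSup hSb ⟨_, (D ⟨k, hk⟩ (g n)).2, rfl⟩
            linarith [hgS n]
    have h0 : ∫ ω, max (k ω - h ω) 0 ∂P ≤ 0 :=
      ge_of_tendsto' tendsto_one_div_add_atTop_nhds_zero_nat hle
    have h1 : (fun ω => max (k ω - h ω) 0) =ᵐ[P] 0 := by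
      refine (integral_eq_zero_iff_of_nonneg (fun ω => le_max_right _ _) hpI).1 ?_
      exact le_antisymm h0 (integral_nonneg fun ω => le_max_right _ _)
    filter_upwards [h1] with ω hω
    have h2 : k ω - h ω ≤ 0 := (le_max_left _ _).trans_eq hω
    linarith

end Directed

/-! ### Conditional expectations and the density ratios ξ̄ -/

section ConditionalExpectation

variable {Ω : Type*} {mΩ : MeasurableSpace Ω} {P : Measure Ω} [IsProbabilityMeasure P]

theorem ae_eq_zero_of_condExp_eq_zero {m' : MeasurableSpace Ω} (hm' : m' ≤ mΩ) {f : Ω → ℝ}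
    (hf : Integrable f P) (hf0 : 0 ≤ᵐ[P] f) : ∀ᵐ ω ∂P, (P[f | m']) ω = 0 → f ω = 0 := by
  let B := {ω | (P[f | m']) ω = 0}
  have hB : MeasurableSet[m'] B :=
    (stronglyMeasurable_condExp (μ := P) (m := m') (f := f)).measurable (measurableSet_singleton 0)
  have h1 : ∫ ω in B, f ω ∂P = 0 := by
    rw [← setIntegral_condExp hm' hf hB]
    exact setIntegral_eq_zero_of_forall_eq_zero fun ω hω => hω
  rw [setIntegral_eq_zero_iff_of_nonneg_ae (ae_restrict_of_ae hf0) hf.integrableOn] at h1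
  have h2 := (ae_restrict_iff' (hm' _ hB)).1 h1
  filter_upwards [h2] with ω hω h using hω h

/-- The measures with densities f and E[f|m'] agree on m'. Working in [0, ∞] avoids integrability of
fZ, which is not available when a total mass is computed from it. -/
theorem lintegral_mul_condExp {m' : MeasurableSpace Ω} (hm' : m' ≤ mΩ) {f : Ω → ℝ}
    (hf : Integrable f P) (hf0 : 0 ≤ᵐ[P] f) {Z : Ω → ℝ≥0∞} (hZ : Measurable[m'] Z) :
    ∫⁻ ω, ENNReal.ofReal (f ω) * Z ω ∂P = ∫⁻ ω, ENNReal.ofReal ((P[f | m']) ω) * Z ω ∂P := by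
  have hZ' : Measurable[mΩ] Z := hZ.mono hm' le_rfl
  have h1 := lintegral_withDensity_eq_lintegral_mul₀ hf.1.aemeasurable.ennreal_ofReal
    hZ'.aemeasurable
  have h2 := lintegral_withDensity_eq_lintegral_mul₀ (integrable_condExp (μ := P) (m := m')
    (f := f)).1.aemeasurable.ennreal_ofReal hZ'.aemeasurable
  simp only [Pi.mul_apply] at h1 h2
  rw [← h1, ← h2, ← lintegral_trim hm' hZ, ← lintegral_trim hm' hZ]
  congr 1
  refine @Measure.ext _ m' _ _ fun A hA => ?_
  rw [trim_measurableSet_eq hm' hA, trim_measurableSet_eq hm' hA, withDensity_apply _ (hm' _ hA),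
    withDensity_apply _ (hm' _ hA), ← ofReal_integral_eq_lintegral_ofReal hf.integrableOn
      (ae_restrict_of_ae hf0), ← ofReal_integral_eq_lintegral_ofReal
      integrable_condExp.integrableOn (ae_restrict_of_ae (condExp_nonneg hf0)),
    setIntegral_condExp hm' hf hA]

variable {ι : Type*} [LinearOrder ι] {ℱ : Filtration ι mΩ} {t s : ι}

/-- The ratios `ξ̄_{t,s}(Q)` have conditional mean one. -/
theorem condExp_mul_xi (hts : t ≤ s) {Q : Measure Ω} [IsFiniteMeasure Q] {v : Ω → ℝ}
    (hv : AEStronglyMeasurable[ℱ t] v P)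
    (hint : Integrable (fun ω => v ω * xi P ℱ t s Q ω) P) :
    P[fun ω => v ω * xi P ℱ t s Q ω | ℱ t] =ᵐ[P] v := by
  set D : Ω → ℝ := fun ω => (Q.rnDeriv P ω).toReal with hD
  set f : Ω → ℝ := fun ω => v ω * xi P ℱ t s Q ω with hf
  have hDI : Integrable D P := Measure.integrable_toReal_rnDeriv
  let B := {ω | 0 < (P[D | ℱ t]) ω}
  have hDt : StronglyMeasurable[ℱ t] (P[D | ℱ t]) := stronglyMeasurable_condExp
  have hB : MeasurableSet[ℱ t] B := hDt.measurable measurableSet_Ioi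
  have hB' := ℱ.le t _ hB
  -- On B the product v ξ̄ is g E[D | F_s] with g F_t-measurable; off B the default value 1 of ξ̄
  -- leaves v itself.
  let g : Ω → ℝ := B.indicator fun ω => v ω * ((P[D | ℱ t]) ω)⁻¹
  have hg : AEStronglyMeasurable[ℱ t] g P := aestronglyMeasurable_indicator_of_measurableSet
    (hv.mul (hDt.measurable.inv.stronglyMeasurable.aestronglyMeasurable)) hB
  have h1 : g * P[D | ℱ s] = B.indicator f := by
    ext ω
    by_cases hω : ω ∈ B
    · have hω' : 0 < (P[D | ℱ t]) ω := hω
      simp only [g, hf, xi, Pi.mul_apply, Set.indicator_of_mem hω]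
      rw [if_pos hω', div_eq_mul_inv]
      ring
    · simp [g, hω]
  have h2 : Bᶜ.indicator v = Bᶜ.indicator f := by
    ext ω
    by_cases hω : ω ∈ B
    · simp [hω]
    · have hω' : ¬ 0 < (P[D | ℱ t]) ω := hω
      have hω'' : ω ∈ Bᶜ := hω
      simp only [hf, xi, Set.indicator_of_mem hω'']
      rw [if_neg hω', mul_one]
  have hfs : f = g * P[D | ℱ s] + Bᶜ.indicator v := by
    rw [h1, h2, Set.indicator_self_add_compl]
  have hI1 : Integrable (g * P[D | ℱ s]) P := by rw [h1]; exact hint.indicator hB'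
  have hI2 : Integrable (Bᶜ.indicator v) P := by rw [h2]; exact hint.indicator hB'.compl
  have h3 : P[g * P[D | ℱ s] | ℱ t] =ᵐ[P] g * P[P[D | ℱ s] | ℱ t] :=
    condExp_mul_of_aestronglyMeasurable_left hg hI1 integrable_condExp
  have h4 : P[P[D | ℱ s] | ℱ t] =ᵐ[P] P[D | ℱ t] :=
    condExp_condExp_of_le (ℱ.mono hts) (ℱ.le s)
  have h5 : P[Bᶜ.indicator v | ℱ t] =ᵐ[P] Bᶜ.indicator v :=
    condExp_of_aestronglyMeasurable' (ℱ.le t)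
      (aestronglyMeasurable_indicator_of_measurableSet hv hB.compl) hI2
  rw [hfs]
  filter_upwards [condExp_add hI1 hI2 (ℱ t), h3, h4, h5] with ω e1 e2 e3 e4
  rw [e1, Pi.add_apply, e2, e4, Pi.mul_apply, e3]
  by_cases hω : ω ∈ B
  · have hω' : 0 < (P[D | ℱ t]) ω := hω
    simp only [g, Set.indicator_of_mem hω]
    rw [Set.indicator_of_notMem (by simpa using hω), add_zero, mul_assoc,
      inv_mul_cancel₀ hω'.ne', mul_one]
  · have hω'' : ω ∈ Bᶜ := hω
    simp [g, hω]

/-- Every nonnegative integrable `y` is, up to its conditional expectation at time `t`, the density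
of a probability measure `Q`; the ratios `ξ̄` of `Q` recover `y`. -/
theorem exists_measure_xi [OrderTop ι] (hℱ : ℱ ⊤ = mΩ) {y : Ω → ℝ} (hy : Integrable y P)
    (hy0 : 0 ≤ᵐ[P] y) : ∃ Q : Measure Ω, IsProbabilityMeasure Q ∧ Q ≪ P ∧ ∀ s, t ≤ s →
      (fun ω => (P[y | ℱ t]) ω * xi P ℱ t s Q ω) =ᵐ[P] P[y | ℱ s] ∧
      ((fun ω => (P[y | ℱ s]) ω * xi P ℱ s ⊤ Q ω) =ᵐ[P] y) := by
  set E := P[y | ℱ t] with hE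
  have hEm : StronglyMeasurable[ℱ t] E := stronglyMeasurable_condExp
  have hE0 : 0 ≤ᵐ[P] E := condExp_nonneg hy0
  let B := {ω | 0 < E ω}
  have hB : MeasurableSet[ℱ t] B := hEm.measurable measurableSet_Ioi
  have hB' := ℱ.le t _ hB
  let g : Ω → ℝ := B.indicator fun ω => (E ω)⁻¹
  have hg : StronglyMeasurable[ℱ t] g :=
    (hEm.measurable.inv.stronglyMeasurable).indicator hB
  -- The density is y / E[y | F_t] where the denominator is positive and 1 elsewhere, so that E[z |
  -- F_t] = 1. Off B, y and all its later conditional expectations vanish, so the value 1 there does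
  -- no harm.
  let z : Ω → ℝ := fun ω => g ω * y ω + Bᶜ.indicator 1 ω
  have hzm : AEStronglyMeasurable z P := ((hg.mono (ℱ.le t)).aestronglyMeasurable.mul hy.1).add
    (aestronglyMeasurable_one.indicator hB'.compl)
  have hg0 : ∀ ω, 0 ≤ g ω := fun ω =>
    Set.indicator_nonneg (f := fun ω => (E ω)⁻¹) (fun ω (hω : 0 < E ω) => (inv_pos.2 hω).le) ω
  have hz0 : 0 ≤ᵐ[P] z := by
    filter_upwards [hy0] with ω hω
    exact add_nonneg (mul_nonneg (hg0 ω) hω) (Set.indicator_nonneg (fun _ _ => zero_le_one) _)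
  have hz1 : ∫⁻ ω, ENNReal.ofReal (z ω) ∂P = 1 := by
    have h1 : ∫⁻ ω, ENNReal.ofReal (z ω) ∂P =
        ∫⁻ ω, (ENNReal.ofReal (y ω) * ENNReal.ofReal (g ω) + Bᶜ.indicator 1 ω) ∂P := by
      refine lintegral_congr_ae ?_
      filter_upwards [hy0] with ω hω
      simp only [z]
      rw [ENNReal.ofReal_add (mul_nonneg (hg0 ω) hω)
        (Set.indicator_nonneg (f := 1) (fun _ _ => zero_le_one) _), ENNReal.ofReal_mul (hg0 ω), mul_comm]
      congr 1
      by_cases h : ω ∈ Bᶜ <;> simp [h]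
    have h2 : ∀ ω, ENNReal.ofReal (E ω) * ENNReal.ofReal (g ω) = B.indicator 1 ω := fun ω => by
      by_cases h : ω ∈ B
      · have h' : 0 < E ω := h
        simp only [g, Set.indicator_of_mem h]
        rw [← ENNReal.ofReal_mul h'.le, mul_inv_cancel₀ h'.ne']
        simp
      · simp [g, h]
    rw [h1, lintegral_add_right _ (measurable_one.indicator hB'.compl),
      lintegral_mul_condExp (ℱ.le t) hy hy0 hg.measurable.ennreal_ofReal, ← hE]
    simp_rw [h2]
    rw [lintegral_indicator_one hB', lintegral_indicator_one hB'.compl, measure_add_measure_compl hB',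
      measure_univ]
  have hzI : Integrable z P := ⟨hzm, by
    rw [hasFiniteIntegral_iff_ofReal hz0, hz1]; exact ENNReal.one_lt_top⟩
  let Q := P.withDensity fun ω => ENNReal.ofReal (z ω)
  have hQ : IsProbabilityMeasure Q := ⟨by
    rw [withDensity_apply _ MeasurableSet.univ, Measure.restrict_univ, hz1]⟩
  have hD : (fun ω => (Q.rnDeriv P ω).toReal) =ᵐ[P] z := by
    filter_upwards [Measure.rnDeriv_withDensity₀ P hzm.aemeasurable.ennreal_ofReal, hz0]
      with ω h1 h2
    rw [h1, ENNReal.toReal_ofReal h2]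
  have hgyI : Integrable (g * y) P := by
    have h1 : g * y = B.indicator z := by
      ext ω
      by_cases h : ω ∈ B
      · simp [z, h]
      · simp [z, g, h]
    rw [h1]; exact hzI.indicator hB'
  have hCI : Integrable (Bᶜ.indicator (1 : Ω → ℝ)) P :=
    (integrable_indicator_iff hB'.compl).2 (integrable_const (1 : ℝ)).integrableOn
  have hDs : ∀ s, t ≤ s → P[fun ω => (Q.rnDeriv P ω).toReal | ℱ s] =ᵐ[P]
      fun ω => g ω * (P[y | ℱ s]) ω + Bᶜ.indicator 1 ω := by
    intro s hs
    have hg' : StronglyMeasurable[ℱ s] g := hg.mono (ℱ.mono hs)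
    have h1 : P[Bᶜ.indicator (1 : Ω → ℝ) | ℱ s] = Bᶜ.indicator 1 :=
      condExp_of_stronglyMeasurable (ℱ.le s)
        (stronglyMeasurable_one.indicator (ℱ.mono hs _ hB.compl)) hCI
    have h2 : z = g * y + Bᶜ.indicator 1 := rfl
    filter_upwards [condExp_congr_ae (m := ℱ s) hD, condExp_add hgyI hCI (ℱ s),
      condExp_mul_of_stronglyMeasurable_left hg' hgyI hy] with ω e1 e2 e3
    rw [e1, h2, e2, Pi.add_apply, e3, h1]
    rfl
  refine ⟨Q, hQ, withDensity_absolutelyContinuous _ _, fun s hs => ?_⟩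
  have hzero : ∀ᵐ ω ∂P, E ω = 0 → (P[y | ℱ s]) ω = 0 := by
    filter_upwards [ae_eq_zero_of_condExp_eq_zero (ℱ.le t) (integrable_condExp (f := y) (m := ℱ s))
      (condExp_nonneg hy0), condExp_condExp_of_le (μ := P) (f := y) (ℱ.mono hs) (ℱ.le s)]
      with ω h1 h2 h3
    exact h1 (h2.trans h3)
  refine ⟨?_, ?_⟩
  · filter_upwards [hDs t le_rfl, hDs s hs, hzero, hE0] with ω h1 h2 h3 h4
    by_cases hω : ω ∈ B
    · have hω' : 0 < E ω := hω
      have hC : Bᶜ.indicator (1 : Ω → ℝ) ω = 0 := by simp [hω]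
      have hgω : g ω = (E ω)⁻¹ := Set.indicator_of_mem hω _
      rw [hC, hgω, add_zero] at h1 h2
      rw [← hE, inv_mul_cancel₀ hω'.ne'] at h1
      simp only [xi]
      rw [h1, if_pos one_pos, h2, div_one, mul_inv_cancel_left₀ hω'.ne']
    · have h5 : E ω = 0 := le_antisymm (not_lt.1 hω) h4
      rw [h5, h3 h5, zero_mul]
  · have hy' : P[y | ℱ ⊤] =ᵐ[P] y :=
      condExp_of_aestronglyMeasurable' (ℱ.le ⊤) (by rw [hℱ]; exact hy.1) hy
    have hzero' : ∀ᵐ ω ∂P, (P[y | ℱ s]) ω = 0 → y ω = 0 :=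
      ae_eq_zero_of_condExp_eq_zero (ℱ.le s) hy hy0
    filter_upwards [hDs s hs, hDs ⊤ le_top, hzero, hzero', hE0, condExp_nonneg (m := ℱ s) hy0, hy']
      with ω h1 h2 h3 h4 h5 h6 h7
    rcases eq_or_lt_of_le h6 with h8 | h8
    · have h8' : (P[y | ℱ s]) ω = 0 := h8.symm
      rw [h8', h4 h8', zero_mul]
    · have h8' : 0 < (P[y | ℱ s]) ω := h8
      by_cases hω : ω ∈ B
      · have hω' : 0 < E ω := hω
        have hC : Bᶜ.indicator (1 : Ω → ℝ) ω = 0 := by simp [hω]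
        have hgω : g ω = (E ω)⁻¹ := Set.indicator_of_mem hω _
        rw [hC, hgω, add_zero] at h1 h2
        simp only [xi]
        rw [h1, if_pos (by positivity), h2, h7]
        field_simp
      · exact absurd (h3 (le_antisymm (not_lt.1 hω) h5)) h8'.ne'

end ConditionalExpectation

/-! ### Dual variables and composed densities -/

section DualVariables

variable {Ω : Type*} {mΩ : MeasurableSpace Ω} {P : Measure Ω} [IsProbabilityMeasure P]
  {ι : Type*} [LinearOrder ι] [OrderTop ι] {ℱ : Filtration ι mΩ} {d m : ℕ} {p q : ℝ≥0∞}
  {t s : ι} {w : Ω → Fin d → ℝ}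

theorem MemLt.congr {r : ℝ≥0∞} {D : Ω → Set (Fin d → ℝ)} {f g : Ω → Fin d → ℝ}
    (hf : MemLt P ℱ r t D f) (h : f =ᵐ[P] g) : MemLt P ℱ r t D g := by
  refine ⟨hf.1.congr h, hf.2.1.ae_eq h, ?_⟩
  filter_upwards [hf.2.2, h] with ω h1 h2
  rwa [← h2]

/-- Nonnegative random vectors belong to `M_{s,+}^+`. -/
theorem memDualMtPos_of_nonneg {f : Ω → Fin d → ℝ} (hfm : AEStronglyMeasurable[ℱ s] f P)
    (hfq : MemLp f q P) (hf0 : ∀ᵐ ω ∂P, 0 ≤ f ω) : MemDualMtPos P ℱ p q m s f := by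
  refine ⟨⟨hfm, hfq, ae_of_all _ fun _ => Set.mem_univ _⟩, fun u hu => integral_nonneg_of_ae ?_⟩
  filter_upwards [hf0, (mem_MtPos.1 hu).2] with ω h1 h2
  exact Finset.sum_nonneg fun i _ => mul_nonneg (h1 i) (h2 i)

/-- A nonnegative `Y ∈ L^q` whose time-`t` conditional expectation agrees with `w` on the eligible
assets is the composed density of some dual variables. -/
theorem exists_dual_variables (hℱ : ℱ ⊤ = mΩ) (hq : 1 ≤ q) (hts : t ≤ s)
    (hw : MemLt P ℱ q t (fun _ => dualCone (eligiblePos d m) \ orth (eligible d m)) w)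
    {Y : Ω → Fin d → ℝ} (hY : MemLp Y q P) (hY0 : ∀ᵐ ω ∂P, 0 ≤ Y ω)
    (hYw : ∀ i : Fin d, (i : ℕ) < m → P[fun ω => Y ω i | ℱ t] =ᵐ[P] fun ω => w ω i) :
    ∃ a ∈ steppedDual P ℱ p q m t s w,
      ∃ b ∈ terminalDual P ℱ p q m s (wStep P ℱ t s a.1 (w + a.2)),
        splitDensity P ℱ t s w a b =ᵐ[P] Y := by
  have hYI : ∀ i, Integrable (fun ω => Y ω i) P := fun i => (hY.eval i).integrable hq
  have hY0i : ∀ i, 0 ≤ᵐ[P] fun ω => Y ω i := fun i => hY0.mono fun ω h => h i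
  choose Q hQ hQP hxi using fun i => exists_measure_xi (t := t) hℱ (hYI i) (hY0i i)
  let E : ι → Ω → Fin d → ℝ := fun r ω i => (P[fun ω => Y ω i | ℱ r]) ω
  have hEm : ∀ r, AEStronglyMeasurable[ℱ r] (E r) P := fun r =>
    aestronglyMeasurable_of_forall fun i => stronglyMeasurable_condExp.aestronglyMeasurable
  have hEq : ∀ r, MemLp (E r) q P := fun r => MemLp.of_eval fun i => (hY.eval i).condExp hq
  have hE0 : ∀ r, ∀ᵐ ω ∂P, 0 ≤ E r ω := fun r => by
    filter_upwards [ae_all_iff.2 fun i => condExp_nonneg (m := ℱ r) (hY0i i)] with ω hω i using hω i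
  have hEw : ∀ᵐ ω ∂P, ∀ i : Fin d, (i : ℕ) < m → E t ω i = w ω i := by
    refine ae_all_iff.2 fun i => ?_
    by_cases hi : (i : ℕ) < m
    · filter_upwards [hYw i hi] with ω hω _ using hω
    · exact ae_of_all _ fun ω h => absurd h hi
  have hsum : w + (E t - w) = E t := by rw [add_sub_cancel]
  have hV : wStep P ℱ t s Q (E t) =ᵐ[P] E s := by
    filter_upwards [ae_all_iff.2 fun i => (hxi i s hts).1] with ω hω
    ext i
    exact hω i
  have hV' : E s =ᵐ[P] wStep P ℱ t s Q (E t) := hV.symm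
  have hlast : wStep P ℱ s ⊤ Q (wStep P ℱ t s Q (E t)) =ᵐ[P] Y := by
    filter_upwards [hV, ae_all_iff.2 fun i => (hxi i s hts).2] with ω h1 h2
    ext i
    rw [wStep, h1]
    exact h2 i
  have hMs : MemDualMtPos P ℱ p q m s (wStep P ℱ t s Q (E t)) :=
    memDualMtPos_of_nonneg ((hEm s).congr hV') ((hEq s).ae_eq hV') (by
      filter_upwards [hV, hE0 s] with ω h1 h2
      rwa [h1])
  have hQv : Q ∈ vectorMeasures P d := fun i => ⟨hQ i, hQP i⟩
  -- The choice m_⊥ = E[Y | F_t] - w makes w + m_⊥ = E[Y | F_t]. The first step then gives E[Y |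
  -- F_s] and the second, with the same Q and n_⊥ = 0, gives Y.
  refine ⟨(Q, E t - w), ⟨hQv, ⟨(hEm t).sub hw.1, (hEq t).sub hw.2.1, ?_⟩, ?_, ?_⟩, (Q, 0),
    ⟨hQv, ⟨aestronglyMeasurable_zero, MemLp.zero, ?_⟩, ?_, ?_⟩, ?_⟩
  · filter_upwards [hEw] with ω hω
    refine mem_orth_eligible.2 fun i hi => ?_
    simp [hω i hi]
  · simp only [hsum]
    refine ⟨hEm t, hEq t, ?_⟩
    filter_upwards [hEw, hE0 t, hw.2.2] with ω h1 h2 h3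
    refine ⟨mem_dualCone_eligiblePos.2 fun i _ => h2 i, fun h4 => h3.2 ?_⟩
    rw [mem_orth_eligible] at h4 ⊢
    exact fun i hi => (h1 i hi).symm.trans (h4 i hi)
  · simpa only [hsum] using hMs
  · exact ae_of_all _ fun ω => mem_orth_eligible.2 fun i _ => rfl
  · simpa only [hsum, add_zero] using hMs
  · simp only [hsum, add_zero]
    refine MemLt.congr (f := Y) ⟨?_, hY, hY0⟩ hlast.symm
    rw [hℱ]
    exact hY.1
  · simpa only [splitDensity, hsum, add_zero] using hlast

variable {a b : (Fin d → Measure Ω) × (Ω → Fin d → ℝ)}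

theorem memLp_splitDensity (hb : b ∈ terminalDual P ℱ p q m s (wStep P ℱ t s a.1 (w + a.2))) :
    MemLp (splitDensity P ℱ t s w a b) q P := hb.2.2.2.2.1

/-- Tower property through F_s: each ratio ξ̄ has conditional mean one, and n_⊥ and m_⊥ vanish on
coordinates below m. -/
theorem condExp_splitDensity (hq : 1 ≤ q) (hts : t ≤ s)
    (hw : AEStronglyMeasurable[ℱ t] w P) (ha : a ∈ steppedDual P ℱ p q m t s w)
    (hb : b ∈ terminalDual P ℱ p q m s (wStep P ℱ t s a.1 (w + a.2))) (i : Fin d)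
    (hi : (i : ℕ) < m) :
    P[fun ω => splitDensity P ℱ t s w a b ω i | ℱ t] =ᵐ[P] fun ω => w ω i := by
  have : IsProbabilityMeasure (a.1 i) := (ha.1 i).1
  have : IsProbabilityMeasure (b.1 i) := (hb.1 i).1
  have hcoord : ∀ {r : ι} {f : Ω → Fin d → ℝ}, AEStronglyMeasurable[ℱ r] f P →
      AEStronglyMeasurable[ℱ r] (fun ω => f ω i) P := fun hf =>
    (continuous_apply i).comp_aestronglyMeasurable hf
  have h1 := condExp_mul_xi (P := P) (ℱ := ℱ) (t := s) (s := ⊤) le_top (Q := b.1 i)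
    (hcoord hb.2.2.1.1.1) (((memLp_splitDensity hb).eval i).integrable hq)
  have h2 := condExp_mul_xi (P := P) (ℱ := ℱ) hts (Q := a.1 i)
    (hcoord (hw.add ha.2.1.1)) ((ha.2.2.2.1.2.1.eval i).integrable hq)
  have h3 : (fun ω => (wStep P ℱ t s a.1 (w + a.2) + b.2) ω i) =ᵐ[P]
      fun ω => wStep P ℱ t s a.1 (w + a.2) ω i := by
    filter_upwards [hb.2.1.2.2] with ω hω
    simp [mem_orth_eligible.1 hω i hi]
  have h4 : (fun ω => (w + a.2) ω i) =ᵐ[P] fun ω => w ω i := by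
    filter_upwards [ha.2.1.2.2] with ω hω
    simp [mem_orth_eligible.1 hω i hi]
  have h5 := condExp_condExp_of_le (μ := P) (f := fun ω => splitDensity P ℱ t s w a b ω i)
    (ℱ.mono hts) (ℱ.le s)
  exact h5.symm.trans ((condExp_congr_ae (h1.trans h3)).trans (h2.trans h4))

theorem condExp_splitDensity_dotProduct [ENNReal.HolderConjugate p q] (hts : t ≤ s)
    (hw : AEStronglyMeasurable[ℱ t] w P) (ha : a ∈ steppedDual P ℱ p q m t s w)
    (hb : b ∈ terminalDual P ℱ p q m s (wStep P ℱ t s a.1 (w + a.2)))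
    {u : Lp (Fin d → ℝ) p P} (hu : u ∈ Mt P ℱ p m t) :
    P[fun ω => splitDensity P ℱ t s w a b ω ⬝ᵥ u ω | ℱ t] =ᵐ[P] fun ω => w ω ⬝ᵥ u ω := by
  have hq : 1 ≤ q := ENNReal.HolderConjugate.one_le q p
  obtain ⟨hum, huM⟩ := mem_Mt.1 hu
  have hY := memLp_splitDensity hb
  have hI : ∀ i, Integrable (fun ω => splitDensity P ℱ t s w a b ω i * u ω i) P := fun i =>
    (hY.eval i).integrable_mul ((Lp.memLp u).eval i)
  have h1 : (fun ω => splitDensity P ℱ t s w a b ω ⬝ᵥ u ω) =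
      ∑ i, fun ω => splitDensity P ℱ t s w a b ω i * u ω i := by
    ext ω
    simp [dotProduct]
  have h2 : ∀ i : Fin d, P[fun ω => splitDensity P ℱ t s w a b ω i * u ω i | ℱ t] =ᵐ[P]
      fun ω => w ω i * u ω i := by
    intro i
    by_cases hi : (i : ℕ) < m
    · have h3 := condExp_mul_of_aestronglyMeasurable_right (m := ℱ t)
        (f := fun ω => splitDensity P ℱ t s w a b ω i) (g := fun ω => u ω i)
        ((continuous_apply i).comp_aestronglyMeasurable hum) (hI i) ((hY.eval i).integrable hq)
      refine h3.trans ?_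
      filter_upwards [condExp_splitDensity hq hts hw ha hb i hi] with ω hω
      rw [Pi.mul_apply, hω]
    · have h3 : (fun ω => splitDensity P ℱ t s w a b ω i * u ω i) =ᵐ[P] 0 := by
        filter_upwards [huM] with ω hω
        simp [hω i (not_lt.1 hi)]
      refine (condExp_congr_ae h3).trans ?_
      rw [condExp_zero]
      filter_upwards [huM] with ω hω
      simp [hω i (not_lt.1 hi)]
  rw [h1]
  refine (condExp_finsetSum (fun i _ => hI i) _).trans ?_
  filter_upwards [ae_all_iff.2 h2] with ω hω
  simp only [Finset.sum_apply, dotProduct]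
  exact Finset.sum_congr rfl fun i _ => hω i

end DualVariables

/-! ### Weak duality -/

section WeakDuality

variable {Ω : Type*} {mΩ : MeasurableSpace Ω} {P : Measure Ω} [IsProbabilityMeasure P]
  {ι : Type*} [LinearOrder ι] [OrderTop ι] {ℱ : Filtration ι mΩ} {d m : ℕ} {p q : ℝ≥0∞}
  [Fact (1 ≤ p)] [ENNReal.HolderConjugate p q]
  {t s : ι} {w : Ω → Fin d → ℝ}
  {R : Lp (Fin d → ℝ) p P → Set (Lp (Fin d → ℝ) p P)} {R0 : Ω → Set (Fin d → ℝ)}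
  {a b : (Fin d → Measure Ω) × (Ω → Fin d → ℝ)}

/-- By translativity R(X + u) = R(X) - u, which contains u - u = 0. -/
theorem add_mem_acceptance (hR : IsConditionalRiskMeasure P ℱ p m t R R0)
    {X u : Lp (Fin d → ℝ) p P} (hu : u ∈ R X) : X + u ∈ acceptance R := by
  rw [acceptance, Set.mem_ofPred_eq, hR.translative X u (hR.subset_eligible X hu)]
  exact ⟨u, hu, sub_self u⟩

theorem measurable_splitExpectation (X : Lp (Fin d → ℝ) p P) :
    Measurable (splitExpectation ℱ t s w a b X) :=
  measurable_coe_real_ereal.comp (stronglyMeasurable_condExp.measurable.mono (ℱ.le t) le_rfl)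

theorem measurable_beta : Measurable (beta ℱ t s R w a b) :=
  (isFamilyEssSup_familyEssSup P _).measurable

theorem measurable_dualValue (X : Lp (Fin d → ℝ) p P) :
    Measurable (dualValue ℱ t s R w a b X) :=
  measurable_beta.neg.add (measurable_splitExpectation X)

/-- Weak duality. -/
theorem dualValue_le_scalarization (hR : IsConditionalRiskMeasure P ℱ p m t R R0) (hts : t ≤ s)
    (hw : AEStronglyMeasurable[ℱ t] w P) (ha : a ∈ steppedDual P ℱ p q m t s w)
    (hb : b ∈ terminalDual P ℱ p q m s (wStep P ℱ t s a.1 (w + a.2))) (X : Lp (Fin d → ℝ) p P) :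
    dualValue ℱ t s R w a b X ≤ᵐ[P] scalarization P R w X := by
  have key : ∀ u ∈ R X, dualValue ℱ t s R w a b X ≤ᵐ[P]
      fun ω => ((w ω ⬝ᵥ u ω : ℝ) : EReal) := by
    intro u hu
    have hY := memLp_splitDensity hb
    have hneg : ∀ X : Lp (Fin d → ℝ) p P,
        P[fun ω => splitDensity P ℱ t s w a b ω ⬝ᵥ -(X ω) | ℱ t] =ᵐ[P]
          -P[fun ω => splitDensity P ℱ t s w a b ω ⬝ᵥ X ω | ℱ t] := fun X => by
      refine EventuallyEq.trans (condExp_congr_ae (ae_of_all _ fun ω => ?_)) (condExp_neg _ _)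
      simp
    have hadd : P[fun ω => splitDensity P ℱ t s w a b ω ⬝ᵥ (X + u : Lp (Fin d → ℝ) p P) ω | ℱ t]
        =ᵐ[P] P[fun ω => splitDensity P ℱ t s w a b ω ⬝ᵥ X ω | ℱ t] +
          P[fun ω => splitDensity P ℱ t s w a b ω ⬝ᵥ u ω | ℱ t] := by
      refine EventuallyEq.trans (condExp_congr_ae ?_) (condExp_add
        (integrable_dotProduct hY (Lp.memLp X)) (integrable_dotProduct hY (Lp.memLp u)) _)
      filter_upwards [Lp.coeFn_add X u] with ω hω
      simp only [hω, Pi.add_apply, dotProduct_add]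
    have hβ := (isFamilyEssSup_familyEssSup P
      {f | ∃ Z ∈ acceptance R, f = splitExpectation ℱ t s w a b Z}).upper _
        ⟨X + u, add_mem_acceptance hR hu, rfl⟩
    filter_upwards [hβ, hneg (X + u), hneg X, hadd, condExp_splitDensity_dotProduct hts hw ha hb
      (hR.subset_eligible X hu)] with ω h1 h2 h3 h4 h5
    rw [splitExpectation, h2, Pi.neg_apply, h4, Pi.add_apply, h5] at h1
    simp only [dualValue, splitExpectation]
    rw [h3, Pi.neg_apply]
    set x := (P[fun ω => splitDensity P ℱ t s w a b ω ⬝ᵥ X ω | ℱ t]) ω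
    calc -beta ℱ t s R w a b ω + ((-x : ℝ) : EReal)
        ≤ -((-(x + w ω ⬝ᵥ u ω) : ℝ) : EReal) + ((-x : ℝ) : EReal) :=
          add_le_add_left (EReal.neg_le_neg_iff.2 h1) _
      _ = ((w ω ⬝ᵥ u ω : ℝ) : EReal) := by
          rw [← EReal.coe_neg, ← EReal.coe_add]
          congr 1
          ring
  have h1 := (isFamilyEssSup_familyEssSup P {f | ∃ g ∈ {f | ∃ u ∈ R X,
      f = fun ω => ((w ω ⬝ᵥ u ω : ℝ) : EReal)}, f = fun ω' => -g ω'}).least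
    (fun ω => -dualValue ℱ t s R w a b X ω) (measurable_dualValue X).neg.aemeasurable (by
      rintro _ ⟨_, ⟨u, hu, rfl⟩, rfl⟩
      filter_upwards [key u hu] with ω hω
      exact EReal.neg_le_neg_iff.2 hω)
  filter_upwards [h1] with ω hω
  exact EReal.le_neg_of_le_neg hω

end WeakDuality

/-! ### The expected scalarization and its affine minorants -/

section Scalarization

variable {Ω : Type*} {mΩ : MeasurableSpace Ω} {P : Measure Ω} [IsProbabilityMeasure P]
  {ι : Type*} [LinearOrder ι] {ℱ : Filtration ι mΩ} {d m : ℕ} {p q : ℝ≥0∞}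
  [Fact (1 ≤ p)] [ENNReal.HolderConjugate p q] {t : ι} {w : Ω → Fin d → ℝ}
  {R : Lp (Fin d → ℝ) p P → Set (Lp (Fin d → ℝ) p P)} {R0 : Ω → Set (Fin d → ℝ)}

/-- The indicator of an F_t-event is an admissible weight, so conditional convexity contains
locality. -/
theorem ConditionallyConvex.glue_mem (hconv : ConditionallyConvex ℱ t R) {B : Set Ω}
    (hB : MeasurableSet[ℱ t] B) {X Y Z u v z : Lp (Fin d → ℝ) p P} (hu : u ∈ R X) (hv : v ∈ R Y)
    (hZ : Z =ᵐ[P] fun ω => B.indicator X ω + Bᶜ.indicator Y ω)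
    (hz : z =ᵐ[P] fun ω => B.indicator u ω + Bᶜ.indicator v ω) : z ∈ R Z := by
  have h : ∀ f g : Ω → Fin d → ℝ, (fun ω => B.indicator f ω + Bᶜ.indicator g ω) =
      fun ω => B.indicator (1 : Ω → ℝ) ω • f ω + (1 - B.indicator (1 : Ω → ℝ) ω) • g ω := by
    intro f g
    ext ω : 1
    by_cases hω : ω ∈ B <;> simp [hω]
  rw [h] at hZ hz
  refine hconv X Y Z (B.indicator 1)
    (stronglyMeasurable_one.indicator hB).aestronglyMeasurable (ae_of_all _ fun ω => ?_) hZ u hu v hv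
    z hz
  by_cases hω : ω ∈ B <;> simp [hω]

theorem scalarization_measurable {X : Lp (Fin d → ℝ) p P} : Measurable (scalarization P R w X) :=
  (isFamilyEssSup_familyEssSup P _).measurable.neg

theorem scalarization_le {X u : Lp (Fin d → ℝ) p P} (hu : u ∈ R X) :
    scalarization P R w X ≤ᵐ[P] fun ω => ((w ω ⬝ᵥ u ω : ℝ) : EReal) := by
  have h := (isFamilyEssSup_familyEssSup P {f | ∃ g ∈ {f | ∃ u ∈ R X,
      f = fun ω => ((w ω ⬝ᵥ u ω : ℝ) : EReal)}, f = fun ω' => -g ω'}).upper _ ⟨_, ⟨u, hu, rfl⟩, rfl⟩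
  filter_upwards [h] with ω hω
  exact EReal.neg_le_of_neg_le hω

theorem le_scalarization {X : Lp (Fin d → ℝ) p P} {h : Ω → EReal} (hm : AEMeasurable h P)
    (hle : ∀ u ∈ R X, h ≤ᵐ[P] fun ω => ((w ω ⬝ᵥ u ω : ℝ) : EReal)) :
    h ≤ᵐ[P] scalarization P R w X := by
  have h1 := (isFamilyEssSup_familyEssSup P {f | ∃ g ∈ {f | ∃ u ∈ R X,
      f = fun ω => ((w ω ⬝ᵥ u ω : ℝ) : EReal)}, f = fun ω' => -g ω'}).least
    (fun ω => -h ω) hm.neg (by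
      rintro _ ⟨_, ⟨u, hu, rfl⟩, rfl⟩
      filter_upwards [hle u hu] with ω hω
      exact EReal.neg_le_neg_iff.2 hω)
  filter_upwards [h1] with ω hω
  exact EReal.le_neg_of_le_neg hω

/-- The expected scalarization is the infimum of the expected scalar costs. -/
theorem exists_mem_integral_lt (hR : IsConditionalRiskMeasure P ℱ p m t R R0)
    (hconv : ConditionallyConvex ℱ t R) (hwm : AEStronglyMeasurable[ℱ t] w P) (hwq : MemLp w q P)
    {X : Lp (Fin d → ℝ) p P} {g : Ω → ℝ} (hg : Integrable g P)
    (hgX : scalarization P R w X =ᵐ[P] fun ω => (g ω : EReal)) {ε : ℝ} (hε : 0 < ε) :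
    ∃ u ∈ R X, pairing p hwq u < ∫ ω, g ω ∂P + ε := by
  by_contra! hcon
  have hI : ∀ u : Lp (Fin d → ℝ) p P, Integrable (fun ω => w ω ⬝ᵥ u ω) P := fun u =>
    integrable_dotProduct hwq (Lp.memLp u)
  have hne : (R X).Nonempty := by
    by_contra! hemp
    have h1 : (fun _ => ⊤ : Ω → EReal) ≤ᵐ[P] scalarization P R w X :=
      le_scalarization aemeasurable_const fun u hu => by simp [hemp] at hu
    obtain ⟨ω, h2, h3⟩ := (h1.and hgX).exists
    rw [h3] at h2
    exact EReal.coe_ne_top _ (top_le_iff.1 h2)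
  -- Gluing the cheaper of two portfolios makes F directed. If every expected cost were at least
  -- E[g] + ε, an integrable bound h of F would give -h ≤ g, while E[-h] ≥ E[g] + ε.
  let F : Set (Ω → ℝ) := {f | ∃ u ∈ R X, f = fun ω => -(w ω ⬝ᵥ u ω)}
  obtain ⟨h, hhI, hha, hhF⟩ := exists_integrable_upper_bound (P := P) (F := F)
    (a := -(∫ ω, g ω ∂P + ε)) (by obtain ⟨u, hu⟩ := hne; exact ⟨_, u, hu, rfl⟩)
    (by rintro _ ⟨u, -, rfl⟩; exact (hI u).neg)
    (by
      rintro _ ⟨u, hu, rfl⟩ _ ⟨v, hv, rfl⟩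
      have hmu := aestronglyMeasurable_dotProduct hwm (mem_Mt.1 (hR.subset_eligible X hu)).1
      have hmv := aestronglyMeasurable_dotProduct hwm (mem_Mt.1 (hR.subset_eligible X hv)).1
      let B : Set Ω := {ω | (hmu.mk _ - hmv.mk _) ω ≤ 0}
      have hB : MeasurableSet[ℱ t] B :=
        (hmu.stronglyMeasurable_mk.sub hmv.stronglyMeasurable_mk).measurable measurableSet_Iic
      obtain ⟨z, hz⟩ := exists_glue B (ℱ.le t _ hB) u v
      have hzR : z ∈ R X := hconv.glue_mem hB hu hv (ae_of_all _ fun ω => by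
        by_cases hω : ω ∈ B <;> simp [hω]) hz
      refine ⟨_, ⟨z, hzR, rfl⟩, ?_, ?_⟩
      all_goals
        filter_upwards [hz, hmu.ae_eq_mk, hmv.ae_eq_mk] with ω h1 h2 h3
        rw [h1]
        by_cases hω : ω ∈ B
        · have hω' : hmu.mk _ ω - hmv.mk _ ω ≤ 0 := hω
          rw [← h2, ← h3] at hω'
          simp only [Set.indicator_of_mem hω, Set.indicator_of_notMem (Set.notMem_compl_iff.2 hω),
            add_zero]
          linarith
        · have hω' : ¬ hmu.mk _ ω - hmv.mk _ ω ≤ 0 := hω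
          rw [← h2, ← h3] at hω'
          have hωc : ω ∈ Bᶜ := hω
          simp only [Set.indicator_of_notMem hω, Set.indicator_of_mem hωc, zero_add]
          linarith)
    (by
      rintro _ ⟨u, hu, rfl⟩
      have := hcon u hu
      rw [pairing_apply] at this
      rw [integral_neg]
      linarith)
  have h1 : (fun ω => ((-h ω : ℝ) : EReal)) ≤ᵐ[P] scalarization P R w X := by
    refine le_scalarization hhI.1.aemeasurable.neg.coe_real_ereal fun u hu => ?_
    filter_upwards [hhF _ ⟨u, hu, rfl⟩] with ω hω
    exact EReal.coe_le_coe_iff.2 (by linarith)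
  have h2 : (fun ω => -h ω) ≤ᵐ[P] g := by
    filter_upwards [h1, hgX] with ω h1 h2
    rw [h2] at h1
    exact EReal.coe_le_coe_iff.1 h1
  have h3 := integral_mono_ae hhI.neg hg h2
  simp only [Pi.neg_apply, integral_neg] at h3
  linarith

theorem integral_le_pairing (hwq : MemLp w q P) {X u : Lp (Fin d → ℝ) p P} (hu : u ∈ R X)
    {g : Ω → ℝ} (hg : Integrable g P)
    (hgX : scalarization P R w X =ᵐ[P] fun ω => (g ω : EReal)) :
    ∫ ω, g ω ∂P ≤ pairing p hwq u := by
  refine integral_mono_ae hg (integrable_dotProduct hwq (Lp.memLp u)) ?_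
  filter_upwards [scalarization_le (w := w) hu, hgX] with ω h1 h2
  rw [h2] at h1
  exact EReal.coe_le_coe_iff.1 h1

/-- The expected scalarization is supported, up to any `ε`, by an affine functional given by a
nonnegative random vector `Y ∈ L^q` whose conditional expectation agrees with `w` on the eligible
assets. -/
theorem exists_affine_minorant (hR : IsConditionalRiskMeasure P ℱ p m t R R0)
    (hconv : ConditionallyConvex ℱ t R) (hcuc : ConvexUpperContinuous ℱ m t R)
    (hw : MemLt P ℱ q t (fun _ => dualCone (eligiblePos d m) \ orth (eligible d m)) w)
    {g : Lp (Fin d → ℝ) p P → Ω → ℝ} (hg : ∀ X, Integrable (g X) P)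
    (hgX : ∀ X, scalarization P R w X =ᵐ[P] fun ω => (g X ω : EReal))
    (X : Lp (Fin d → ℝ) p P) {ε : ℝ} (hε : 0 < ε) :
    ∃ (Y : Ω → Fin d → ℝ) (hY : MemLp Y q P) (c : ℝ), (∀ᵐ ω ∂P, 0 ≤ Y ω) ∧
      (∀ i : Fin d, (i : ℕ) < m → P[fun ω => Y ω i | ℱ t] =ᵐ[P] fun ω => w ω i) ∧
      (∀ Z ∈ acceptance R, -pairing p hY Z ≤ -c) ∧
      -pairing p hY X + c = ∫ ω, g X ω ∂P - ε := by
  obtain ⟨hwm, hwq, hwv⟩ := hw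
  let φ : Lp (Fin d → ℝ) p P → ℝ := fun X => ∫ ω, g X ω ∂P
  have hup : ∀ {X u}, u ∈ R X → φ X ≤ pairing p hwq u := fun hu =>
    integral_le_pairing hwq hu (hg _) (hgX _)
  have hlow : ∀ X {ε : ℝ}, 0 < ε → ∃ u ∈ R X, pairing p hwq u < φ X + ε := fun X ε hε =>
    exists_mem_integral_lt hR hconv hwm hwq (hg X) (hgX X) hε
  have hmono : ∀ X Y : Lp (Fin d → ℝ) p P,
      (∀ᵐ ω ∂P, 0 ≤ (Y - X : Lp (Fin d → ℝ) p P) ω) → φ Y ≤ φ X := fun X Y h => by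
    refine le_of_forall_pos_le_add fun ε hε => ?_
    obtain ⟨u, hu, hu'⟩ := hlow X hε
    exact (hup (hR.monotone X Y h hu)).trans hu'.le
  have htrans : ∀ k ∈ Mt P ℱ p m t, φ k ≤ φ 0 - pairing p hwq k := fun k hk => by
    refine le_of_forall_pos_le_add fun ε hε => ?_
    obtain ⟨u, hu, hu'⟩ := hlow 0 hε
    have h1 : u - k ∈ R k := by
      have h2 := hR.translative 0 k hk
      rw [zero_add] at h2
      rw [h2]
      exact ⟨u, hu, rfl⟩
    have h3 := hup h1
    rw [map_sub] at h3
    linarith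
  have hconvex : ConvexOn ℝ Set.univ φ := by
    refine ⟨convex_univ, fun X _ Y _ a b ha hb hab => le_of_forall_pos_le_add fun ε hε => ?_⟩
    obtain ⟨u, hu, hu'⟩ := hlow X hε
    obtain ⟨v, hv, hv'⟩ := hlow Y hε
    have h1 := hup (hconv.combo_mem hu hv ha hb hab)
    rw [map_add, map_smul, map_smul] at h1
    simp only [smul_eq_mul] at h1 ⊢
    nlinarith [mul_le_mul_of_nonneg_left hu'.le ha, mul_le_mul_of_nonneg_left hv'.le hb]
  let := lpTopology (d := d) P p
  have := isTopologicalAddGroup_lpTopology (d := d) (P := P) (p := p)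
  have := continuousSMul_lpTopology (d := d) (P := P) (p := p)
  have := locallyConvexSpace_lpTopology (d := d) (P := P) (p := p)
  have hlsc : LowerSemicontinuous φ := by
    rw [lowerSemicontinuous_iff_isClosed_preimage]
    intro c
    -- The infimum defining φ need not be attained, hence the slack 1/(n+1) when a sublevel set of φ
    -- is written with these test sets.
    let D : ℝ → Set (Lp (Fin d → ℝ) p P) := fun c => Mt P ℱ p m t ∩ {u | pairing p hwq u ≤ c}
    have hD : ∀ c, D c ∈ lowerClosedConvex P ℱ p m t := fun c => by
      refine mem_lowerClosedConvex Set.inter_subset_left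
        (convex_Mt.inter (convex_halfSpace_le (pairing p hwq).isLinear c))
        (isClosed_Mt.inter (isClosed_le (continuous_pairing hwq) continuous_const)) ?_
      rintro u ⟨huM, hu⟩ e he
      refine ⟨?_, ?_⟩
      · rw [sub_eq_add_neg]
        exact add_mem_Mt huM (neg_mem_Mt (mem_MtPos.1 he).1)
      · have h1 : 0 ≤ pairing p hwq e := by
          rw [pairing_apply]
          refine integral_nonneg_of_ae ?_
          have he' : ∀ᵐ ω ∂P, e ω ∈ eligiblePos d m := he.2.2
          filter_upwards [hwv, he'] with ω h1 h2 using h1.1 _ h2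
        simp only [Set.mem_ofPred_eq] at hu ⊢
        rw [map_sub]
        linarith
    have h1 : φ ⁻¹' Set.Iic c = ⋂ n : ℕ, {X | (R X ∩ D (c + 1 / ((n : ℝ) + 1))).Nonempty} := by
      ext X
      simp only [Set.mem_preimage, Set.mem_Iic, Set.mem_iInter, Set.mem_ofPred_eq]
      constructor
      · intro h n
        obtain ⟨u, hu, hu'⟩ := hlow X (show (0 : ℝ) < 1 / ((n : ℝ) + 1) by positivity)
        refine ⟨u, hu, hR.subset_eligible X hu, ?_⟩
        simp only [Set.mem_ofPred_eq]
        linarith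
      · intro h
        have h2 : ∀ n : ℕ, φ X ≤ c + 1 / ((n : ℝ) + 1) := fun n => by
          obtain ⟨u, hu, -, hu'⟩ := h n
          exact (hup hu).trans hu'
        have h3 : Tendsto (fun n : ℕ => c + 1 / ((n : ℝ) + 1)) atTop (nhds (c + 0)) :=
          tendsto_const_nhds.add tendsto_one_div_add_atTop_nhds_zero_nat
        rw [add_zero] at h3
        exact ge_of_tendsto' h3 h2
    rw [h1]
    exact isClosed_iInter fun n => hcuc _ (hD _)
  obtain ⟨l, c, hlc, hlX⟩ := ConvexOn.exists_affine_le_of_lt (𝕜 := ℝ) (s := Set.univ)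
    (Set.mem_univ X) (show φ X - ε < φ X by linarith) isClosed_univ
    (lowerSemicontinuousOn_univ_iff.2 hlsc) hconvex
  have hl : ∀ Z, l Z + c ≤ φ Z := fun Z => by simpa using hlc ⟨Z, Set.mem_univ Z⟩
  have hlX' : l X + c = φ X - ε := by simpa using hlX
  -- Along the ray n Z, φ stays below φ(0) by monotonicity, so its affine minorant cannot increase
  -- there.
  have hlneg : ∀ Z : Lp (Fin d → ℝ) p P, (∀ᵐ ω ∂P, 0 ≤ Z ω) → l Z ≤ 0 := by
    intro Z hZ
    by_contra! hpos
    obtain ⟨n, hn⟩ := exists_nat_gt ((φ 0 - c) / l Z)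
    rw [div_lt_iff₀ hpos] at hn
    have h1 := hl ((n : ℝ) • Z)
    rw [map_smul, smul_eq_mul] at h1
    have h2 : φ ((n : ℝ) • Z) ≤ φ 0 := hmono _ _ (by
      rw [sub_zero]
      filter_upwards [hZ, Lp.coeFn_smul (n : ℝ) Z] with ω h3 h4
      rw [h4]
      exact fun i => mul_nonneg (Nat.cast_nonneg (α := ℝ) n) (h3 i))
    linarith
  obtain ⟨Y, hY, hlY⟩ := exists_pairing_of_positive (q := q) (-l.toLinearMap)
    (show Continuous fun Z => -l Z from l.continuous.neg) fun Z hZ => neg_nonneg.2 (hlneg Z hZ)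
  have hlY' : ∀ Z, l Z = -pairing p hY Z := fun Z => by
    rw [← hlY, LinearMap.neg_apply, neg_neg]; rfl
  have hq1 : 1 ≤ q := ENNReal.HolderConjugate.one_le q p
  have hind : ∀ (A : Set Ω), MeasurableSet A → ∀ i : Fin d,
      MemLp (A.indicator fun _ => (Pi.single i 1 : Fin d → ℝ)) p P := fun A hA i =>
    memLp_indicator_const p hA _ (Or.inr (measure_ne_top P A))
  have hpind : ∀ {V : Ω → Fin d → ℝ} (hV : MemLp V q P) (A : Set Ω) (hA : MeasurableSet A)
      (i : Fin d), pairing p hV (hind A hA i).toLp = ∫ ω in A, V ω i ∂P := fun {V} hV A hA i => by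
    rw [pairing_apply, ← integral_indicator hA]
    refine integral_congr_ae ?_
    filter_upwards [(hind A hA i).coeFn_toLp] with ω hω
    rw [hω]
    by_cases h : ω ∈ A <;> simp [h]
  refine ⟨Y, hY, c, ?_, fun i hi => ?_, fun Z hZ => ?_, ?_⟩
  · have h1 : ∀ i, 0 ≤ᵐ[P] fun ω => Y ω i := fun i => by
      refine ae_nonneg_of_forall_setIntegral_nonneg ((hY.eval i).integrable hq1) fun A hA _ => ?_
      rw [← hpind hY A hA i]
      have h2 := hlneg (hind A hA i).toLp (by
        filter_upwards [(hind A hA i).coeFn_toLp] with ω hω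
        rw [hω]
        exact Set.indicator_nonneg (fun _ _ => Pi.single_nonneg.2 zero_le_one) _)
      rw [hlY'] at h2
      linarith
    filter_upwards [ae_all_iff.2 h1] with ω hω i using hω i
  · symm
    refine ae_eq_condExp_of_forall_setIntegral_eq (ℱ.le t) ((hY.eval i).integrable hq1)
      (fun A _ _ => ((hwq.eval i).integrable hq1).integrableOn) (fun A hA _ => ?_)
      ((continuous_apply i).comp_aestronglyMeasurable hwm)
    have hA' := ℱ.le t _ hA
    rw [← hpind hY A hA' i, ← hpind hwq A hA' i]
    set k : Lp (Fin d → ℝ) p P := (hind A hA' i).toLp with hk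
    have hkM : k ∈ Mt P ℱ p m t := by
      refine mem_Mt.2 ⟨(stronglyMeasurable_const.indicator hA).aestronglyMeasurable.congr
        (hind A hA' i).coeFn_toLp.symm, ?_⟩
      filter_upwards [(hind A hA' i).coeFn_toLp] with ω hω j hj
      rw [hω]
      have hji : j ≠ i := by rintro rfl; omega
      by_cases h : ω ∈ A <;> simp [h, hji]
    -- For eligible k = 1_A e_i and every real r, φ(rk) ≤ φ(0) - r E[wᵀk]. A linear function of r
    -- bounded above is zero, so Y_i and w_i have the same integral over every A ∈ F_t.
    have h1 : ∀ r : ℝ, r * (pairing p hwq k - pairing p hY k) ≤ φ 0 - c := fun r => by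
      have h2 := hl (r • k)
      have h3 := htrans (r • k) (smul_mem_Mt r hkM)
      rw [hlY', map_smul] at h2
      rw [map_smul] at h3
      simp only [smul_eq_mul] at h2 h3
      linarith
    by_contra hne
    have hne' := sub_ne_zero.2 hne
    have h2 := h1 ((φ 0 - c + 1) / (pairing p hwq k - pairing p hY k))
    rw [div_mul_cancel₀ _ hne'] at h2
    linarith
  · have h1 := hl Z
    have h2 := hup (show (0 : Lp (Fin d → ℝ) p P) ∈ R Z from hZ)
    rw [map_zero] at h2
    rw [hlY'] at h1
    linarith
  · rw [← hlY']
    exact hlX'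

end Scalarization

/-! ### Strong duality -/

section StrongDuality

variable {Ω : Type*} {mΩ : MeasurableSpace Ω} {P : Measure Ω} [IsProbabilityMeasure P]
  {ι : Type*} [LinearOrder ι] [OrderTop ι] {ℱ : Filtration ι mΩ} {d m : ℕ} {p q : ℝ≥0∞}
  [Fact (1 ≤ p)] [ENNReal.HolderConjugate p q] {t s : ι} {w : Ω → Fin d → ℝ}
  {R : Lp (Fin d → ℝ) p P → Set (Lp (Fin d → ℝ) p P)} {R0 : Ω → Set (Fin d → ℝ)}

theorem integral_dotProduct_neg {Y : Ω → Fin d → ℝ} (hY : MemLp Y q P)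
    (X : Lp (Fin d → ℝ) p P) : ∫ ω, Y ω ⬝ᵥ -(X ω) ∂P = -pairing p hY X := by
  rw [pairing_apply, ← integral_neg]
  simp

/-- The conditional expectations of the losses of acceptable positions form a directed family. -/
theorem directed_condExp_acceptance (hconv : ConditionallyConvex ℱ t R) {Y : Ω → Fin d → ℝ}
    (hY : MemLp Y q P) {Z₁ Z₂ : Lp (Fin d → ℝ) p P} (h₁ : Z₁ ∈ acceptance R)
    (h₂ : Z₂ ∈ acceptance R) :
    ∃ Z ∈ acceptance R,
      P[fun ω => Y ω ⬝ᵥ -(Z₁ ω) | ℱ t] ≤ᵐ[P] P[fun ω => Y ω ⬝ᵥ -(Z ω) | ℱ t] ∧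
      P[fun ω => Y ω ⬝ᵥ -(Z₂ ω) | ℱ t] ≤ᵐ[P] P[fun ω => Y ω ⬝ᵥ -(Z ω) | ℱ t] := by
  have hI : ∀ X : Lp (Fin d → ℝ) p P, Integrable (fun ω => Y ω ⬝ᵥ -(X ω)) P := fun X =>
    integrable_dotProduct hY (Lp.memLp X).neg
  set f₁ := P[fun ω => Y ω ⬝ᵥ -(Z₁ ω) | ℱ t] with hf₁
  set f₂ := P[fun ω => Y ω ⬝ᵥ -(Z₂ ω) | ℱ t] with hf₂
  -- Z₁ is used where its conditional loss is the larger one, Z₂ elsewhere; the glued position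
  -- remains acceptable by locality.
  let B : Set Ω := {ω | (f₂ - f₁) ω ≤ 0}
  have hfm : StronglyMeasurable[ℱ t] (f₂ - f₁) :=
    stronglyMeasurable_condExp.sub stronglyMeasurable_condExp
  have hB : MeasurableSet[ℱ t] B := hfm.measurable measurableSet_Iic
  obtain ⟨Z, hZ⟩ := exists_glue B (ℱ.le t _ hB) Z₁ Z₂
  have hZA : Z ∈ acceptance R := hconv.glue_mem hB h₁ h₂ hZ
    (ae_of_all _ fun ω => by by_cases hωB : ω ∈ B <;> simp [hωB])
  have hsum : P[fun ω => Y ω ⬝ᵥ -(Z ω) | ℱ t] =ᵐ[P] B.indicator f₁ + Bᶜ.indicator f₂ := by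
    have h1 : (fun ω => Y ω ⬝ᵥ -(Z ω)) =ᵐ[P] (B.indicator fun ω => Y ω ⬝ᵥ -(Z₁ ω)) +
        Bᶜ.indicator fun ω => Y ω ⬝ᵥ -(Z₂ ω) := by
      filter_upwards [hZ] with ω hω
      rw [hω]
      by_cases hωB : ω ∈ B <;> simp [hωB]
    refine (condExp_congr_ae h1).trans ((condExp_add ((hI Z₁).indicator (ℱ.le t _ hB))
      ((hI Z₂).indicator (ℱ.le t _ hB).compl) _).trans ?_)
    exact (condExp_indicator (hI Z₁) hB).add (condExp_indicator (hI Z₂) hB.compl)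
  refine ⟨Z, hZA, ?_, ?_⟩
  all_goals
    filter_upwards [hsum] with ω hω
    rw [hω]
    by_cases hωB : ω ∈ B
    · have h : f₂ ω - f₁ ω ≤ 0 := hωB
      simpa [hωB] using h
    · have h : ¬ f₂ ω - f₁ ω ≤ 0 := hωB
      simpa [hωB] using (not_le.1 h).le

/-- Strong duality in expectation, up to `ε`. -/
theorem exists_jointDual_le_dualValue (hℱ : ℱ ⊤ = mΩ) (hts : t ≤ s)
    (hR : IsConditionalRiskMeasure P ℱ p m t R R0)
    (hconv : ConditionallyConvex ℱ t R) (hcuc : ConvexUpperContinuous ℱ m t R)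
    (hw : MemLt P ℱ q t (fun _ => dualCone (eligiblePos d m) \ orth (eligible d m)) w)
    {g : Lp (Fin d → ℝ) p P → Ω → ℝ} (hg : ∀ X, Integrable (g X) P)
    (hgX : ∀ X, scalarization P R w X =ᵐ[P] fun ω => (g X ω : EReal))
    (X : Lp (Fin d → ℝ) p P) {ε : ℝ} (hε : 0 < ε) :
    ∃ c ∈ jointDual ℱ q m t s R w, ∃ k : Ω → ℝ, Integrable k P ∧
      ∫ ω, g X ω ∂P - ε ≤ ∫ ω, k ω ∂P ∧
      (fun ω => (k ω : EReal)) ≤ᵐ[P] dualValue ℱ t s R w c.1 c.2 X := by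
  obtain ⟨Y, hY, c, hY0, hYw, hacc, hval⟩ := exists_affine_minorant hR hconv hcuc hw hg hgX X hε
  obtain ⟨a, ha, b, hb, hab⟩ := exists_dual_variables (p := p) hℱ
    (ENNReal.HolderConjugate.one_le q p) hts hw hY hY0 hYw
  have hE : ∀ Z : Lp (Fin d → ℝ) p P, P[fun ω => splitDensity P ℱ t s w a b ω ⬝ᵥ -(Z ω) | ℱ t]
      =ᵐ[P] P[fun ω => Y ω ⬝ᵥ -(Z ω) | ℱ t] := fun Z => condExp_congr_ae (by
    filter_upwards [hab] with ω hω
    rw [hω])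
  let F : Set (Ω → ℝ) := {f | ∃ Z ∈ acceptance R, f = P[fun ω => Y ω ⬝ᵥ -(Z ω) | ℱ t]}
  obtain ⟨h, hhI, hhc, hhF⟩ := exists_integrable_upper_bound (P := P) (F := F) (a := -c)
    (by
      obtain ⟨u, hu⟩ := hR.nonempty_zero
      exact ⟨_, _, add_mem_acceptance hR hu, rfl⟩)
    (by rintro _ ⟨Z, -, rfl⟩; exact integrable_condExp)
    (by
      rintro _ ⟨Z₁, h₁, rfl⟩ _ ⟨Z₂, h₂, rfl⟩
      obtain ⟨Z, hZ, hZ₁, hZ₂⟩ := directed_condExp_acceptance hconv hY h₁ h₂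
      exact ⟨_, ⟨Z, hZ, rfl⟩, hZ₁, hZ₂⟩)
    (by
      rintro _ ⟨Z, hZ, rfl⟩
      rw [integral_condExp (ℱ.le t), integral_dotProduct_neg hY]
      exact hacc Z hZ)
  -- This bound with E[h] ≤ -c gives both membership in the joint dual set and E[k] ≥ c - E[YᵀX],
  -- which is the minorant's value at X.
  have hbeta : beta ℱ t s R w a b ≤ᵐ[P] fun ω => (h ω : EReal) := by
    refine (isFamilyEssSup_familyEssSup P _).least _ hhI.1.aemeasurable.coe_real_ereal ?_
    rintro _ ⟨Z, hZ, rfl⟩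
    filter_upwards [hE Z, hhF _ ⟨Z, hZ, rfl⟩] with ω h1 h2
    rw [splitExpectation, h1]
    exact EReal.coe_le_coe_iff.2 h2
  refine ⟨(a, b), ⟨ha, hb, ?_⟩, fun ω => -h ω + (P[fun ω => Y ω ⬝ᵥ -(X ω) | ℱ t]) ω,
    hhI.neg.add integrable_condExp, ?_, ?_⟩
  · refine lt_of_le_of_lt (lintegral_mono_ae ?_) hhI.lintegral_lt_top
    filter_upwards [hbeta] with ω hω
    exact EReal.toENNReal_le_toENNReal hω
  · have h1 : ∫ ω, (-h ω + (P[fun ω => Y ω ⬝ᵥ -(X ω) | ℱ t]) ω) ∂P =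
        -∫ ω, h ω ∂P + -pairing p hY X := by
      refine (integral_add hhI.neg integrable_condExp).trans ?_
      rw [integral_condExp (ℱ.le t), integral_dotProduct_neg hY]
      simp only [Pi.neg_apply, integral_neg]
    rw [h1]
    linarith
  · filter_upwards [hbeta, hE X] with ω h1 h2
    rw [dualValue, splitExpectation, h2, EReal.coe_add, EReal.coe_neg]
    exact add_le_add (EReal.neg_le_neg_iff.2 h1) le_rfl

/-- An extended real random variable below `f` that dominates integrable ones whose integrals come
arbitrarily close to that of `f` equals `f`. -/
theorem ae_eq_coe_of_forall_exists_integral {f : Ω → ℝ} (hf : Integrable f P) {G : Ω → EReal}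
    (hG : Measurable G) (hle : G ≤ᵐ[P] fun ω => (f ω : EReal))
    (happ : ∀ ε : ℝ, 0 < ε → ∃ k : Ω → ℝ, Integrable k P ∧ ∫ ω, f ω ∂P - ε ≤ ∫ ω, k ω ∂P ∧
      (fun ω => (k ω : EReal)) ≤ᵐ[P] G) :
    G =ᵐ[P] fun ω => (f ω : EReal) := by
  obtain ⟨k, hk, -, hkG⟩ := happ 1 one_pos
  have hreal : G =ᵐ[P] fun ω => ((G ω).toReal : EReal) := by
    filter_upwards [hle, hkG] with ω h1 h2
    refine (EReal.coe_toReal (fun h => ?_) fun h => ?_).symm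
    · rw [h] at h1
      exact EReal.coe_ne_top _ (top_le_iff.1 h1)
    · rw [h] at h2
      exact EReal.coe_ne_bot _ (le_bot_iff.1 h2)
  have hle' : (fun ω => (G ω).toReal) ≤ᵐ[P] f := by
    filter_upwards [hle, hreal] with ω h1 h2
    rw [h2] at h1
    exact EReal.coe_le_coe_iff.1 h1
  have hlow : ∀ {k : Ω → ℝ}, (fun ω => (k ω : EReal)) ≤ᵐ[P] G →
      k ≤ᵐ[P] fun ω => (G ω).toReal := fun h => by
    filter_upwards [h, hreal] with ω h1 h2
    rw [h2] at h1
    exact EReal.coe_le_coe_iff.1 h1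
  have hGI : Integrable (fun ω => (G ω).toReal) P :=
    integrable_of_le_of_le hG.ereal_toReal.aestronglyMeasurable (hlow hkG) hle' hk hf
  have hint : ∫ ω, f ω ∂P ≤ ∫ ω, (G ω).toReal ∂P := le_of_forall_pos_le_add fun ε hε => by
    obtain ⟨k, hk, hkε, hkG⟩ := happ ε hε
    have := integral_mono_ae hk hGI (hlow hkG)
    linarith
  have heq := (integral_eq_iff_of_ae_le hGI hf hle').1
    (le_antisymm (integral_mono_ae hGI hf hle') hint)
  filter_upwards [hreal, heq] with ω h1 h2
  rw [h1, h2]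

end StrongDuality

end RiskMeasure

theorem proposition3p7
    {Ω : Type*} {mΩ : MeasurableSpace Ω} (P : Measure Ω) [IsProbabilityMeasure P]
    {ι : Type*} [LinearOrder ι] [OrderTop ι] (ℱ : Filtration ι mΩ) (hℱ : ℱ ⊤ = mΩ)
    (p q : ℝ≥0∞) [Fact (1 ≤ p)] [ENNReal.HolderConjugate p q]
    (d m : ℕ) (hm : 1 ≤ m) (hmd : m ≤ d) (t s : ι) (hts : t ≤ s)
    (R : Lp (Fin d → ℝ) p P → Set (Lp (Fin d → ℝ) p P)) (R0 : Ω → Set (Fin d → ℝ))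
    (hR : RiskMeasure.IsConditionalRiskMeasure P ℱ p m t R R0)
    (hnorm : RiskMeasure.Normalized R)
    (hconv : RiskMeasure.ConditionallyConvex ℱ t R)
    (hcuc : RiskMeasure.ConvexUpperContinuous ℱ m t R)
    (hint : RiskMeasure.IntegrableScalarizations P ℱ q m t R R0)
    (w : Ω → Fin d → ℝ)
    (hw : RiskMeasure.MemLt P ℱ q t
      (fun _ => RiskMeasure.dualCone (RiskMeasure.eligiblePos d m) \
        RiskMeasure.orth (RiskMeasure.eligible d m)) w)
    (X : Lp (Fin d → ℝ) p P) :
    (RiskMeasure.scalarization P R w X =ᵐ[P]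
      familyEssSup P {f | ∃ a ∈ RiskMeasure.steppedDual P ℱ p q m t s w,
        f = familyEssSup P
          {g | ∃ b ∈ RiskMeasure.terminalDual P ℱ p q m s
              (RiskMeasure.wStep P ℱ t s a.1 (w + a.2)),
            g = RiskMeasure.dualValue ℱ t s R w a b X}}) ∧
    (RiskMeasure.scalarization P R w X =ᵐ[P]
      familyEssSup P {f | ∃ c ∈ RiskMeasure.jointDual ℱ q m t s R w,
        f = RiskMeasure.dualValue ℱ t s R w c.1 c.2 X}) := by
  choose g hg hgX using hint w (RiskMeasure.memLt_dualCone hR hnorm hconv hcuc hw)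
  have hweak : ∀ {a b}, a ∈ RiskMeasure.steppedDual P ℱ p q m t s w →
      b ∈ RiskMeasure.terminalDual P ℱ p q m s (RiskMeasure.wStep P ℱ t s a.1 (w + a.2)) →
      RiskMeasure.dualValue ℱ t s R w a b X ≤ᵐ[P] RiskMeasure.scalarization P R w X := fun ha hb =>
    RiskMeasure.dualValue_le_scalarization hR hts hw.1 ha hb X
  -- Both essential suprema lie below ρ and above every dual value over the joint dual set; any such
  -- G must equal ρ.
  have key : ∀ G : Ω → EReal, Measurable G → G ≤ᵐ[P] RiskMeasure.scalarization P R w X →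
      (∀ c ∈ RiskMeasure.jointDual ℱ q m t s R w, RiskMeasure.dualValue ℱ t s R w c.1 c.2 X ≤ᵐ[P] G) →
      RiskMeasure.scalarization P R w X =ᵐ[P] G := by
    intro G hG hGle hGc
    refine (hgX X).trans (RiskMeasure.ae_eq_coe_of_forall_exists_integral (hg X) hG
      (hGle.trans (hgX X).le) fun ε hε => ?_).symm
    obtain ⟨c, hc, k, hk, hkε, hkc⟩ :=
      RiskMeasure.exists_jointDual_le_dualValue hℱ hts hR hconv hcuc hw hg hgX X hε
    exact ⟨k, hk, hkε, hkc.trans (hGc c hc)⟩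
  have hm' : AEMeasurable (RiskMeasure.scalarization P R w X) P := RiskMeasure.scalarization_measurable.aemeasurable
  refine ⟨key _ (isFamilyEssSup_familyEssSup P _).measurable ?_ ?_,
    key _ (isFamilyEssSup_familyEssSup P _).measurable ?_ ?_⟩
  · refine (isFamilyEssSup_familyEssSup P _).least _ hm' ?_
    rintro _ ⟨a, ha, rfl⟩
    refine (isFamilyEssSup_familyEssSup P _).least _ hm' ?_
    rintro _ ⟨b, hb, rfl⟩
    exact hweak ha hb
  · intro c hc
    refine EventuallyLE.trans ?_ ((isFamilyEssSup_familyEssSup P _).upper _ ⟨c.1, hc.1, rfl⟩)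
    exact (isFamilyEssSup_familyEssSup P _).upper _ ⟨c.2, hc.2.1, rfl⟩
  · refine (isFamilyEssSup_familyEssSup P _).least _ hm' ?_
    rintro _ ⟨c, hc, rfl⟩
    exact hweak hc.1 hc.2.1
  · intro c hc
    exact (isFamilyEssSup_familyEssSup P _).upper _ ⟨c, hc, rfl⟩
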